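/- Let $\lambda$ be Lebesgue measure on $\mathbb R$ and let $W^{\infty,1}(\mathbb R)=\bigcap_k W^{k,1}(\mathbb R)$, with the Fréchet topology of the seminorms $\|f^{(k)}\|_{L^1}$. Let $$\mathfrak g=\{u: u'\in W^{\infty,1}(\mathbb R),\ \lim_{x\to-\infty}u(x)=0\},$$ with the topology of the seminorms $\|u^{(k+1)}\|_{L^1}$, $k\ge 0$, and let $$\widetilde{\operatorname{Diff}}(\mathbb R)=\{\varphi=\mathrm{id}+f: f\in\mathfrak g,\ f'>-1\},$$ a group under composition and, through $\varphi\mapsto\varphi-\mathrm{id}$, an open subset of $\mathfrak g$; its tangent vectors at $\varphi$ are $X=u\circ\varphi$ with $u\in\mathfrak g$. Let $\widetilde{\operatorname{Dens}}_+(\mathbb R)=\{h\lambda: h-1\in W^{\infty,1}(\mathbb R),\ h>0\}$, with tangent spaces $\{r\lambda: r\in W^{\infty,1}(\mathbb R)\}$. For $\alpha\in\mathbb R$ let $$G^{\alpha}_{\mu}(a,b)=\int\Big(\frac{\mu}{\lambda}\Big)^{-\alpha-1}\frac a\lambda\,\frac b\lambda\,\lambda,\qquad G^{\alpha\dot H^1}_\varphi(X,Y)=\int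 \varphi_x^{-\alpha-1}X_xY_x\,\lambda$$ be the $\alpha$-Fisher–Rao metric on $\widetilde{\operatorname{Dens}}_+(\mathbb R)$ and the $\alpha\dot H^1$ metric on $\widetilde{\operatorname{Diff}}(\mathbb R)$. **Theorem.** For every $\alpha\in\mathbb R$: 1. $G^{\alpha\dot H^1}$ is well defined (the integrals converge) and positive definite, and it is right-invariant, i.e. $G_{\varphi\circ\psi}(X\circ\psi,Y\circ\psi)=G_\varphi(X,Y)$ for all $\varphi,\psi,X,Y$, if and only if $\alpha=0$. 2. $G^{\alpha\dot H^1}$ is the pullback of $G^\alpha$ under $\Theta:\varphi\mapsto\varphi^*\lambda=(\varphi^{-1})_*\lambda$, which maps $\widetilde{\operatorname{Diff}}(\mathbb R)$ to $\widetilde{\operatorname{Dens}}_+(\mathbb R)$ and is differentiable. 3. The generalized Proudman–Johnson equation $$u_{txx}+(2-\alpha)u_xu_{xx}+uu_{xxx}=0$$ is the Euler–Arnold equation of $G^{\alpha\dot H^1}$: a $C^2$ curve $\varphi:[a,b]\to\widetilde{\operatorname{Diff}}(\mathbb R)$, $a<b$, is a geodesic (a critical point of the energy $\frac12\int_a^bG^{\alpha\dot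 H^1}_\varphi(\varphi_t,\varphi_t)\,dt$ with respect to $C^2$ variations $\varphi+sw$ fixing the end points) if and only if its Eulerian velocity $u=\varphi_t\circ\varphi^{-1}$ is a $C^1$ curve in $\mathfrak g$ that solves this equation. 4. The equation is globally well-posed on $\mathfrak g$ if and only if $\alpha=1$. Here global well-posedness means: for every $u_0\in\mathfrak g$ there is a solution $u\in C^1([0,\infty),\mathfrak g)$ with $u(0)=u_0$; any solution in $C^1([0,T],\mathfrak g)$, $T>0$, with the same initial value agrees with it on $[0,T]$; and $(u_0,t)\mapsto u(t)$ is continuous on $\mathfrak g\times[0,\infty)$. -/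

import Mathlib

open MeasureTheory Filter Set
open scoped Topology ContDiff

noncomputable section

namespace ProudmanJohnson

/-! ### Calculus helper facts: classes `I n` (integrable derivatives up to order `n`) and `B n`
(bounded derivatives up to order `n`). -/

/-- `f` is smooth and its derivatives of order at most `n` are integrable. -/
def I : ℕ → (ℝ → ℝ) → Prop
  | 0, f => ContDiff ℝ ∞ f ∧ Integrable f
  | n + 1, f => ContDiff ℝ ∞ f ∧ Integrable f ∧ I n (deriv f)

/-- `f` is smooth and its derivatives of order at most `n` are bounded. -/
def B : ℕ → (ℝ → ℝ) → Prop
  | 0, f => ContDiff ℝ ∞ f ∧ ∃ C, ∀ x, |f x| ≤ C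
  | n + 1, f => ContDiff ℝ ∞ f ∧ (∃ C, ∀ x, |f x| ≤ C) ∧ B n (deriv f)

/-- `f ∈ W^{∞,1}(ℝ) = ⋂ₖ W^{k,1}(ℝ)`. By the Sobolev embedding every class in this space has a
unique smooth representative, whose classical derivatives are its weak ones. -/
def MemW (f : ℝ → ℝ) : Prop :=
  ContDiff ℝ ∞ f ∧ ∀ k : ℕ, Integrable (iteratedDeriv k f)

theorem contDiff_deriv {f : ℝ → ℝ} (hf : ContDiff ℝ ∞ f) : ContDiff ℝ ∞ (deriv f) :=
  (contDiff_infty_iff_deriv.1 hf).2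

theorem diff_of {f : ℝ → ℝ} (hf : ContDiff ℝ ∞ f) : Differentiable ℝ f :=
  (contDiff_infty_iff_deriv.1 hf).1

theorem I.smooth {n : ℕ} {f : ℝ → ℝ} (h : I n f) : ContDiff ℝ ∞ f := by
  cases n with
  | zero => exact h.1
  | succ n => exact h.1

theorem I.int {n : ℕ} {f : ℝ → ℝ} (h : I n f) : Integrable f := by
  cases n with
  | zero => exact h.2
  | succ n => exact h.2.1

theorem B.smooth {n : ℕ} {f : ℝ → ℝ} (h : B n f) : ContDiff ℝ ∞ f := by
  cases n with
  | zero => exact h.1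
  | succ n => exact h.1

theorem B.bdd {n : ℕ} {f : ℝ → ℝ} (h : B n f) : ∃ C, ∀ x, |f x| ≤ C := by
  cases n with
  | zero => exact h.2
  | succ n => exact h.2.1

theorem I.pred {n : ℕ} {f : ℝ → ℝ} (h : I (n + 1) f) : I n f := by
  induction n generalizing f with
  | zero => exact ⟨h.1, h.2.1⟩
  | succ n ih => exact ⟨h.1, h.2.1, ih h.2.2⟩

theorem B.pred {n : ℕ} {f : ℝ → ℝ} (h : B (n + 1) f) : B n f := by
  induction n generalizing f with
  | zero => exact ⟨h.1, h.2.1⟩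
  | succ n ih => exact ⟨h.1, h.2.1, ih h.2.2⟩

theorem deriv_add' {f g : ℝ → ℝ} (hf : ContDiff ℝ ∞ f) (hg : ContDiff ℝ ∞ g) :
    deriv (fun x => f x + g x) = fun x => deriv f x + deriv g x := by
  funext x
  exact ((diff_of hf x).hasDerivAt.add (diff_of hg x).hasDerivAt).deriv

theorem deriv_mul' {f g : ℝ → ℝ} (hf : ContDiff ℝ ∞ f) (hg : ContDiff ℝ ∞ g) :
    deriv (fun x => f x * g x) = fun x => deriv f x * g x + f x * deriv g x := by
  funext x
  exact ((diff_of hf x).hasDerivAt.mul (diff_of hg x).hasDerivAt).deriv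

theorem I.add {n : ℕ} {f g : ℝ → ℝ} (hf : I n f) (hg : I n g) : I n (fun x => f x + g x) := by
  induction n generalizing f g with
  | zero => exact ⟨hf.1.add hg.1, hf.2.add hg.2⟩
  | succ n ih =>
    refine ⟨hf.1.add hg.1, hf.2.1.add hg.2.1, ?_⟩
    rw [deriv_add' hf.1 hg.1]
    exact ih hf.2.2 hg.2.2

theorem B.add {n : ℕ} {f g : ℝ → ℝ} (hf : B n f) (hg : B n g) : B n (fun x => f x + g x) := by
  have hb : ∃ C, ∀ x, |f x + g x| ≤ C := by
    obtain ⟨C, hC⟩ := hf.bdd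
    obtain ⟨D, hD⟩ := hg.bdd
    exact ⟨C + D, fun x => (abs_add_le _ _).trans (add_le_add (hC x) (hD x))⟩
  induction n generalizing f g with
  | zero => exact ⟨hf.1.add hg.1, hb⟩
  | succ n ih =>
    refine ⟨hf.1.add hg.1, hb, ?_⟩
    rw [deriv_add' hf.1 hg.1]
    refine ih hf.2.2 hg.2.2 ?_
    obtain ⟨C, hC⟩ := hf.2.2.bdd
    obtain ⟨D, hD⟩ := hg.2.2.bdd
    exact ⟨C + D, fun x => (abs_add_le _ _).trans (add_le_add (hC x) (hD x))⟩

theorem bdd_mul {f g : ℝ → ℝ} (hf : ∃ C, ∀ x, |f x| ≤ C) (hg : ∃ C, ∀ x, |g x| ≤ C) :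
    ∃ C, ∀ x, |f x * g x| ≤ C := by
  obtain ⟨C, hC⟩ := hf
  obtain ⟨D, hD⟩ := hg
  refine ⟨C * D, fun x => ?_⟩
  rw [abs_mul]
  exact mul_le_mul (hC x) (hD x) (abs_nonneg _) ((abs_nonneg _).trans (hC x))

theorem int_mul {f g : ℝ → ℝ} (hf : Integrable f) (hgc : Continuous g)
    (hg : ∃ C, ∀ x, |g x| ≤ C) : Integrable (fun x => f x * g x) := by
  obtain ⟨C, hC⟩ := hg
  exact hf.mul_bdd (c := C) hgc.aestronglyMeasurable
    (Eventually.of_forall fun x => by simpa [Real.norm_eq_abs] using hC x)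

theorem I.mul {n : ℕ} {f g : ℝ → ℝ} (hf : I n f) (hg : B n g) : I n (fun x => f x * g x) := by
  have hi := int_mul hf.int hg.smooth.continuous hg.bdd
  induction n generalizing f g with
  | zero => exact ⟨hf.1.mul hg.1, hi⟩
  | succ n ih =>
    refine ⟨hf.1.mul hg.1, hi, ?_⟩
    rw [deriv_mul' hf.1 hg.1]
    exact (ih hf.2.2 hg.pred (int_mul hf.2.2.int hg.1.continuous hg.2.1)).add
      (ih hf.pred hg.2.2 (int_mul hf.2.1 hg.2.2.smooth.continuous hg.2.2.bdd))

theorem B.mul {n : ℕ} {f g : ℝ → ℝ} (hf : B n f) (hg : B n g) : B n (fun x => f x * g x) := by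
  have hi := bdd_mul hf.bdd hg.bdd
  induction n generalizing f g with
  | zero => exact ⟨hf.1.mul hg.1, hi⟩
  | succ n ih =>
    refine ⟨hf.1.mul hg.1, hi, ?_⟩
    rw [deriv_mul' hf.1 hg.1]
    exact (ih hf.2.2 hg.pred (bdd_mul hf.2.2.bdd hg.2.1)).add
      (ih hf.pred hg.2.2 (bdd_mul hf.2.1 hg.2.2.bdd))

theorem B.const (n : ℕ) (c : ℝ) : B n (fun _ => c) := by
  induction n generalizing c with
  | zero => exact ⟨contDiff_const, |c|, fun _ => le_rfl⟩
  | succ n ih =>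
    refine ⟨contDiff_const, ⟨|c|, fun _ => le_rfl⟩, ?_⟩
    rw [deriv_const']
    exact ih 0

theorem inv_bdd {h : ℝ → ℝ} {c : ℝ} (hc : 0 < c) (hh : ∀ x, c ≤ h x) :
    ∃ C, ∀ x, |(h x)⁻¹| ≤ C := by
  refine ⟨c⁻¹, fun x => ?_⟩
  rw [abs_of_pos (inv_pos.2 (hc.trans_le (hh x)))]
  exact inv_anti₀ hc (hh x)

theorem B.inv {n : ℕ} {h : ℝ → ℝ} {c : ℝ} (hc : 0 < c) (hh : ∀ x, c ≤ h x) (hB : B n h) :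
    B n (fun x => (h x)⁻¹) := by
  have hs : ContDiff ℝ ∞ (fun x => (h x)⁻¹) :=
    hB.smooth.inv fun x => (hc.trans_le (hh x)).ne'
  induction n with
  | zero => exact ⟨hs, inv_bdd hc hh⟩
  | succ n ih =>
    refine ⟨hs, inv_bdd hc hh, ?_⟩
    have hd : deriv (fun x => (h x)⁻¹) =
        fun x => ((-1) * deriv h x) * ((h x)⁻¹ * (h x)⁻¹) := by
      funext x
      have e : deriv (fun x => (h x)⁻¹) x = -deriv h x / h x ^ 2 :=
        ((diff_of hB.1 x).hasDerivAt.inv (hc.trans_le (hh x)).ne').deriv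
      rw [e]
      have := (hc.trans_le (hh x)).ne'
      field_simp
    rw [hd]
    exact ((B.const n (-1)).mul hB.2.2).mul ((ih hB.pred).mul (ih hB.pred))

theorem memW_iff {f : ℝ → ℝ} : MemW f ↔ ∀ n, I n f := by
  constructor
  · intro h n
    induction n generalizing f with
    | zero => exact ⟨h.1, by simpa using h.2 0⟩
    | succ n ih =>
      exact ⟨h.1, by simpa using h.2 0, ih ⟨contDiff_deriv h.1, fun k => by
        have := h.2 (k + 1)
        rwa [iteratedDeriv_succ'] at this⟩⟩
  · intro h
    refine ⟨(h 0).1, fun k => ?_⟩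
    have := h k
    clear h
    induction k generalizing f with
    | zero => simpa using this.2
    | succ k ih =>
      rw [iteratedDeriv_succ']
      exact ih this.2.2

theorem MemW.der {f : ℝ → ℝ} (h : MemW f) : MemW (deriv f) :=
  memW_iff.2 fun n => ((memW_iff.1 h) (n + 1)).2.2

theorem MemW.int {f : ℝ → ℝ} (h : MemW f) : Integrable f := ((memW_iff.1 h) 0).2

theorem MemW.tendsto_atTop {f : ℝ → ℝ} (h : MemW f) : Tendsto f atTop (𝓝 0) :=
  tendsto_zero_of_hasDerivAt_of_integrableOn_Ioi (a := 0)
    (fun x _ => (diff_of h.1 x).hasDerivAt) h.der.int.integrableOn h.int.integrableOn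

theorem MemW.tendsto_atBot {f : ℝ → ℝ} (h : MemW f) : Tendsto f atBot (𝓝 0) :=
  tendsto_zero_of_hasDerivAt_of_integrableOn_Iic (a := 0)
    (fun x _ => (diff_of h.1 x).hasDerivAt) h.der.int.integrableOn h.int.integrableOn

theorem MemW.bdd {f : ℝ → ℝ} (h : MemW f) : ∃ C, ∀ x, |f x| ≤ C := by
  obtain ⟨a, ha⟩ := eventually_atTop.1 (h.tendsto_atTop.abs.eventually_le_const
    (show |(0 : ℝ)| < 1 by simp))
  obtain ⟨b, hb⟩ := eventually_atBot.1 (h.tendsto_atBot.abs.eventually_le_const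
    (show |(0 : ℝ)| < 1 by simp))
  obtain ⟨C, hC⟩ := (isCompact_Icc (a := b) (b := a)).exists_bound_of_continuousOn
    h.1.continuous.continuousOn
  refine ⟨max 1 C, fun x => ?_⟩
  by_cases h1 : a ≤ x
  · exact (ha x h1).trans (le_max_left _ _)
  by_cases h2 : x ≤ b
  · exact (hb x h2).trans (le_max_left _ _)
  · exact (hC x ⟨(not_le.1 h2).le, (not_le.1 h1).le⟩).trans (le_max_right _ _)

theorem MemW.toB {f : ℝ → ℝ} (h : MemW f) (n : ℕ) : B n f := by
  induction n generalizing f with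
  | zero => exact ⟨h.1, h.bdd⟩
  | succ n ih => exact ⟨h.1, h.bdd, ih h.der⟩

theorem MemW.mul {f g : ℝ → ℝ} (hf : MemW f) (hg : ∀ n, ProudmanJohnson.B n g) :
    MemW (fun x => f x * g x) :=
  memW_iff.2 fun n => ((memW_iff.1 hf) n).mul (hg n)

theorem MemW.add {f g : ℝ → ℝ} (hf : MemW f) (hg : MemW g) : MemW (fun x => f x + g x) :=
  memW_iff.2 fun n => ((memW_iff.1 hf) n).add ((memW_iff.1 hg) n)

theorem MemW.const_mul {f : ℝ → ℝ} (hf : MemW f) (c : ℝ) : MemW (fun x => c * f x) := by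
  have := hf.mul (fun n => B.const n c)
  simpa [mul_comm] using this

theorem memW_zero : MemW (fun _ => (0 : ℝ)) := by
  refine ⟨contDiff_const, fun k => ?_⟩
  have : iteratedDeriv k (fun _ : ℝ => (0 : ℝ)) = fun _ => 0 := by
    funext x
    rw [iteratedDeriv_const]
    split <;> rfl
  rw [this]
  exact integrable_zero _ _ _

theorem MemW.lower {f : ℝ → ℝ} (h : MemW f) (hf : ∀ x, -1 < f x) :
    ∃ c, 0 < c ∧ ∀ x, c ≤ 1 + f x := by
  obtain ⟨a, ha⟩ := eventually_atTop.1 (h.tendsto_atTop.eventually_const_le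
    (show (-(1 / 2) : ℝ) < 0 by norm_num))
  obtain ⟨b, hb⟩ := eventually_atBot.1 (h.tendsto_atBot.eventually_const_le
    (show (-(1 / 2) : ℝ) < 0 by norm_num))
  by_cases hab : b ≤ a
  · obtain ⟨z, -, hz⟩ := (isCompact_Icc (a := b) (b := a)).exists_isMinOn
      (nonempty_Icc.2 hab) h.1.continuous.continuousOn
    refine ⟨min (1 / 2) (1 + f z), lt_min (by norm_num) (by linarith [hf z]), fun x => ?_⟩
    by_cases h1 : a ≤ x
    · exact (min_le_left _ _).trans (by linarith [ha x h1])
    by_cases h2 : x ≤ b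
    · exact (min_le_left _ _).trans (by linarith [hb x h2])
    · have := hz (show x ∈ Icc b a from ⟨(not_le.1 h2).le, (not_le.1 h1).le⟩)
      simp only [mem_ofPred_eq] at this
      exact (min_le_right _ _).trans (by linarith)
  · refine ⟨1 / 2, by norm_num, fun x => ?_⟩
    rcases le_total a x with h1 | h1
    · linarith [ha x h1]
    · linarith [hb x (h1.trans (not_le.1 hab).le)]

theorem int_comp {f : ℝ → ℝ} {ψ : Equiv.Perm ℝ} {c : ℝ} (hf : Integrable f)
    (hfc : Continuous f) (hψ : Differentiable ℝ ψ) (hc : 0 < c) (hψc : ∀ x, c ≤ deriv ψ x) :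
    Integrable (fun x => f (ψ x)) := by
  have h := (integrableOn_image_iff_integrableOn_abs_deriv_smul (s := univ) (f := ψ)
    (f' := deriv ψ) MeasurableSet.univ (fun x _ => (hψ x).hasDerivAt.hasDerivWithinAt)
    ψ.injective.injOn f).1 (by simpa [ψ.surjective.range_eq] using hf)
  rw [integrableOn_univ] at h
  refine (h.norm.const_mul c⁻¹).mono' (hfc.comp hψ.continuous).aestronglyMeasurable
    (Eventually.of_forall fun x => ?_)
  have h0 : c ≤ |deriv ψ x| := (hψc x).trans (le_abs_self _)
  rw [norm_smul, Real.norm_eq_abs, Real.norm_eq_abs, abs_abs, ← mul_assoc]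
  refine le_mul_of_one_le_left (abs_nonneg _) ?_
  rw [inv_mul_eq_div, one_le_div hc]
  exact h0

theorem deriv_comp' {f : ℝ → ℝ} {ψ : ℝ → ℝ} (hf : ContDiff ℝ ∞ f) (hψ : ContDiff ℝ ∞ ψ) :
    deriv (fun x => f (ψ x)) = fun x => deriv f (ψ x) * deriv ψ x := by
  funext x
  exact ((diff_of hf (ψ x)).hasDerivAt.comp x (diff_of hψ x).hasDerivAt).deriv

theorem MemW.comp_perm {f : ℝ → ℝ} (hf : MemW f) {ψ : Equiv.Perm ℝ} {c : ℝ}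
    (hψ : ContDiff ℝ ∞ ψ) (hc : 0 < c) (hψc : ∀ x, c ≤ deriv ψ x)
    (hB : ∀ n, ProudmanJohnson.B n (deriv ψ)) : MemW (fun x => f (ψ x)) := by
  refine memW_iff.2 fun n => ?_
  induction n generalizing f with
  | zero => exact ⟨hf.1.comp hψ, int_comp hf.int hf.1.continuous (diff_of hψ) hc hψc⟩
  | succ n ih =>
    refine ⟨hf.1.comp hψ, int_comp hf.int hf.1.continuous (diff_of hψ) hc hψc, ?_⟩
    rw [deriv_comp' hf.1 hψ]
    exact (ih hf.der).mul (hB n)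

theorem MemW.comp_inv {f : ℝ → ℝ} (hf : MemW f) {ψ : Equiv.Perm ℝ} {c : ℝ} {b : ℝ → ℝ}
    (hψ : ContDiff ℝ ∞ ψ) (hc : 0 < c) (hψc : ∀ x, c ≤ deriv ψ x)
    (hb : ∀ x, deriv ψ x = b (ψ x)) (hB : ∀ n, ProudmanJohnson.B n b) :
    MemW (fun x => f (ψ x)) := by
  refine memW_iff.2 fun n => ?_
  induction n generalizing f with
  | zero => exact ⟨hf.1.comp hψ, int_comp hf.int hf.1.continuous (diff_of hψ) hc hψc⟩
  | succ n ih =>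
    refine ⟨hf.1.comp hψ, int_comp hf.int hf.1.continuous (diff_of hψ) hc hψc, ?_⟩
    rw [deriv_comp' hf.1 hψ]
    have := ih (hf.der.mul hB)
    simpa only [hb] using this

/-! ### The spaces `W^{∞,1}(ℝ)` and `𝔤` -/

/-- The Fréchet space `W^{∞,1}(ℝ)`. -/
def W : Submodule ℝ (ℝ → ℝ) where
  carrier := {f | MemW f}
  add_mem' hf hg := hf.add hg
  zero_mem' := memW_zero
  smul_mem' c _ hf := hf.const_mul c

/-- The seminorm `f ↦ ∫ |f^{(k)}|` on `W^{∞,1}(ℝ)`. -/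
def W.seminorm (k : ℕ) : Seminorm ℝ W :=
  Seminorm.of (fun f => ∫ x, |iteratedDeriv k (f : ℝ → ℝ) x|)
    (fun f g => by
      have h : ∀ x, iteratedDeriv k ((f + g : W) : ℝ → ℝ) x =
          iteratedDeriv k (f : ℝ → ℝ) x + iteratedDeriv k (g : ℝ → ℝ) x := fun x =>
        iteratedDeriv_add (f.2.1.contDiffAt.of_le (mod_cast le_top))
          (g.2.1.contDiffAt.of_le (mod_cast le_top))
      simp only [h]
      rw [← integral_add (f.2.2 k).abs (g.2.2 k).abs]
      exact integral_mono ((f.2.2 k).add (g.2.2 k)).abs ((f.2.2 k).abs.add (g.2.2 k).abs)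
        fun x => abs_add_le _ _)
    (fun c f => by
      have h : ∀ x, iteratedDeriv k ((c • f : W) : ℝ → ℝ) x =
          c * iteratedDeriv k (f : ℝ → ℝ) x := fun x => by
        change iteratedDeriv k (c • (f : ℝ → ℝ)) x = _
        rw [iteratedDeriv_const_smul_field]; rfl
      simp only [h, abs_mul, integral_const_mul, Real.norm_eq_abs])

/-- The family of seminorms defining the topology of `W^{∞,1}(ℝ)`. -/
def W.seminorms : SeminormFamily ℝ W ℕ := W.seminorm

instance : TopologicalSpace W := W.seminorms.moduleFilterBasis.topology

theorem W.withSeminorms : WithSeminorms W.seminorms := ⟨rfl⟩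

instance : IsTopologicalAddGroup W := W.withSeminorms.topologicalAddGroup

instance : ContinuousSMul ℝ W := W.withSeminorms.continuousSMul

/-- `u' ∈ W^{∞,1}(ℝ)` and `u(x) → 0` as `x → -∞`. -/
def MemG (u : ℝ → ℝ) : Prop :=
  Differentiable ℝ u ∧ MemW (deriv u) ∧ Tendsto u atBot (𝓝 0)

theorem MemG.smooth {u : ℝ → ℝ} (h : MemG u) : ContDiff ℝ ∞ u :=
  contDiff_infty_iff_deriv.2 ⟨h.1, h.2.1.1⟩

/-- The Fréchet space `𝔤`. -/
def G : Submodule ℝ (ℝ → ℝ) where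
  carrier := {u | MemG u}
  add_mem' {u v} hu hv := by
    refine ⟨hu.1.add hv.1, ?_, by
      have h := hu.2.2.add hv.2.2
      rw [add_zero] at h
      exact h⟩
    have := deriv_add' hu.smooth hv.smooth
    change MemW (deriv fun x => u x + v x)
    rw [this]
    exact hu.2.1.add hv.2.1
  zero_mem' := ⟨differentiable_const 0, by
    change MemW (deriv fun _ => (0 : ℝ))
    rw [deriv_const']; exact memW_zero, tendsto_const_nhds⟩
  smul_mem' c u hu := by
    refine ⟨hu.1.const_smul c, ?_, by
      have h := hu.2.2.const_mul c
      rw [mul_zero] at h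
      exact h⟩
    have : deriv (c • u) = fun x => c * deriv u x := by
      funext x
      exact ((hu.1 x).hasDerivAt.const_mul c).deriv
    rw [this]
    exact hu.2.1.const_mul c

/-- The derivative `u ↦ u'`, a linear isomorphism from `𝔤` to `W^{∞,1}(ℝ)`. -/
def G.D : G →ₗ[ℝ] W where
  toFun u := ⟨deriv (u : ℝ → ℝ), u.2.2.1⟩
  map_add' u v := Subtype.ext (deriv_add' u.2.smooth v.2.smooth)
  map_smul' c u := Subtype.ext (by
    funext x
    exact ((u.2.1 x).hasDerivAt.const_mul c).deriv)

/-- The topology of `𝔤`, given by the seminorms `u ↦ ∫ |u^{(k+1)}|`, `k ∈ ℕ`. -/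
instance : TopologicalSpace G := TopologicalSpace.induced G.D inferInstance

instance : IsTopologicalAddGroup G := topologicalAddGroup_induced G.D

instance : ContinuousSMul ℝ G := continuousSMul_induced G.D

/-! ### The group `Diff~(ℝ)` -/

/-- `φ = id + f` with `f ∈ 𝔤` and `f' > -1`. -/
def MemDiff (φ : Equiv.Perm ℝ) : Prop :=
  MemG (fun x => φ x - x) ∧ ∀ x, -1 < deriv (fun x => φ x - x) x

theorem MemDiff.smooth {φ : Equiv.Perm ℝ} (h : MemDiff φ) : ContDiff ℝ ∞ φ := by
  have h1 : ContDiff ℝ ∞ fun x => (φ x - x) + id x := h.1.smooth.add contDiff_id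
  have h2 : (φ : ℝ → ℝ) = fun x => (φ x - x) + id x := by funext x; simp
  rw [h2]
  exact h1

theorem MemDiff.deriv_eq {φ : Equiv.Perm ℝ} (h : MemDiff φ) (x : ℝ) :
    deriv (fun x => φ x - x) x = deriv φ x - 1 :=
  ((diff_of h.smooth x).hasDerivAt.sub (hasDerivAt_id x)).deriv

theorem MemDiff.lower {φ : Equiv.Perm ℝ} (h : MemDiff φ) :
    ∃ c, 0 < c ∧ ∀ x, c ≤ deriv φ x := by
  obtain ⟨c, hc, H⟩ := h.1.2.1.lower h.2
  refine ⟨c, hc, fun x => ?_⟩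
  have := H x
  rw [h.deriv_eq] at this
  linarith

theorem MemDiff.B {φ : Equiv.Perm ℝ} (h : MemDiff φ) (n : ℕ) :
    ProudmanJohnson.B n (deriv φ) := by
  have h1 := (h.1.2.1.toB n).add (B.const n 1)
  have h2 : deriv φ = fun x => deriv (fun x => φ x - x) x + 1 := by
    funext x
    rw [h.deriv_eq]; ring
  rw [h2]
  exact h1

theorem MemDiff.tendsto {φ : Equiv.Perm ℝ} (h : MemDiff φ) : Tendsto φ atBot atBot := by
  have := h.1.2.2.add_atBot tendsto_id
  exact this.congr fun x => by simp

/-- Right translation preserves `𝔤`. -/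
theorem MemG.comp {u : ℝ → ℝ} (hu : MemG u) {ψ : Equiv.Perm ℝ} (hψ : MemDiff ψ) :
    MemG (fun x => u (ψ x)) := by
  obtain ⟨c, hc, H⟩ := hψ.lower
  refine ⟨hu.1.comp (diff_of hψ.smooth), ?_, hu.2.2.comp hψ.tendsto⟩
  rw [deriv_comp' hu.smooth hψ.smooth]
  exact (hu.2.1.comp_perm hψ.smooth hc H hψ.B).mul hψ.B

theorem memG_add {u v : ℝ → ℝ} (hu : MemG u) (hv : MemG v) : MemG (fun x => u x + v x) :=
  G.add_mem hu hv

theorem memDiff_one : MemDiff 1 := by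
  have : (fun x : ℝ => (1 : Equiv.Perm ℝ) x - x) = fun _ => 0 := by funext x; simp
  rw [MemDiff, this]
  refine ⟨G.zero_mem, fun x => by simp⟩

theorem MemDiff.mul {φ ψ : Equiv.Perm ℝ} (hφ : MemDiff φ) (hψ : MemDiff ψ) :
    MemDiff (φ * ψ) := by
  have h : MemG (fun x => (φ * ψ) x - x) := by
    have := memG_add (hφ.1.comp hψ) hψ.1
    have e : (fun x => (φ * ψ) x - x) = fun x => (φ (ψ x) - ψ x) + (ψ x - x) := by
      funext x; simp
    rw [e]; exact this
  refine ⟨h, fun x => ?_⟩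
  obtain ⟨c, hc, H⟩ := hφ.lower
  obtain ⟨d, hd, K⟩ := hψ.lower
  have := ((diff_of hφ.smooth (ψ x)).hasDerivAt.comp x (diff_of hψ.smooth x).hasDerivAt).sub
    (hasDerivAt_id x)
  have e : deriv (fun x => (φ * ψ) x - x) x = deriv φ (ψ x) * deriv ψ x - 1 := this.deriv
  rw [e]
  have := mul_pos (hc.trans_le (H (ψ x))) (hd.trans_le (K x))
  linarith

theorem MemDiff.inv {φ : Equiv.Perm ℝ} (hφ : MemDiff φ) : MemDiff φ⁻¹ := by
  obtain ⟨c, hc, H⟩ := hφ.lower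
  have hpos : ∀ x, 0 < deriv φ x := fun x => hc.trans_le (H x)
  have hmono : StrictMono φ := strictMono_of_deriv_pos hpos
  let e : ℝ ≃o ℝ := hmono.orderIsoOfSurjective φ φ.surjective
  have he : ∀ x, φ⁻¹ x = e.symm x := fun x => by
    apply φ.injective
    exact (φ.apply_symm_apply x).trans (e.apply_symm_apply x).symm
  have he' : ⇑(φ⁻¹) = e.symm := funext he
  have hcont : Continuous ⇑(φ⁻¹) := by rw [he']; exact e.symm.continuous
  have hd : ∀ x, HasDerivAt ⇑(φ⁻¹) (deriv φ (φ⁻¹ x))⁻¹ x := fun x =>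
    HasDerivAt.of_local_left_inverse (f := φ) (g := ⇑(φ⁻¹)) hcont.continuousAt (diff_of hφ.smooth _).hasDerivAt
      (hpos _).ne' (Eventually.of_forall fun y => φ.apply_symm_apply y)
  have hb : ∀ x, deriv ⇑(φ⁻¹) x = (fun y => (deriv φ y)⁻¹) (φ⁻¹ x) :=
    fun x => (hd x).deriv
  have hBinv : ∀ n, ProudmanJohnson.B n (fun y => (deriv φ y)⁻¹) :=
    fun n => (hφ.B n).inv hc H
  have hsm : ContDiff ℝ ∞ ⇑(φ⁻¹) := by
    refine contDiff_infty.2 fun n => ?_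
    induction n with
    | zero => exact contDiff_zero.2 hcont
    | succ n ih =>
      push_cast
      refine contDiff_succ_iff_deriv.2 ⟨fun x => (hd x).differentiableAt, by simp, ?_⟩
      rw [funext hb]
      exact ((hBinv 0).smooth.of_le (mod_cast le_top)).comp ih
  obtain ⟨C, hC⟩ := (hφ.B 0).bdd
  have hCpos : 0 < C := (hpos 0).trans_le ((le_abs_self _).trans (hC 0))
  have hlow : ∀ x, C⁻¹ ≤ deriv ⇑(φ⁻¹) x := fun x => by
    rw [hb]
    exact inv_anti₀ (hpos _) ((le_abs_self _).trans (hC _))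
  have htend : Tendsto ⇑(φ⁻¹) atBot atBot := by rw [he']; exact e.symm.tendsto_atBot
  have hder : ∀ x, HasDerivAt (fun x => φ⁻¹ x - x) ((deriv φ (φ⁻¹ x))⁻¹ - 1) x :=
    fun x => (hd x).sub (hasDerivAt_id x)
  refine ⟨⟨fun x => (hder x).differentiableAt, ?_, ?_⟩, fun x => ?_⟩
  · have h1 : MemW (fun y => (-1 * deriv (fun x => φ x - x) y) * (deriv φ y)⁻¹) :=
      (hφ.1.2.1.const_mul (-1)).mul hBinv
    have h2 := h1.comp_inv hsm (inv_pos.2 hCpos) hlow hb hBinv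
    have : deriv (fun x => φ⁻¹ x - x) = fun x =>
        (-1 * deriv (fun x => φ x - x) (φ⁻¹ x)) * (deriv φ (φ⁻¹ x))⁻¹ := by
      funext x
      rw [(hder x).deriv, hφ.deriv_eq]
      have := (hpos (φ⁻¹ x)).ne'
      field_simp
      ring
    rw [this]
    exact h2
  · have := (hφ.1.2.2.comp htend).neg
    simpa [Function.comp_def] using this
  · rw [(hder x).deriv]
    have := inv_pos.2 (hpos (φ⁻¹ x))
    linarith

/-- The group `Diff~(ℝ)` (under composition) of all `φ = id + f` with `f' ∈ W^{∞,1}(ℝ)`, `f' > -1`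
and `f(x) → 0` as `x → -∞`. Such a map is automatically a bijection of `ℝ`. -/
def DiffTilde : Subgroup (Equiv.Perm ℝ) where
  carrier := {φ | MemDiff φ}
  mul_mem' := MemDiff.mul
  one_mem' := memDiff_one
  inv_mem' := MemDiff.inv

/-- The global chart `φ ↦ φ - id` of `Diff~(ℝ)`, with values in an open convex subset of `𝔤`.
Through it, every tangent space `T_φ Diff~(ℝ)` is identified with `𝔤`. -/
def disp (φ : DiffTilde) : G := ⟨fun x => φ.1 x - x, φ.2.1⟩

/-- Right translation `X ↦ X ∘ ψ` of tangent vectors. -/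
def rightTranslate (X : G) (ψ : DiffTilde) : G := ⟨fun x => (X : ℝ → ℝ) (ψ.1 x), X.2.comp ψ.2⟩

/-- The metric `∫ φ_x^{-α-1} X_x Y_x dx` at the map `φ = id + f`, for `X, Y ∈ 𝔤`. -/
def chartMetric (α : ℝ) (f X Y : G) : ℝ :=
  ∫ x, (1 + deriv (f : ℝ → ℝ) x) ^ (-α - 1) * (deriv (X : ℝ → ℝ) x * deriv (Y : ℝ → ℝ) x)

/-- The `α`-`Ḣ¹` metric on `Diff~(ℝ)`; a tangent vector at `φ` is `X = u ∘ φ`, `u ∈ 𝔤`. -/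
def alphaH1 (α : ℝ) (φ : DiffTilde) (X Y : G) : ℝ := chartMetric α (disp φ) X Y

/-- Well-definedness (the integrand is integrable), and positive definiteness of the symmetric
bilinear forms `alphaH1 α φ`. -/
def IsWeakRiemannian (α : ℝ) : Prop :=
  ∀ φ : DiffTilde,
    (∀ X Y : G, Integrable fun x =>
      (1 + deriv (disp φ : ℝ → ℝ) x) ^ (-α - 1) *
        (deriv (X : ℝ → ℝ) x * deriv (Y : ℝ → ℝ) x)) ∧
    ∀ X : G, X ≠ 0 → 0 < alphaH1 α φ X X

/-- Right-invariance of a family of bilinear forms on the tangent spaces of `Diff~(ℝ)`. -/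
def IsRightInvariant (g : DiffTilde → G → G → ℝ) : Prop :=
  ∀ (φ ψ : DiffTilde) (X Y : G),
    g (φ * ψ) (rightTranslate X ψ) (rightTranslate Y ψ) = g φ X Y

/-! ### Densities -/

/-- The space `Dens~₊(ℝ)` of densities `(1 + r) λ`, `r ∈ W^{∞,1}(ℝ)`, `1 + r > 0`; the open subset
of all such `r` is a global chart, with tangent spaces `W^{∞,1}(ℝ)`. -/
structure DensTilde where
  /-- the density minus one -/
  coord : W
  pos : ∀ x, 0 < 1 + (coord : ℝ → ℝ) x

/-- The measure `(1 + r) λ`, where `λ` is Lebesgue measure. -/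
def DensTilde.toMeasure (μ : DensTilde) : Measure ℝ :=
  volume.withDensity fun x => ENNReal.ofReal (1 + (μ.coord : ℝ → ℝ) x)

/-- The `α`-Fisher–Rao metric `∫ (μ/λ)^{-α-1} (a/λ) (b/λ) λ`. -/
def alphaFisherRao (α : ℝ) (μ : DensTilde) (a b : W) : ℝ :=
  ∫ x, (1 + (μ.coord : ℝ → ℝ) x) ^ (-α - 1) * ((a : ℝ → ℝ) x * (b : ℝ → ℝ) x)

/-- `g = Θ^* γ`: the map `Θ` has a differential at every point, and `g` is the pullback of `γ`
along it. -/
def IsPullbackMetric (g : DiffTilde → G → G → ℝ) (γ : DensTilde → W → W → ℝ)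
    (Θ : DiffTilde → DensTilde) : Prop :=
  ∀ φ : DiffTilde, ∃ dΘ : G →L[ℝ] W,
    (∀ (c : ℝ → DiffTilde) (X : G), c 0 = φ → HasDerivAt (fun s => disp (c s)) X 0 →
      HasDerivAt (fun s => (Θ (c s)).coord) (dΘ X) 0) ∧
    ∀ X Y : G, g φ X Y = γ (Θ φ) (dΘ X) (dΘ Y)

/-! ### Geodesics and the generalized Proudman–Johnson equation -/

/-- `c` is a `C¹` curve in the Fréchet space `𝔤` on the interval `J`, with velocity `v`. -/
structure IsC1CurveOn (c v : ℝ → G) (J : Set ℝ) : Prop where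
  hasDeriv : ∀ t ∈ J, HasDerivWithinAt c (v t) J t
  cont : ContinuousOn v J

/-- `c` is a `C²` curve in `𝔤` on `J`, with velocity `v` and acceleration `a`. -/
structure IsC2CurveOn (c v a : ℝ → G) (J : Set ℝ) : Prop where
  first : ∀ t ∈ J, HasDerivWithinAt c (v t) J t
  second : IsC1CurveOn v a J

/-- The energy on `[a, b]` of the curve `id + c` with velocity `v`. -/
def energy (α a b : ℝ) (c v : ℝ → G) : ℝ :=
  (1 / 2) * ∫ t in a..b, chartMetric α (c t) (v t) (v t)

/-- The curve `φ` in `Diff~(ℝ)` with velocity `v` is a geodesic of the `α`-`Ḣ¹` metric on `[a, b]`: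
a critical point of the energy among curves with the same end points. In the global chart the
admissible variations are `φ + s w`, with `w` a `C²` curve in `𝔤` vanishing at `a` and `b`
(and `φ + s w` lies in `Diff~(ℝ)` for small `s`). -/
def IsGeodesic (α a b : ℝ) (φ : ℝ → DiffTilde) (v : ℝ → G) : Prop :=
  ∀ w w' w'' : ℝ → G, IsC2CurveOn w w' w'' (Icc a b) → w a = 0 → w b = 0 →
    HasDerivAt (fun s : ℝ =>
      energy α a b (fun t => disp (φ t) + s • w t) (fun t => v t + s • w' t)) 0 0

/-- The Eulerian velocity `u = φ_t ∘ φ⁻¹` of a curve `φ` with velocity `v = φ_t`. -/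
def eulerian (φ : ℝ → DiffTilde) (v : ℝ → G) (t : ℝ) : G := rightTranslate (v t) (φ t)⁻¹

/-- `u` is a `C¹` curve in `𝔤` on the time interval `J` which solves
`u_txx + (2 - α) u_x u_xx + u u_xxx = 0`. -/
def IsGPJSolution (α : ℝ) (J : Set ℝ) (u : ℝ → G) : Prop :=
  ∃ v : ℝ → G, IsC1CurveOn u v J ∧ ∀ t ∈ J, ∀ x : ℝ,
    iteratedDeriv 2 (v t : ℝ → ℝ) x
      + (2 - α) * deriv (u t : ℝ → ℝ) x * iteratedDeriv 2 (u t : ℝ → ℝ) x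
      + (u t : ℝ → ℝ) x * iteratedDeriv 3 (u t : ℝ → ℝ) x = 0

/-- Global well-posedness on `𝔤` (in the sense of Hadamard): every initial value in `𝔤` has a
solution for all times `t ≥ 0`, solutions are unique on every `[0, T]`, and the solution depends
continuously on time and initial value. -/
def GloballyWellPosed (α : ℝ) : Prop :=
  ∃ S : G → ℝ → G,
    (∀ u₀, S u₀ 0 = u₀ ∧ IsGPJSolution α (Ici 0) (S u₀)) ∧
    (∀ (u₀ : G) (T : ℝ) (u : ℝ → G), 0 < T → u 0 = u₀ → IsGPJSolution α (Icc 0 T) u →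
      EqOn u (S u₀) (Icc 0 T)) ∧
    ContinuousOn (fun p : G × ℝ => S p.1 p.2) (univ ×ˢ Ici 0)

end ProudmanJohnson

end

/-!
Everything is computed in the global chart `φ ↦ φ - id`, in which `Diff~(ℝ)` is the open set
`{f ∈ 𝔤 : f' > -1}` of the Fréchet space `𝔤`.

The map `Θ` sends `φ` to the density `φ' λ`. In the charts it is `f ↦ f'`, a continuous linear
isomorphism from `𝔤` to `W^{∞,1}(ℝ)`, so `G^{αḢ¹}` is literally the pullback of `G^α`
(`toMeasure_pullbackDensity`, `isPullbackMetric`). Replacing `(φ, X, Y)` by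
`(φ ∘ ψ, X ∘ ψ, Y ∘ ψ)` and changing variables puts a weight `(ψ')^{-α}` into the integrand of the
metric (`alphaH1_rightTranslate`). For `α = 0` the weight is `1`; for `α ≠ 0` a map with `ψ' ≥ 1`,
and a field living where `ψ' > 1`, show that right invariance fails
(`eq_zero_of_isRightInvariant`).

For the geodesics, the first variation of the energy in the direction `w` is
`-∫∫ w_x φ_x^{-α-1} R`, where `R = φ_ttx - (α + 1) / 2 · φ_tx² / φ_x` (`hasDerivAt_energy`). Hence
geodesics are the curves with `R = 0` (`isGeodesic_iff`). On the other hand, all terms of the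
equation vanish at `-∞`, so it can be integrated once to
`u_tx + u u_xx + (1 - α) / 2 · u_x² = 0` (`gpj_iff_integrated`). If `u = φ_t ∘ φ⁻¹`, the left hand
side at `(t, φ(t, x))` is `R(t, x) / φ_x(t, x)` (`gpj_eulerian_iff`).

For `α = 1` the equation `φ_ttx φ_x = φ_tx²` says that `log φ_x` is affine in time, and
`φ_x = e^{t u₀'}` is the geodesic with initial velocity `u₀`. Its Eulerian velocity is a global
solution, depending continuously on `(u₀, t)` since superposition operators, inversion and
composition are continuous (`continuous_superpose`, `continuous_comp_inv`). If `d` is the difference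
of the `x`-derivatives of another solution and this one, then Grönwall's inequality for the `L¹`
norm of `d ∘ φ` gives uniqueness (`eqOn_expSolution`). For `α ≠ 1`, `q = u_x` satisfies
`q' = (α - 1) / 2 · q²` along the characteristics of a solution, and there are initial values for
which `q` blows up at time one (`not_isGPJSolution_of_deriv_eq`).

A technical point: in a Fréchet space the derivative of a curve is the limit of its difference
quotients (`hasDerivWithinAt_iff_tendsto`). A curve in `W^{∞,1}(ℝ)` or `𝔤` is `C¹` as soon as its
pointwise time derivative exists and is a continuous curve in the space (`W.isC1_of_pointwise`,
`G.isC1_of_pointwise`), which reduces all derivatives of curves to derivatives of real functions.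
-/

noncomputable section

namespace ProudmanJohnson

/-! ### Derivatives of curves in topological vector spaces -/

theorem hasDerivWithinAt_univ_tvs {E : Type*} [AddCommGroup E] [Module ℝ E] [TopologicalSpace E]
    [ContinuousSMul ℝ E] {f : ℝ → E} {f' : E} {t : ℝ} :
    HasDerivWithinAt f f' univ t ↔ HasDerivAt f f' t := by
  rw [HasDerivWithinAt, HasDerivAt, nhdsWithin_univ]

section TVS

variable {E : Type*} [AddCommGroup E] [Module ℝ E] [TopologicalSpace E]
  [IsTopologicalAddGroup E] [ContinuousSMul ℝ E]

open scoped Pointwise in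
/-- In an arbitrary topological vector space the derivative of a curve, which Mathlib defines
through gauges of neighbourhoods of zero, is the limit of the difference quotients. -/
theorem hasDerivWithinAt_iff_tendsto {f : ℝ → E} {f' : E} {s : Set ℝ} {t : ℝ} :
    HasDerivWithinAt f f' s t ↔
      Tendsto (fun r => (r - t)⁻¹ • (f r - f t)) (𝓝[s \ {t}] t) (𝓝 f') := by
  have hle : 𝓝[s \ {t}] t ≤ 𝓝[s] t := nhdsWithin_mono _ sdiff_subset
  have key : ∀ r, r ≠ t → (r - t)⁻¹ • (f r - f t) - f' =
      (r - t)⁻¹ • (f r - f t - (r - t) • f') := fun r hr => by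
    rw [smul_sub _ (f r - f t), smul_smul, inv_mul_cancel₀ (sub_ne_zero.2 hr), one_smul]
  have hne : ∀ᶠ r in 𝓝[s \ {t}] t, r ≠ t := by
    filter_upwards [self_mem_nhdsWithin] with r hr using hr.2
  have h0 : HasDerivWithinAt f f' s t ↔
      (fun r => f r - f t - (r - t) • f') =o[ℝ; 𝓝[s] t] (fun r => r - t) := by
    rw [HasDerivWithinAt, HasDerivAtFilter, hasFDerivAtFilter_iff_isLittleOTVS, prod_pure,
      Asymptotics.isLittleOTVS_map]
    rfl
  rw [h0, ← tendsto_sub_nhds_zero_iff, tendsto_congr' (hne.mono key)]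
  rw [(nhds_basis_balanced ℝ E).isLittleOTVS_iff Metric.nhds_basis_ball,
    (nhds_basis_balanced ℝ E).tendsto_right_iff]
  constructor
  -- `r - t` has gauge at most a multiple of `|r - t|`, so the remainder lies in `(r - t) • U`
  · rintro h U ⟨hU, hUb⟩
    obtain ⟨δ, hδ, H⟩ := h U ⟨hU, hUb⟩
    have h4 := H ‖δ / 4‖₊ (by simp [hδ.ne'])
    filter_upwards [hle h4, hne] with r hr hrt
    have hy : r - t ≠ 0 := sub_ne_zero.2 hrt
    have hc : δ / (2 * (r - t)) ≠ 0 := by positivity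
    have h5 : egauge ℝ (Metric.ball (0 : ℝ) δ) (r - t) ≤ (‖δ / (2 * (r - t))‖₊⁻¹ : NNReal) := by
      refine egauge_le_of_smul_mem_of_ne ?_ hc
      have : δ / (2 * (r - t)) * (r - t) = δ / 2 := by field_simp
      rw [smul_eq_mul, this, mem_ball_zero_iff, Real.norm_eq_abs, abs_of_pos (by linarith)]
      linarith
    have h6 : egauge ℝ U (f r - f t - (r - t) • f') < ‖r - t‖ₑ := by
      refine (hr.trans (mul_le_mul_right h5 _)).trans_lt ?_
      rw [← ENNReal.coe_mul, enorm_eq_nnnorm, ENNReal.coe_lt_coe, ← NNReal.coe_lt_coe]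
      push_cast
      rw [norm_div, norm_div, norm_mul]
      have := norm_pos_iff.2 hy
      have := norm_pos_iff.2 hδ.ne'
      simp only [Real.norm_ofNat]
      field_simp
      norm_num
    have := mem_smul_of_egauge_lt hUb h6
    rwa [mem_smul_set_iff_inv_smul_mem₀ hy] at this
  · rintro h U ⟨hU, hUb⟩
    refine ⟨1, one_pos, fun ε hε => ?_⟩
    have hεU : (ε : ℝ) • U ∈ 𝓝 (0 : E) :=
      (set_smul_mem_nhds_zero_iff (NNReal.coe_ne_zero.2 hε)).2 hU
    have h1 := h _ ⟨hεU, hUb.smul (ε : ℝ)⟩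
    rw [eventually_nhdsWithin_iff] at h1
    rw [eventually_nhdsWithin_iff]
    filter_upwards [h1] with r hr hrs
    refine le_trans ?_ (mul_le_mul_right (le_egauge_ball_one ℝ (r - t)) _)
    by_cases hrt : r = t
    · subst hrt
      simp [egauge_zero_right ℝ ⟨0, mem_of_mem_nhds hU⟩]
    · have hy : r - t ≠ 0 := sub_ne_zero.2 hrt
      have h2 := hr ⟨hrs, hrt⟩
      rw [id, ← mem_smul_set_iff_inv_smul_mem₀ hy, smul_smul] at h2
      refine (egauge_le_of_mem_smul h2).trans_eq ?_
      rw [enorm_mul, mul_comm]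
      congr 1
      simp [enorm_eq_nnnorm]

theorem continuousWithinAt_of_hasDerivWithinAt {f : ℝ → E} {f' : E} {s : Set ℝ} {t : ℝ}
    (h : HasDerivWithinAt f f' s t) : ContinuousWithinAt f s t := by
  rw [hasDerivWithinAt_iff_tendsto] at h
  have h1 : Tendsto (fun r : ℝ => r - t) (𝓝[s \ {t}] t) (𝓝 0) := by
    have : Tendsto (fun r : ℝ => r - t) (𝓝 t) (𝓝 (t - t)) := tendsto_id.sub_const t
    rw [sub_self] at this
    exact this.mono_left nhdsWithin_le_nhds
  have h2 := (h1.smul h).add_const (f t)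
  rw [zero_smul, zero_add] at h2
  rw [← continuousWithinAt_sdiff_self]
  refine h2.congr' ?_
  filter_upwards [self_mem_nhdsWithin] with r hr
  rw [smul_smul, mul_inv_cancel₀ (sub_ne_zero.2 hr.2), one_smul, sub_add_cancel]

variable {F : Type*} [AddCommGroup F] [Module ℝ F] [TopologicalSpace F]
  [IsTopologicalAddGroup F] [ContinuousSMul ℝ F]

theorem hasDerivWithinAt_clm_comp (L : E →L[ℝ] F) {f : ℝ → E} {f' : E} {s : Set ℝ} {t : ℝ}
    (h : HasDerivWithinAt f f' s t) : HasDerivWithinAt (fun r => L (f r)) (L f') s t := by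
  rw [hasDerivWithinAt_iff_tendsto] at h ⊢
  refine ((L.continuous.tendsto f').comp h).congr fun r => ?_
  simp [map_smul, map_sub]

end TVS

/-! ### Differentiation, evaluation and primitives on `W^{∞,1}(ℝ)` and `𝔤` -/

theorem W.integrable (f : W) : Integrable (f : ℝ → ℝ) := f.2.int

theorem W.continuous (f : W) : Continuous (f : ℝ → ℝ) := f.2.1.continuous

theorem G.smooth (u : G) : ContDiff ℝ ∞ (u : ℝ → ℝ) := u.2.smooth

theorem W.hasDerivAt (f : W) (x : ℝ) : HasDerivAt (f : ℝ → ℝ) (deriv (f : ℝ → ℝ) x) x :=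
  (diff_of f.2.1 x).hasDerivAt

theorem G.hasDerivAt (u : G) (x : ℝ) : HasDerivAt (u : ℝ → ℝ) (deriv (u : ℝ → ℝ) x) x :=
  (u.2.1 x).hasDerivAt

/-- The derivative `f ↦ f'` on `W^{∞,1}(ℝ)`. -/
def W.der : W →ₗ[ℝ] W where
  toFun f := ⟨deriv (f : ℝ → ℝ), f.2.der⟩
  map_add' f g := Subtype.ext (deriv_add' f.2.1 g.2.1)
  map_smul' c f := Subtype.ext (by
    funext x
    exact ((W.hasDerivAt f x).const_mul c).deriv)

theorem W.seminorm_zero (f : W) : W.seminorm 0 f = ∫ x, |(f : ℝ → ℝ) x| := by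
  change ∫ x, |iteratedDeriv 0 (f : ℝ → ℝ) x| = _
  simp

theorem W.seminorm_succ (k : ℕ) (f : W) : W.seminorm (k + 1) f = W.seminorm k (W.der f) := by
  change ∫ x, |iteratedDeriv (k + 1) (f : ℝ → ℝ) x| = ∫ x, |iteratedDeriv k (deriv (f : ℝ → ℝ)) x|
  rw [iteratedDeriv_succ']

theorem abs_le_integral_abs_deriv {f : ℝ → ℝ} (hf : Differentiable ℝ f)
    (hi : Integrable (deriv f)) (h0 : Tendsto f atBot (𝓝 0)) (x : ℝ) :
    |f x| ≤ ∫ y, |deriv f y| := by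
  have h := integral_Iic_of_hasDerivAt_of_tendsto (a := x) hf.continuous.continuousWithinAt
    (fun y _ => (hf y).hasDerivAt) hi.integrableOn h0
  rw [sub_zero] at h
  rw [← h]
  exact (abs_integral_le_integral_abs).trans
    (setIntegral_le_integral hi.abs (Eventually.of_forall fun _ => abs_nonneg _))

/-- The supremum norm is dominated by the seminorm of order one. -/
theorem W.abs_le (f : W) (x : ℝ) : |(f : ℝ → ℝ) x| ≤ W.seminorm 1 f := by
  rw [W.seminorm_succ, W.seminorm_zero]
  exact abs_le_integral_abs_deriv (diff_of f.2.1) f.2.der.int f.2.tendsto_atBot x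

theorem G.abs_le (u : G) (x : ℝ) : |(u : ℝ → ℝ) x| ≤ W.seminorm 0 (G.D u) := by
  rw [W.seminorm_zero]
  exact abs_le_integral_abs_deriv u.2.1 u.2.2.1.int u.2.2.2 x

theorem W.tendsto_iff {Z : Type*} {l : Filter Z} {F : Z → W} {f : W} :
    Tendsto F l (𝓝 f) ↔ ∀ k, Tendsto (fun z => W.seminorm k (F z - f)) l (𝓝 0) := by
  rw [W.withSeminorms.tendsto_nhds]
  refine forall_congr' fun k => ?_
  rw [Metric.tendsto_nhds]
  refine forall₂_congr fun ε _ => ?_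
  simp [W.seminorms, abs_of_nonneg (apply_nonneg (W.seminorm k) _)]

theorem W.continuous_seminorm (k : ℕ) : Continuous (W.seminorm k) :=
  W.withSeminorms.continuous_seminorm k

theorem G.isInducing_D : Topology.IsInducing G.D := ⟨rfl⟩

/-- `W.der` as a continuous linear map. -/
def W.derL : W →L[ℝ] W where
  toLinearMap := W.der
  cont := by
    refine continuous_iff_continuousAt.2 fun f => W.tendsto_iff.2 fun k => ?_
    refine (W.tendsto_iff.1 (tendsto_id (x := 𝓝 f)) (k + 1)).congr fun g => ?_
    rw [W.seminorm_succ, map_sub]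
    rfl

/-- The derivative `u ↦ u'` as a continuous linear map from `𝔤` to `W^{∞,1}(ℝ)`. -/
def G.DL : G →L[ℝ] W where
  toLinearMap := G.D
  cont := G.isInducing_D.continuous

/-- Joint continuity of the evaluation on `W^{∞,1}(ℝ)`. -/
theorem W.continuous_eval : Continuous fun p : W × ℝ => (p.1 : ℝ → ℝ) p.2 := by
  refine continuous_iff_continuousAt.2 fun ⟨f, x⟩ => ?_
  have h1 : Tendsto (fun p : W × ℝ => W.seminorm 1 (p.1 - f)) (𝓝 (f, x)) (𝓝 0) :=
    W.tendsto_iff.1 (continuous_fst.tendsto (f, x)) 1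
  have h2 : Tendsto (fun p : W × ℝ => ((p.1 - f : W) : ℝ → ℝ) p.2) (𝓝 (f, x)) (𝓝 0) :=
    squeeze_zero_norm (fun p => W.abs_le _ _) h1
  have h3 : Tendsto (fun p : W × ℝ => (f : ℝ → ℝ) p.2) (𝓝 (f, x)) (𝓝 ((f : ℝ → ℝ) x)) :=
    ((W.continuous f).comp continuous_snd).tendsto (f, x)
  have h4 := h2.add h3
  rw [zero_add] at h4
  exact h4.congr fun p => by simp

/-- Joint continuity of the evaluation on `𝔤`. -/
theorem G.continuous_eval : Continuous fun p : G × ℝ => (p.1 : ℝ → ℝ) p.2 := by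
  refine continuous_iff_continuousAt.2 fun ⟨f, x⟩ => ?_
  have h1 : Tendsto (fun p : G × ℝ => W.seminorm 0 (G.D p.1 - G.D f)) (𝓝 (f, x)) (𝓝 0) :=
    W.tendsto_iff.1 ((G.DL.continuous.comp continuous_fst).tendsto (f, x)) 0
  have h2 : Tendsto (fun p : G × ℝ => ((p.1 - f : G) : ℝ → ℝ) p.2) (𝓝 (f, x)) (𝓝 0) :=
    squeeze_zero_norm (fun p => (G.abs_le _ _).trans_eq (by rw [map_sub])) h1
  have h3 : Tendsto (fun p : G × ℝ => (f : ℝ → ℝ) p.2) (𝓝 (f, x)) (𝓝 ((f : ℝ → ℝ) x)) :=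
    ((G.smooth f).continuous.comp continuous_snd).tendsto (f, x)
  have h4 := h2.add h3
  rw [zero_add] at h4
  exact h4.congr fun p => by simp

/-- Evaluation at a point, on `W^{∞,1}(ℝ)`. -/
def W.evalL (x : ℝ) : W →L[ℝ] ℝ where
  toFun f := (f : ℝ → ℝ) x
  map_add' _ _ := rfl
  map_smul' _ _ := rfl
  cont := W.continuous_eval.comp (Continuous.prodMk_left x)

/-- Evaluation at a point, on `𝔤`. -/
def G.evalL (x : ℝ) : G →L[ℝ] ℝ where
  toFun f := (f : ℝ → ℝ) x
  map_add' _ _ := rfl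
  map_smul' _ _ := rfl
  cont := G.continuous_eval.comp (Continuous.prodMk_left x)

theorem hasDerivAt_integral_Iic {f : ℝ → ℝ} (hf : Integrable f) (hc : Continuous f) (x : ℝ) :
    HasDerivAt (fun x => ∫ y in Iic x, f y) (f x) x := by
  have h : (fun x => ∫ y in Iic x, f y) = fun x => (∫ y in Iic 0, f y) + ∫ y in (0 : ℝ)..x, f y := by
    funext x
    rw [← intervalIntegral.integral_Iic_sub_Iic hf.integrableOn hf.integrableOn]
    ring
  rw [h]
  exact (intervalIntegral.integral_hasDerivAt_right hf.intervalIntegrable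
    (hc.stronglyMeasurableAtFilter _ _) hc.continuousAt).const_add _

theorem tendsto_integral_Iic_atBot {f : ℝ → ℝ} (hf : Integrable f) :
    Tendsto (fun x => ∫ y in Iic x, f y) atBot (𝓝 0) := by
  have h := (intervalIntegral_tendsto_integral_Iic (0 : ℝ) hf.integrableOn tendsto_id).const_sub
    (∫ y in Iic (0 : ℝ), f y)
  rw [sub_self] at h
  refine h.congr fun x => ?_
  rw [id, ← intervalIntegral.integral_Iic_sub_Iic hf.integrableOn hf.integrableOn]
  ring

theorem MemW.memG_prim {f : ℝ → ℝ} (hf : MemW f) : MemG fun x => ∫ y in Iic x, f y := by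
  have h := hasDerivAt_integral_Iic hf.int hf.1.continuous
  refine ⟨fun x => (h x).differentiableAt, ?_, tendsto_integral_Iic_atBot hf.int⟩
  rw [funext fun x => (h x).deriv]
  exact hf

/-- The primitive vanishing at `-∞`, as a map from `W^{∞,1}(ℝ)` to `𝔤`. -/
def W.prim (f : W) : G := ⟨fun x => ∫ y in Iic x, (f : ℝ → ℝ) y, f.2.memG_prim⟩

theorem W.deriv_prim (f : W) : deriv (W.prim f : ℝ → ℝ) = f :=
  funext fun x => (hasDerivAt_integral_Iic (W.integrable f) (W.continuous f) x).deriv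

@[simp] theorem G.D_prim (f : W) : G.D (W.prim f) = f := Subtype.ext (W.deriv_prim f)

theorem G.D_injective : Function.Injective G.D := by
  refine (injective_iff_map_eq_zero G.D).2 fun u hu => Subtype.ext (funext fun x => ?_)
  have := G.abs_le u x
  rw [hu, map_zero] at this
  exact abs_nonpos_iff.1 this

theorem W.continuous_prim : Continuous W.prim :=
  G.isInducing_D.continuous_iff.2 (continuous_id.congr fun f => (G.D_prim f).symm)

theorem G.D_apply (u : G) (x : ℝ) : (G.D u : ℝ → ℝ) x = deriv (u : ℝ → ℝ) x := rfl

theorem W.der_apply (f : W) (x : ℝ) : (W.der f : ℝ → ℝ) x = deriv (f : ℝ → ℝ) x := rfl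

/-! ### The diffeomorphisms: derivatives, change of variables, construction from displacements -/

theorem DiffTilde.smooth (φ : DiffTilde) : ContDiff ℝ ∞ φ.1 := MemDiff.smooth φ.2

theorem DiffTilde.hasDerivAt (φ : DiffTilde) (x : ℝ) : HasDerivAt φ.1 (deriv φ.1 x) x :=
  (diff_of (MemDiff.smooth φ.2) x).hasDerivAt

theorem DiffTilde.deriv_eq (φ : DiffTilde) (x : ℝ) :
    deriv φ.1 x = 1 + deriv (disp φ : ℝ → ℝ) x := by
  have := MemDiff.deriv_eq φ.2 x
  change deriv (disp φ : ℝ → ℝ) x = _ at this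
  rw [this]; ring

theorem DiffTilde.deriv_pos (φ : DiffTilde) (x : ℝ) : 0 < deriv φ.1 x := by
  have h : -1 < deriv (disp φ : ℝ → ℝ) x := φ.2.2 x
  rw [DiffTilde.deriv_eq φ]; linarith

theorem disp_apply (φ : DiffTilde) (x : ℝ) : (disp φ : ℝ → ℝ) x = φ.1 x - x := rfl

theorem DiffTilde.apply_eq (φ : DiffTilde) (x : ℝ) : φ.1 x = x + (disp φ : ℝ → ℝ) x := by
  rw [disp_apply]; ring

@[simp] theorem DiffTilde.apply_inv (φ : DiffTilde) (x : ℝ) :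
    φ.1 ((φ⁻¹ : DiffTilde).1 x) = x := φ.1.apply_symm_apply x

@[simp] theorem DiffTilde.inv_apply (φ : DiffTilde) (x : ℝ) :
    (φ⁻¹ : DiffTilde).1 (φ.1 x) = x := φ.1.symm_apply_apply x

theorem DiffTilde.hasDerivAt_inv (φ : DiffTilde) (x : ℝ) :
    HasDerivAt (φ⁻¹ : DiffTilde).1 (deriv φ.1 ((φ⁻¹ : DiffTilde).1 x))⁻¹ x :=
  HasDerivAt.of_local_left_inverse (DiffTilde.smooth φ⁻¹).continuous.continuousAt (DiffTilde.hasDerivAt φ _)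
    (DiffTilde.deriv_pos φ _).ne' (Eventually.of_forall (DiffTilde.apply_inv φ))

theorem DiffTilde.integral_comp (φ : DiffTilde) (g : ℝ → ℝ) :
    ∫ x, deriv φ.1 x * g (φ.1 x) = ∫ x, g x := by
  have h := integral_image_eq_integral_abs_deriv_smul MeasurableSet.univ
    (fun x _ => (DiffTilde.hasDerivAt φ x).hasDerivWithinAt) φ.1.injective.injOn g
  rw [image_univ, φ.1.surjective.range_eq, setIntegral_univ, setIntegral_univ] at h
  rw [h]
  refine integral_congr_ae (Eventually.of_forall fun x => ?_)
  simp [abs_of_pos (DiffTilde.deriv_pos φ x)]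

/-- Right translation of elements of `W^{∞,1}(ℝ)`. -/
def W.comp (f : W) (φ : DiffTilde) : W := ⟨fun x => (f : ℝ → ℝ) (φ.1 x), by
  obtain ⟨c, hc, H⟩ := MemDiff.lower φ.2
  exact f.2.comp_perm (DiffTilde.smooth φ) hc H (MemDiff.B φ.2)⟩

theorem W.comp_apply (f : W) (φ : DiffTilde) (x : ℝ) :
    (W.comp f φ : ℝ → ℝ) x = (f : ℝ → ℝ) (φ.1 x) := rfl

/-- Every `g ∈ 𝔤` with `g' > -1` is the displacement of a diffeomorphism. -/
def DiffTilde.ofDisp (g : G) (hg : ∀ x, -1 < deriv (g : ℝ → ℝ) x) : DiffTilde := by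
  have hd : ∀ x, HasDerivAt (fun x => x + (g : ℝ → ℝ) x) (1 + deriv (g : ℝ → ℝ) x) x :=
    fun x => (hasDerivAt_id x).add (G.hasDerivAt g x)
  have hmono : StrictMono fun x => x + (g : ℝ → ℝ) x := strictMono_of_deriv_pos fun x => by
    rw [(hd x).deriv]; linarith [hg x]
  have hb := G.abs_le g
  have hsurj : Function.Surjective fun x => x + (g : ℝ → ℝ) x := by
    refine Continuous.surjective (continuous_id.add (G.smooth g).continuous) ?_ ?_
    · exact tendsto_atTop_add_right_of_le _ (-W.seminorm 0 (G.D g)) tendsto_id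
        fun x => (abs_le.1 (hb x)).1
    · exact tendsto_atBot_add_right_of_ge _ (W.seminorm 0 (G.D g)) tendsto_id
        fun x => (abs_le.1 (hb x)).2
  refine ⟨Equiv.ofBijective _ ⟨hmono.injective, hsurj⟩, ?_⟩
  have e : (fun x : ℝ => (Equiv.ofBijective _ ⟨hmono.injective, hsurj⟩ : Equiv.Perm ℝ) x - x) =
      g := by
    funext x
    exact add_sub_cancel_left _ _
  change MemDiff _
  rw [MemDiff, e]
  exact ⟨g.2, hg⟩

theorem DiffTilde.ofDisp_apply (g : G) (hg : ∀ x, -1 < deriv (g : ℝ → ℝ) x) (x : ℝ) :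
    (DiffTilde.ofDisp g hg).1 x = x + (g : ℝ → ℝ) x := rfl

@[simp] theorem disp_ofDisp (g : G) (hg : ∀ x, -1 < deriv (g : ℝ → ℝ) x) :
    disp (DiffTilde.ofDisp g hg) = g := by
  refine Subtype.ext (funext fun x => ?_)
  rw [disp_apply, DiffTilde.ofDisp_apply]
  ring

/-! ### Integral estimates -/

/-- Minkowski's inequality for an integral over a time interval, in `L¹`. -/
theorem integral_abs_le_of_eq_intervalIntegral {c : ℝ → ℝ} {v : ℝ → ℝ → ℝ} {a b M : ℝ}
    (hv : ContinuousOn (Function.uncurry v) (uIcc a b ×ˢ univ))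
    (hi : ∀ s ∈ uIcc a b, Integrable (v s)) (hM : ∀ s ∈ uIcc a b, ∫ x, |v s x| ≤ M)
    (hcm : Continuous c) (hc : ∀ x, c x = ∫ s in a..b, v s x) :
    ∫ x, |c x| ≤ M * |b - a| := by
  have hM0 : 0 ≤ M := (integral_nonneg fun _ => abs_nonneg _).trans (hM a left_mem_uIcc)
  have hm : AEMeasurable (Function.uncurry fun x s => ‖v s x‖ₑ)
      ((volume : Measure ℝ).prod (volume.restrict (uIoc a b))) := by
    have h1 : ContinuousOn (fun p : ℝ × ℝ => v p.2 p.1) (univ ×ˢ uIoc a b) :=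
      hv.comp continuous_swap.continuousOn fun p hp => ⟨uIoc_subset_uIcc hp.2, trivial⟩
    have h2 := h1.aestronglyMeasurable (μ := (volume : Measure ℝ).prod volume)
      (MeasurableSet.univ.prod measurableSet_uIoc)
    rw [← Measure.prod_restrict, Measure.restrict_univ] at h2
    exact h2.enorm
  have h : ∫⁻ x, ‖c x‖ₑ ≤ ENNReal.ofReal (M * |b - a|) := by
    calc ∫⁻ x, ‖c x‖ₑ ≤ ∫⁻ x, ∫⁻ s in uIoc a b, ‖v s x‖ₑ := by
          refine lintegral_mono fun x => ?_
          simp only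
          rw [hc x, intervalIntegral.intervalIntegral_eq_integral_uIoc]
          refine le_trans ?_ (enorm_integral_le_lintegral_enorm _)
          rw [enorm_smul]
          split_ifs <;> simp
      _ = ∫⁻ s in uIoc a b, ∫⁻ x, ‖v s x‖ₑ := lintegral_lintegral_swap hm
      _ ≤ ∫⁻ s in uIoc a b, ENNReal.ofReal M := by
          refine setLIntegral_mono measurable_const fun s hs => ?_
          have hs' := uIoc_subset_uIcc hs
          rw [← ofReal_integral_norm_eq_lintegral_enorm (hi s hs')]
          exact ENNReal.ofReal_le_ofReal (hM s hs')
      _ = ENNReal.ofReal (M * |b - a|) := by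
          rw [setLIntegral_const, Real.volume_uIoc, ENNReal.ofReal_mul hM0]
  have h3 := integral_norm_eq_lintegral_enorm (μ := volume) hcm.aestronglyMeasurable
  simp only [Real.norm_eq_abs] at h3
  rw [h3]
  exact ENNReal.toReal_le_of_le_ofReal (by positivity) h

theorem exists_lipschitz_of_contDiffOn {Φ : ℝ → ℝ} {U : Set ℝ} {p q : ℝ} (hU : IsOpen U)
    (hΦ : ContDiffOn ℝ ∞ Φ U) (hpq : Icc p q ⊆ U) :
    ∃ C, ∀ y ∈ Icc p q, ∀ z ∈ Icc p q, |Φ z - Φ y| ≤ C * |z - y| := by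
  have hd : ContDiffOn ℝ ∞ (deriv Φ) U := hΦ.deriv_of_isOpen hU (by simp)
  obtain ⟨C, hC⟩ := (isCompact_Icc (a := p) (b := q)).exists_bound_of_continuousOn
    (hd.continuousOn.mono hpq)
  refine ⟨C, fun y hy z hz => ?_⟩
  exact (convex_Icc p q).norm_image_sub_le_of_norm_deriv_le
    (fun x hx => (hΦ.differentiableOn (by simp)).differentiableAt (hU.mem_nhds (hpq hx)))
    hC hy hz

/-- Superposition with a smooth function `Φ` with `Φ(0) = 0`. -/
theorem MemW.superpose {Φ h : ℝ → ℝ} {U : Set ℝ} {p q : ℝ} (hh : MemW h) (hU : IsOpen U)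
    (hΦ : ContDiffOn ℝ ∞ Φ U) (hΦ0 : Φ 0 = 0) (hpq : Icc p q ⊆ U) (h0 : (0 : ℝ) ∈ Icc p q)
    (hmem : ∀ x, h x ∈ Icc p q) : MemW fun x => Φ (h x) := by
  have hs : ∀ {Φ : ℝ → ℝ}, ContDiffOn ℝ ∞ Φ U → ContDiff ℝ ∞ fun x => Φ (h x) :=
    fun hΦ => hΦ.comp_contDiff hh.1 fun x => hpq (hmem x)
  have hi : ∀ {Φ : ℝ → ℝ}, ContDiffOn ℝ ∞ Φ U → Φ 0 = 0 → Integrable fun x => Φ (h x) := by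
    intro Φ hΦ hΦ0
    obtain ⟨C, hC⟩ := exists_lipschitz_of_contDiffOn hU hΦ hpq
    refine (hh.int.abs.const_mul C).mono' (hs hΦ).continuous.aestronglyMeasurable
      (Eventually.of_forall fun x => ?_)
    have := hC 0 h0 (h x) (hmem x)
    simpa [hΦ0] using this
  refine memW_iff.2 fun n => ?_
  induction n generalizing Φ with
  | zero => exact ⟨hs hΦ, hi hΦ hΦ0⟩
  | succ n ih =>
    refine ⟨hs hΦ, hi hΦ hΦ0, ?_⟩
    have hd : ContDiffOn ℝ ∞ (fun y => deriv Φ y - deriv Φ 0) U :=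
      (hΦ.deriv_of_isOpen hU (by simp)).sub contDiffOn_const
    have e : deriv (fun x => Φ (h x)) = fun x =>
        (deriv Φ (h x) - deriv Φ 0) * deriv h x + deriv h x * deriv Φ 0 := by
      funext x
      have h1 : HasDerivAt Φ (deriv Φ (h x)) (h x) :=
        ((hΦ.differentiableOn (by simp)).differentiableAt
          (hU.mem_nhds (hpq (hmem x)))).hasDerivAt
      have h2 : HasDerivAt (fun x => Φ (h x)) _ x := h1.comp x (diff_of hh.1 x).hasDerivAt
      rw [h2.deriv]
      ring
    rw [e]
    exact ((ih hd (sub_self _)).mul (hh.der.toB n)).add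
      (((memW_iff.1 hh.der) n).mul (B.const n _))

/-! ### Continuity of products, superpositions and compositions -/

theorem MemG.toB {u : ℝ → ℝ} (h : MemG u) (n : ℕ) : B n u := by
  have hb : ∃ C, ∀ x, |u x| ≤ C := ⟨_, fun x => G.abs_le ⟨u, h⟩ x⟩
  cases n with
  | zero => exact ⟨h.smooth, hb⟩
  | succ n => exact ⟨h.smooth, hb, h.2.1.toB n⟩

/-- The inclusion of `W^{∞,1}(ℝ)` in `𝔤`. -/
def W.toG (f : W) : G := ⟨f, diff_of f.2.1, f.2.der, f.2.tendsto_atBot⟩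

theorem W.toG_apply (f : W) (x : ℝ) : (W.toG f : ℝ → ℝ) x = (f : ℝ → ℝ) x := rfl

theorem G.D_toG (f : W) : G.D (W.toG f) = W.der f := rfl

theorem W.continuous_toG : Continuous W.toG :=
  G.isInducing_D.continuous_iff.2 W.derL.continuous

/-- The product of an element of `W^{∞,1}(ℝ)` with an element of `𝔤`. -/
def W.mulG (f : W) (u : G) : W := ⟨fun x => (f : ℝ → ℝ) x * (u : ℝ → ℝ) x, f.2.mul (MemG.toB u.2)⟩

theorem W.mulG_apply (f : W) (u : G) (x : ℝ) :
    (W.mulG f u : ℝ → ℝ) x = (f : ℝ → ℝ) x * (u : ℝ → ℝ) x := rfl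

/-- Pointwise multiplication on `W^{∞,1}(ℝ)`. -/
def W.mul (f g : W) : W := W.mulG f (W.toG g)

theorem W.mul_apply (f g : W) (x : ℝ) :
    (W.mul f g : ℝ → ℝ) x = (f : ℝ → ℝ) x * (g : ℝ → ℝ) x := rfl

theorem W.der_mulG (f : W) (u : G) :
    W.der (W.mulG f u) = W.mulG (W.der f) u + W.mul f (G.D u) :=
  Subtype.ext (deriv_mul' f.2.1 (G.smooth u))

theorem W.seminorm_zero_mulG_le (f : W) (u : G) :
    W.seminorm 0 (W.mulG f u) ≤ W.seminorm 0 f * W.seminorm 0 (G.D u) := by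
  rw [W.seminorm_zero, W.seminorm_zero f, ← integral_mul_const]
  refine integral_mono (W.mulG f u).2.int.abs (f.2.int.abs.mul_const _) fun x => ?_
  simp only [W.mulG_apply, abs_mul]
  exact mul_le_mul_of_nonneg_left (G.abs_le u x) (abs_nonneg _)

section ContinuousOperations

variable {Z : Type*} [TopologicalSpace Z]

/-- Continuity of a map into `W^{∞,1}(ℝ)` with respect to the seminorms of order at most `n`. It
serves to prove continuity by induction on the number of derivatives. -/
def ContOrder (n : ℕ) (F : Z → W) : Prop :=
  ∀ k ≤ n, ∀ z₀, Tendsto (fun z => W.seminorm k (F z - F z₀)) (𝓝 z₀) (𝓝 0)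

theorem continuous_iff_contOrder {F : Z → W} : Continuous F ↔ ∀ n, ContOrder n F := by
  rw [continuous_iff_continuousAt]
  exact ⟨fun h n k _ z₀ => W.tendsto_iff.1 (h z₀) k,
    fun h z₀ => W.tendsto_iff.2 fun k => h k k le_rfl z₀⟩

theorem ContOrder.of_zero {F : Z → W}
    (h : ∀ z₀, Tendsto (fun z => W.seminorm 0 (F z - F z₀)) (𝓝 z₀) (𝓝 0)) : ContOrder 0 F := by
  intro k hk
  obtain rfl := Nat.le_zero.1 hk
  exact h

theorem contOrder_succ {n : ℕ} {F : Z → W} :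
    ContOrder (n + 1) F ↔ ContOrder 0 F ∧ ContOrder n fun z => W.der (F z) := by
  constructor
  · refine fun h => ⟨fun k hk => h k (hk.trans (Nat.zero_le _)), fun k hk z₀ => ?_⟩
    simpa only [W.seminorm_succ, map_sub] using h (k + 1) (by omega) z₀
  · rintro ⟨h0, h⟩ (_ | k) hk z₀
    · exact h0 0 le_rfl z₀
    · simpa only [W.seminorm_succ, map_sub] using h k (by omega) z₀

theorem ContOrder.add {n : ℕ} {F H : Z → W} (hF : ContOrder n F) (hH : ContOrder n H) :
    ContOrder n fun z => F z + H z := by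
  intro k hk z₀
  have h := (hF k hk z₀).add (hH k hk z₀)
  rw [add_zero] at h
  refine squeeze_zero (fun _ => apply_nonneg _ _) (fun z => ?_) h
  rw [add_sub_add_comm]
  exact map_add_le_add _ _ _

theorem ContOrder.mulG {n : ℕ} {F : Z → W} {u : Z → G} (hF : ContOrder n F) (hu : Continuous u) :
    ContOrder n fun z => W.mulG (F z) (u z) := by
  have zero : ∀ {F : Z → W} {u : Z → G}, ContOrder 0 F → Continuous u →
      ContOrder 0 fun z => W.mulG (F z) (u z) := by
    intro F u hF hu
    have hD : Continuous fun z => G.D (u z) := G.DL.continuous.comp hu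
    refine ContOrder.of_zero fun z₀ => ?_
    have h1 := ((hF 0 le_rfl z₀).mul (((W.continuous_seminorm 0).comp hD).tendsto z₀)).add
      ((W.tendsto_iff.1 (hD.tendsto z₀) 0).const_mul (W.seminorm 0 (F z₀)))
    rw [zero_mul, mul_zero, zero_add] at h1
    refine squeeze_zero (fun _ => apply_nonneg _ _) (fun z => ?_) h1
    have e : W.mulG (F z) (u z) - W.mulG (F z₀) (u z₀) =
        W.mulG (F z - F z₀) (u z) + W.mulG (F z₀) (u z - u z₀) := by
      refine Subtype.ext (funext fun x => ?_)
      simp only [W.mulG, AddSubgroupClass.coe_sub, Pi.sub_apply, Submodule.coe_add, Pi.add_apply]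
      ring
    rw [e, ← map_sub]
    exact (map_add_le_add _ _ _).trans
      (add_le_add (W.seminorm_zero_mulG_le _ _) (W.seminorm_zero_mulG_le _ _))
  induction n generalizing F u with
  | zero => exact zero hF hu
  | succ n ih =>
    refine contOrder_succ.2 ⟨zero (contOrder_succ.1 hF).1 hu, ?_⟩
    simp only [W.der_mulG, W.mul]
    exact (ih (contOrder_succ.1 hF).2 hu).add (ih (fun k hk => hF k (by omega))
      (W.continuous_toG.comp (G.DL.continuous.comp hu)))

theorem ContOrder.mul {n : ℕ} {F H : Z → W} (hF : ContOrder n F) (hH : Continuous H) :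
    ContOrder n fun z => W.mul (F z) (H z) :=
  hF.mulG (W.continuous_toG.comp hH)

theorem W.continuous_mulG : Continuous fun p : W × G => W.mulG p.1 p.2 :=
  continuous_iff_contOrder.2 fun n =>
    (continuous_iff_contOrder.1 continuous_fst n).mulG continuous_snd

theorem W.continuous_mul : Continuous fun p : W × W => W.mul p.1 p.2 :=
  continuous_iff_contOrder.2 fun n =>
    (continuous_iff_contOrder.1 continuous_fst n).mul continuous_snd

/-- Superposition operators are continuous on `W^{∞,1}(ℝ)`. The induction runs over the order of
the seminorm and all `Φ` at once, since `(Φ ∘ h)' = ((Φ' - Φ'(0)) ∘ h) h' + Φ'(0) h'`. -/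
theorem continuous_superpose {h H : Z → W} (hh : Continuous h) {U : Set ℝ} (hU : IsOpen U)
    (hK : ∀ z₀, ∃ p q, (0 : ℝ) ∈ Icc p q ∧ Icc p q ⊆ U ∧
      ∀ᶠ z in 𝓝 z₀, ∀ x, (h z : ℝ → ℝ) x ∈ Icc p q)
    {Φ : ℝ → ℝ} (hΦ : ContDiffOn ℝ ∞ Φ U) (hΦ0 : Φ 0 = 0)
    (hH : ∀ z x, (H z : ℝ → ℝ) x = Φ ((h z : ℝ → ℝ) x)) : Continuous H := by
  refine continuous_iff_contOrder.2 fun n => ?_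
  have zero : ∀ {Φ : ℝ → ℝ} {H : Z → W}, ContDiffOn ℝ ∞ Φ U →
      (∀ z x, (H z : ℝ → ℝ) x = Φ ((h z : ℝ → ℝ) x)) → ContOrder 0 H := by
    intro Φ H hΦ hH
    refine ContOrder.of_zero fun z₀ => ?_
    obtain ⟨p, q, -, hpq, hev⟩ := hK z₀
    obtain ⟨C, hC⟩ := exists_lipschitz_of_contDiffOn hU hΦ hpq
    have h1 := (W.tendsto_iff.1 (hh.tendsto z₀) 0).const_mul C
    rw [mul_zero] at h1
    refine squeeze_zero' (Eventually.of_forall fun _ => apply_nonneg _ _) ?_ h1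
    filter_upwards [hev] with z hz
    rw [W.seminorm_zero, W.seminorm_zero, ← integral_const_mul]
    refine integral_mono (H z - H z₀).2.int.abs ((h z - h z₀).2.int.abs.const_mul _) fun x => ?_
    simp only [AddSubgroupClass.coe_sub, Pi.sub_apply, hH]
    exact hC _ (hev.self_of_nhds x) _ (hz x)
  induction n generalizing Φ H with
  | zero => exact zero hΦ hH
  | succ n ih =>
    refine contOrder_succ.2 ⟨zero hΦ hH, ?_⟩
    have hd : ContDiffOn ℝ ∞ (fun y => deriv Φ y - deriv Φ 0) U :=
      (hΦ.deriv_of_isOpen hU (by simp)).sub contDiffOn_const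
    have hm : ∀ z, MemW fun x => deriv Φ ((h z : ℝ → ℝ) x) - deriv Φ 0 := fun z => by
      obtain ⟨p, q, h0, hpq, hev⟩ := hK z
      exact (h z).2.superpose hU hd (sub_self _) hpq h0 hev.self_of_nhds
    have e : (fun z => W.der (H z)) = fun z =>
        W.mul (⟨_, hm z⟩ : W) (W.der (h z)) + deriv Φ 0 • W.der (h z) := by
      funext z
      refine Subtype.ext (funext fun x => ?_)
      obtain ⟨p, q, h0, hpq, hev⟩ := hK z
      have h1 : HasDerivAt Φ (deriv Φ ((h z : ℝ → ℝ) x)) ((h z : ℝ → ℝ) x) :=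
        ((hΦ.differentiableOn (by simp)).differentiableAt
          (hU.mem_nhds (hpq (hev.self_of_nhds x)))).hasDerivAt
      have h2 : HasDerivAt (fun x => Φ ((h z : ℝ → ℝ) x)) _ x := h1.comp x (W.hasDerivAt (h z) x)
      rw [W.der_apply, funext (hH z), h2.deriv]
      simp only [Submodule.coe_add, Submodule.coe_smul, Pi.add_apply, Pi.smul_apply, smul_eq_mul,
        W.mul_apply, W.der_apply]
      ring
    rw [e]
    have hc : Continuous fun z => deriv Φ 0 • W.derL (h z) :=
      (continuous_const_smul _).comp (W.derL.continuous.comp hh)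
    exact ((ih hd (sub_self _) fun z x => rfl).mul (W.derL.continuous.comp hh)).add
      (continuous_iff_contOrder.1 hc n)

/-- `1 / (1 + f) - 1`, for `f ∈ W^{∞,1}(ℝ)` with `f > -1`. -/
def W.recip (f : W) (hf : ∀ x, -1 < (f : ℝ → ℝ) x) : W :=
  ⟨fun x => (-1 * (f : ℝ → ℝ) x) * (1 + (f : ℝ → ℝ) x)⁻¹, by
    obtain ⟨c, hc, H⟩ := MemW.lower f.2 hf
    exact (f.2.const_mul (-1)).mul fun n =>
      B.inv hc H ((B.const n 1).add (f.2.toB n))⟩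

theorem W.recip_apply (f : W) (hf : ∀ x, -1 < (f : ℝ → ℝ) x) (x : ℝ) :
    (W.recip f hf : ℝ → ℝ) x = (1 + (f : ℝ → ℝ) x)⁻¹ - 1 := by
  have : 1 + (f : ℝ → ℝ) x ≠ 0 := by linarith [hf x]
  change (-1 * (f : ℝ → ℝ) x) * (1 + (f : ℝ → ℝ) x)⁻¹ = _
  field_simp
  ring

theorem W.eventually_abs_sub_lt {ι : Type*} {l : Filter ι} {F : ι → W} {f : W}
    (h : Tendsto F l (𝓝 f)) {ε : ℝ} (hε : 0 < ε) :
    ∀ᶠ z in l, ∀ x, |(F z : ℝ → ℝ) x - (f : ℝ → ℝ) x| < ε := by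
  filter_upwards [(W.tendsto_iff.1 h 1).eventually_lt_const hε] with z hz x
  exact (W.abs_le (F z - f) x).trans_lt hz

theorem continuous_recip {h : Z → W} (hh : Continuous h)
    (hpos : ∀ z x, -1 < (h z : ℝ → ℝ) x) : Continuous fun z => W.recip (h z) (hpos z) := by
  refine continuous_superpose hh (U := Ioi (-1)) isOpen_Ioi (fun z₀ => ?_)
    (Φ := fun y => (1 + y)⁻¹ - 1) ?_ (by simp) fun z x => W.recip_apply _ _ x
  · obtain ⟨c, hc, H⟩ := MemW.lower (h z₀).2 (hpos z₀)
    obtain ⟨C, hC⟩ := (h z₀).2.bdd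
    have hC0 : 0 ≤ C := (abs_nonneg _).trans (hC 0)
    refine ⟨min 0 (c / 2 - 1), C + c, ⟨min_le_left _ _, by positivity⟩, fun y hy => ?_, ?_⟩
    · exact (lt_min (by norm_num) (by linarith)).trans_le hy.1
    · filter_upwards [W.eventually_abs_sub_lt (hh.tendsto z₀) (half_pos hc)] with z hz x
      have h1 := abs_lt.1 (hz x)
      have h2 := abs_le.1 (hC x)
      exact ⟨(min_le_right _ _).trans (by linarith [H x]), by linarith⟩
  · refine ContDiffOn.sub (ContDiffOn.inv (by fun_prop) fun y hy => ?_) contDiffOn_const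
    have : -1 < y := hy
    linarith

theorem deriv_disp_gt (φ : DiffTilde) (x : ℝ) : -1 < (G.D (disp φ) : ℝ → ℝ) x := φ.2.2 x

theorem W.seminorm_zero_comp_le (f : W) (φ : DiffTilde) {c : ℝ} (hc : 0 < c)
    (hφ : ∀ x, c ≤ deriv φ.1 x) : W.seminorm 0 (W.comp f φ) ≤ c⁻¹ * W.seminorm 0 f := by
  rw [W.seminorm_zero, W.seminorm_zero, ← DiffTilde.integral_comp φ fun x => |(f : ℝ → ℝ) x|,
    ← integral_const_mul]
  have hi : Integrable fun x => deriv φ.1 x * |(f : ℝ → ℝ) (φ.1 x)| := by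
    have := int_mul (W.comp f φ).2.int.abs (MemDiff.B φ.2 0).smooth.continuous (MemDiff.B φ.2 0).bdd
    simpa only [mul_comm, W.comp_apply] using this
  refine integral_mono (W.comp f φ).2.int.abs (hi.const_mul _) fun x => ?_
  simp only [W.comp_apply]
  rw [inv_mul_eq_div, le_div_iff₀ hc, mul_comm]
  exact mul_le_mul_of_nonneg_right (hφ x) (abs_nonneg _)

theorem DiffTilde.deriv_le (φ : DiffTilde) (x : ℝ) :
    deriv φ.1 x ≤ 1 + W.seminorm 1 (G.D (disp φ)) := by
  rw [DiffTilde.deriv_eq]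
  have := (le_abs_self _).trans (W.abs_le (G.D (disp φ)) x)
  rw [G.D_apply] at this
  linarith

theorem DiffTilde.integral_abs_comp_inv (φ : DiffTilde) (g : ℝ → ℝ) :
    ∫ x, |g x| = ∫ x, deriv φ.1 x * |g (φ.1 x)| :=
  (DiffTilde.integral_comp φ fun x => |g x|).symm

/-- Change of variables: composition with `φ⁻¹` is bounded for the `L¹` norm. -/
theorem W.seminorm_zero_comp_inv_le (f : W) (φ : DiffTilde) :
    W.seminorm 0 (W.comp f φ⁻¹) ≤ (1 + W.seminorm 1 (G.D (disp φ))) * W.seminorm 0 f := by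
  rw [W.seminorm_zero, W.seminorm_zero, DiffTilde.integral_abs_comp_inv φ, ← integral_const_mul]
  simp only [W.comp_apply, DiffTilde.inv_apply]
  refine integral_mono ?_ (f.2.int.abs.const_mul _) fun x =>
    mul_le_mul_of_nonneg_right (DiffTilde.deriv_le φ x) (abs_nonneg _)
  have := int_mul f.2.int.abs (MemDiff.B φ.2 0).smooth.continuous (MemDiff.B φ.2 0).bdd
  simpa only [mul_comm] using this

/-- Composition with a fixed function is Lipschitz from displacements, with the uniform norm,
to `L¹`: integrate `H'(φ_s) (ψ - φ)` along the segment `φ_s` from `φ` to `ψ`. -/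
theorem W.seminorm_zero_comp_sub_le (H : W) (φ ψ : DiffTilde) {c : ℝ} (hc : 0 < c)
    (hφ : ∀ x, c ≤ deriv φ.1 x) (hψ : ∀ x, c ≤ deriv ψ.1 x) :
    W.seminorm 0 (W.comp H ψ - W.comp H φ) ≤
      W.seminorm 0 (G.D (disp ψ - disp φ)) * (c⁻¹ * W.seminorm 1 H) := by
  have hlow : ∀ s ∈ Icc (0 : ℝ) 1, ∀ x,
      c - 1 ≤ deriv ((disp φ + s • (disp ψ - disp φ) : G) : ℝ → ℝ) x := by
    intro s hs x
    have e : deriv ((disp φ + s • (disp ψ - disp φ) : G) : ℝ → ℝ) x =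
        deriv (disp φ : ℝ → ℝ) x + s * (deriv (disp ψ : ℝ → ℝ) x - deriv (disp φ : ℝ → ℝ) x) := by
      simp only [← G.D_apply, map_add, map_smul, map_sub]
      rfl
    have h1 := hφ x
    have h2 := hψ x
    rw [DiffTilde.deriv_eq] at h1 h2
    rw [e]
    nlinarith [mul_nonneg hs.1 (sub_nonneg.2 h2), mul_nonneg (sub_nonneg.2 hs.2) (sub_nonneg.2 h1)]
  have hgt : ∀ s ∈ Icc (0 : ℝ) 1, ∀ x,
      -1 < deriv ((disp φ + s • (disp ψ - disp φ) : G) : ℝ → ℝ) x := fun s hs x =>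
    lt_of_lt_of_le (by linarith) (hlow s hs x)
  have hu : uIcc (0 : ℝ) 1 = Icc 0 1 := uIcc_of_le zero_le_one
  have happ : ∀ s x, x + ((disp φ + s • (disp ψ - disp φ) : G) : ℝ → ℝ) x =
      φ.1 x + s * (ψ.1 x - φ.1 x) := fun s x => by
    simp only [Submodule.coe_add, Submodule.coe_smul, AddSubgroupClass.coe_sub, Pi.add_apply,
      Pi.smul_apply, Pi.sub_apply, smul_eq_mul, disp_apply]
    ring
  have hcont : Continuous fun p : ℝ × ℝ =>
      deriv (H : ℝ → ℝ) (φ.1 p.2 + p.1 * (ψ.1 p.2 - φ.1 p.2)) * (ψ.1 p.2 - φ.1 p.2) := by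
    have h1 := (DiffTilde.smooth φ).continuous
    have h2 := (DiffTilde.smooth ψ).continuous
    have h3 := (contDiff_deriv H.2.1).continuous
    fun_prop
  have hle : ∀ s ∈ Icc (0 : ℝ) 1, ∀ x,
      |deriv (H : ℝ → ℝ) (φ.1 x + s * (ψ.1 x - φ.1 x)) * (ψ.1 x - φ.1 x)| ≤
        W.seminorm 0 (G.D (disp ψ - disp φ)) *
          |deriv (H : ℝ → ℝ) (φ.1 x + s * (ψ.1 x - φ.1 x))| := fun s _ x => by
    rw [abs_mul, mul_comm]
    refine mul_le_mul_of_nonneg_right ?_ (abs_nonneg _)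
    have := G.abs_le (disp ψ - disp φ) x
    simp only [AddSubgroupClass.coe_sub, Pi.sub_apply, disp_apply, sub_sub_sub_cancel_right] at this
    exact this
  have hi : ∀ s ∈ Icc (0 : ℝ) 1,
      Integrable fun x => deriv (H : ℝ → ℝ) (φ.1 x + s * (ψ.1 x - φ.1 x)) := fun s hs => by
    have := (W.comp (W.der H) (DiffTilde.ofDisp _ (hgt s hs))).2.int
    refine this.congr (Eventually.of_forall fun x => ?_)
    simp only [W.comp_apply, DiffTilde.ofDisp_apply, happ, W.der_apply]
  have key := integral_abs_le_of_eq_intervalIntegral (a := 0) (b := 1)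
    (c := fun x => (H : ℝ → ℝ) (ψ.1 x) - (H : ℝ → ℝ) (φ.1 x))
    (v := fun s x => deriv (H : ℝ → ℝ) (φ.1 x + s * (ψ.1 x - φ.1 x)) * (ψ.1 x - φ.1 x))
    (M := W.seminorm 0 (G.D (disp ψ - disp φ)) * (c⁻¹ * W.seminorm 1 H))
    hcont.continuousOn ?_ ?_ ?_ ?_
  · rw [W.seminorm_zero]
    simpa [W.comp_apply] using key
  · intro s hs
    rw [hu] at hs
    exact ((hi s hs).abs.const_mul _).mono' (hcont.comp (Continuous.prodMk_right s)).aestronglyMeasurable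
      (Eventually.of_forall (hle s hs))
  · intro s hs
    rw [hu] at hs
    have h1 := W.seminorm_zero_comp_le (W.der H) (DiffTilde.ofDisp _ (hgt s hs)) hc fun x => by
      rw [DiffTilde.deriv_eq, disp_ofDisp]
      linarith [hlow s hs x]
    rw [← W.seminorm_succ, W.seminorm_zero] at h1
    simp only [W.comp_apply, DiffTilde.ofDisp_apply, happ, W.der_apply] at h1
    refine le_trans ?_ (mul_le_mul_of_nonneg_left h1 (apply_nonneg _ _))
    rw [← integral_const_mul]
    refine integral_mono_of_nonneg (Eventually.of_forall fun _ => abs_nonneg _)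
      ((hi s hs).abs.const_mul _) (Eventually.of_forall (hle s hs))
  · exact (H.2.1.continuous.comp (DiffTilde.smooth ψ).continuous).sub
      (H.2.1.continuous.comp (DiffTilde.smooth φ).continuous)
  · intro x
    have hd : ∀ s, HasDerivAt (fun s => (H : ℝ → ℝ) (φ.1 x + s * (ψ.1 x - φ.1 x)))
        (deriv (H : ℝ → ℝ) (φ.1 x + s * (ψ.1 x - φ.1 x)) * (ψ.1 x - φ.1 x)) s := fun s => by
      refine (W.hasDerivAt H _).comp s ?_
      simpa using ((hasDerivAt_id s).mul_const (ψ.1 x - φ.1 x)).const_add (φ.1 x)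
    rw [intervalIntegral.integral_eq_sub_of_hasDerivAt (fun s _ => hd s)
      ((hcont.comp (Continuous.prodMk_left x)).intervalIntegrable _ _)]
    simp

/-- The quotient `f / φ'`, for `f ∈ W^{∞,1}(ℝ)`. -/
def W.divDeriv (f : W) (φ : DiffTilde) : W :=
  f + W.mul f (W.recip (G.D (disp φ)) (deriv_disp_gt φ))

theorem W.divDeriv_apply (f : W) (φ : DiffTilde) (x : ℝ) :
    (W.divDeriv f φ : ℝ → ℝ) x = (f : ℝ → ℝ) x / deriv φ.1 x := by
  simp only [W.divDeriv, Submodule.coe_add, Pi.add_apply, W.mul_apply, W.recip_apply,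
    DiffTilde.deriv_eq, G.D_apply]
  ring

theorem continuous_divDeriv {F : Z → W} {φ : Z → DiffTilde} (hF : Continuous F)
    (hφ : Continuous fun z => disp (φ z)) : Continuous fun z => W.divDeriv (F z) (φ z) :=
  hF.add (W.continuous_mul.comp (hF.prodMk
    (continuous_recip (G.DL.continuous.comp hφ) fun z => deriv_disp_gt (φ z))))

/-- The map `(f, φ) ↦ f ∘ φ⁻¹` is continuous. The induction on the order of the seminorm rests on
`(f ∘ φ⁻¹)' = (f' / φ') ∘ φ⁻¹`. -/
theorem continuous_comp_inv {F : Z → W} {φ : Z → DiffTilde} (hF : Continuous F)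
    (hφ : Continuous fun z => disp (φ z)) : Continuous fun z => W.comp (F z) (φ z)⁻¹ := by
  have hD : Continuous fun z => G.D (disp (φ z)) := G.DL.continuous.comp hφ
  refine continuous_iff_contOrder.2 fun n => ?_
  have zero : ∀ {F : Z → W}, Continuous F → ContOrder 0 fun z => W.comp (F z) (φ z)⁻¹ := by
    intro F hF
    refine ContOrder.of_zero fun z₀ => ?_
    obtain ⟨c, hc, hlow⟩ := MemDiff.lower (φ z₀).2
    set H := W.comp (F z₀) (φ z₀)⁻¹ with hH
    have h1 : Tendsto (fun z => 1 + W.seminorm 1 (G.D (disp (φ z)))) (𝓝 z₀)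
        (𝓝 (1 + W.seminorm 1 (G.D (disp (φ z₀))))) :=
      (((W.continuous_seminorm 1).comp hD).tendsto z₀).const_add 1
    have h2 := W.tendsto_iff.1 (hF.tendsto z₀) 0
    have h3 := (W.tendsto_iff.1 (hD.tendsto z₀) 0).mul_const ((c / 2)⁻¹ * W.seminorm 1 H)
    have h4 := h1.mul (h2.add h3)
    rw [zero_mul, add_zero, mul_zero] at h4
    refine squeeze_zero' (Eventually.of_forall fun _ => apply_nonneg _ _) ?_ h4
    filter_upwards [W.eventually_abs_sub_lt (hD.tendsto z₀) (half_pos hc)] with z hz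
    have e : W.comp (F z) (φ z)⁻¹ - H =
        W.comp (F z - F z₀ + (W.comp H (φ z₀) - W.comp H (φ z))) (φ z)⁻¹ := by
      refine Subtype.ext (funext fun x => ?_)
      simp only [hH, W.comp, AddSubgroupClass.coe_sub, Submodule.coe_add, Pi.sub_apply,
        Pi.add_apply, DiffTilde.inv_apply, DiffTilde.apply_inv]
      ring
    rw [e]
    refine (W.seminorm_zero_comp_inv_le _ _).trans (mul_le_mul_of_nonneg_left ?_ (by positivity))
    refine (map_add_le_add _ _ _).trans (add_le_add le_rfl ?_)
    rw [map_sub_rev (W.seminorm 0)]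
    have := W.seminorm_zero_comp_sub_le H (φ z₀) (φ z) (half_pos hc)
      (fun x => (half_le_self hc.le).trans (hlow x)) fun x => by
        have h5 := (abs_lt.1 (hz x)).1
        have h6 := hlow x
        rw [DiffTilde.deriv_eq] at h6 ⊢
        rw [G.D_apply, G.D_apply] at h5
        linarith
    rwa [map_sub G.D] at this
  induction n generalizing F with
  | zero => exact zero hF
  | succ n ih =>
    refine contOrder_succ.2 ⟨zero hF, ?_⟩
    have hq := continuous_divDeriv (W.derL.continuous.comp hF) hφ
    convert ih hq using 2 with z
    refine Subtype.ext (funext fun x => ?_)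
    rw [W.comp_apply, W.divDeriv_apply]
    exact ((W.hasDerivAt (F z) ((φ z)⁻¹.1 x)).comp x (DiffTilde.hasDerivAt_inv (φ z) x)).deriv

theorem G.D_rightTranslate_inv (X : G) (φ : DiffTilde) :
    G.D (rightTranslate X φ⁻¹) = W.comp (W.divDeriv (G.D X) φ) φ⁻¹ := by
  refine Subtype.ext (funext fun x => ?_)
  rw [W.comp_apply, W.divDeriv_apply]
  exact ((G.hasDerivAt X (φ⁻¹.1 x)).comp x (DiffTilde.hasDerivAt_inv φ x)).deriv

/-- The map `(X, φ) ↦ X ∘ φ⁻¹` is continuous on `𝔤 × Diff~(ℝ)`. -/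
theorem continuous_rightTranslate_inv {X : Z → G} {φ : Z → DiffTilde} (hX : Continuous X)
    (hφ : Continuous fun z => disp (φ z)) :
    Continuous fun z => rightTranslate (X z) (φ z)⁻¹ := by
  refine G.isInducing_D.continuous_iff.2 ?_
  simp only [Function.comp_def, G.D_rightTranslate_inv]
  exact continuous_comp_inv (continuous_divDeriv (G.DL.continuous.comp hX) hφ) hφ

end ContinuousOperations

/-! ### Continuously differentiable curves -/

theorem G.hasDerivWithinAt_iff {u : ℝ → G} {v : G} {J : Set ℝ} {t : ℝ} :
    HasDerivWithinAt u v J t ↔ HasDerivWithinAt (fun s => G.D (u s)) (G.D v) J t := by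
  rw [hasDerivWithinAt_iff_tendsto, hasDerivWithinAt_iff_tendsto, G.isInducing_D.tendsto_nhds_iff]
  simp only [Function.comp_def, map_smul, map_sub]

theorem intervalIntegral_eq_sub_of_hasDerivWithinAt {f v : ℝ → ℝ} {J : Set ℝ} (hJ : J.OrdConnected)
    (hv : ContinuousOn v J) (hf : ∀ t ∈ J, HasDerivWithinAt f (v t) J t) {a b : ℝ} (ha : a ∈ J)
    (hb : b ∈ J) : ∫ t in a..b, v t = f b - f a := by
  have hsub : uIcc a b ⊆ J := hJ.uIcc_subset ha hb
  refine intervalIntegral.integral_eq_sub_of_hasDeriv_right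
    (fun t ht => ((hf t (hsub ht)).continuousWithinAt).mono hsub) (fun t ht => ?_)
    (hv.mono hsub).intervalIntegrable
  have ht' : t ∈ uIcc a b := ⟨ht.1.le, ht.2.le⟩
  refine ((hf t (hsub ht')).mono hsub).hasDerivAt ?_ |>.hasDerivWithinAt
  exact Icc_mem_nhds ht.1 ht.2

theorem deriv_eq_intervalIntegral_deriv {g : ℝ → ℝ} {v : ℝ → ℝ → ℝ} {a b C : ℝ}
    (hg : ∀ x, g x = ∫ s in a..b, v s x) (hd : ∀ s, Differentiable ℝ (v s))
    (hc : ∀ x, ContinuousOn (fun s => v s x) (uIcc a b))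
    (hc' : ∀ x, ContinuousOn (fun s => deriv (v s) x) (uIcc a b))
    (hC : ∀ s ∈ uIcc a b, ∀ x, |deriv (v s) x| ≤ C) (x : ℝ) :
    deriv g x = ∫ s in a..b, deriv (v s) x := by
  rw [funext hg]
  refine (intervalIntegral.hasDerivAt_integral_of_dominated_loc_of_deriv_le
    (F := fun x s => v s x) (F' := fun x s => deriv (v s) x) (bound := fun _ => C) univ_mem
    (Eventually.of_forall fun y => ?_) (hc x).intervalIntegrable ?_
    (Eventually.of_forall fun s hs y _ => hC s (uIoc_subset_uIcc hs) y)
    intervalIntegrable_const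
    (Eventually.of_forall fun s _ y _ => (hd s y).hasDerivAt)).2.deriv
  · exact ((hc y).mono uIoc_subset_uIcc).aestronglyMeasurable measurableSet_uIoc
  · exact ((hc' x).mono uIoc_subset_uIcc).aestronglyMeasurable measurableSet_uIoc

theorem W.continuousOn_eval {V : ℝ → W} {J : Set ℝ} (hV : ContinuousOn V J) :
    ContinuousOn (fun p : ℝ × ℝ => (V p.1 : ℝ → ℝ) p.2) (J ×ˢ univ) :=
  W.continuous_eval.comp_continuousOn
    ((hV.comp continuousOn_fst fun _ hp => hp.1).prodMk continuousOn_snd)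

theorem W.exists_seminorm_le {V : ℝ → W} {K : Set ℝ} (hK : IsCompact K) (hV : ContinuousOn V K)
    (k : ℕ) : ∃ C, ∀ s ∈ K, W.seminorm k (V s) ≤ C := by
  obtain ⟨C, hC⟩ := hK.exists_bound_of_continuousOn
    ((W.continuous_seminorm k).comp_continuousOn hV)
  exact ⟨C, fun s hs => (le_abs_self _).trans (hC s hs)⟩

/-- If `f = ∫ V` pointwise, then each seminorm of `f` is at most the integral of the seminorm. -/
theorem W.seminorm_le_of_eq_intervalIntegral (k : ℕ) {f : W} {V : ℝ → W} {a b M : ℝ}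
    (hV : ContinuousOn V (uIcc a b))
    (hf : ∀ x, (f : ℝ → ℝ) x = ∫ s in a..b, (V s : ℝ → ℝ) x)
    (hM : ∀ s ∈ uIcc a b, W.seminorm k (V s) ≤ M) : W.seminorm k f ≤ M * |b - a| := by
  induction k generalizing f V with
  | zero =>
    rw [W.seminorm_zero]
    refine integral_abs_le_of_eq_intervalIntegral (v := fun s x => (V s : ℝ → ℝ) x)
      (W.continuousOn_eval hV) (fun s _ => (V s).2.int) (fun s hs => ?_) f.2.1.continuous hf
    rw [← W.seminorm_zero]
    exact hM s hs
  | succ k ih =>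
    have hV' : ContinuousOn (fun s => W.der (V s)) (uIcc a b) :=
      W.derL.continuous.comp_continuousOn hV
    obtain ⟨C, hC⟩ := W.exists_seminorm_le isCompact_uIcc hV' 1
    rw [W.seminorm_succ]
    refine ih hV' (fun x => ?_) fun s hs => by rw [← W.seminorm_succ]; exact hM s hs
    exact deriv_eq_intervalIntegral_deriv hf (fun s => diff_of (V s).2.1)
      (fun x => (W.evalL x).continuous.comp_continuousOn hV)
      (fun x => (W.evalL x).continuous.comp_continuousOn hV')
      (fun s hs x => (W.abs_le (W.der (V s)) x).trans (hC s hs)) x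

/-- The fundamental theorem of calculus in `W^{∞,1}(ℝ)`, from pointwise integrals: the difference
quotient minus `V(t)` is the mean of `V - V(t)`, which is small in every seminorm. -/
theorem W.hasDerivWithinAt_of_integral {F V : ℝ → W} {J : Set ℝ} (hJ : J.OrdConnected)
    (hV : ContinuousOn V J)
    (hF : ∀ s ∈ J, ∀ t ∈ J, ∀ x,
      (F s : ℝ → ℝ) x - (F t : ℝ → ℝ) x = ∫ r in t..s, (V r : ℝ → ℝ) x)
    {t : ℝ} (ht : t ∈ J) : HasDerivWithinAt F (V t) J t := by
  rw [hasDerivWithinAt_iff_tendsto, W.tendsto_iff]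
  intro k
  rw [Metric.tendsto_nhds]
  intro ε hε
  have h1 : ∀ᶠ r in 𝓝[J] t, W.seminorm k (V r - V t) < ε / 2 :=
    (W.tendsto_iff.1 (hV t ht) k).eventually_lt_const (half_pos hε)
  obtain ⟨δ, hδ, H⟩ := Metric.mem_nhdsWithin_iff.1 h1
  have h2 : ∀ᶠ s in 𝓝[J \ {t}] t, s ∈ Metric.ball t δ :=
    nhdsWithin_le_nhds (Metric.ball_mem_nhds t hδ)
  filter_upwards [h2, self_mem_nhdsWithin] with s hs hsJ
  have hst : s - t ≠ 0 := sub_ne_zero.2 hsJ.2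
  have hsub : uIcc t s ⊆ J := hJ.uIcc_subset ht hsJ.1
  have hball : uIcc t s ⊆ Metric.ball t δ := by
    rw [Real.ball_eq_Ioo] at hs ⊢
    exact Set.ordConnected_Ioo.uIcc_subset ⟨by linarith, by linarith⟩ hs
  have e : (s - t)⁻¹ • (F s - F t) - V t = (s - t)⁻¹ • (F s - F t - (s - t) • V t) := by
    rw [smul_sub _ (F s - F t), smul_smul, inv_mul_cancel₀ hst, one_smul]
  have h3 : W.seminorm k (F s - F t - (s - t) • V t) ≤ ε / 2 * |s - t| := by
    refine W.seminorm_le_of_eq_intervalIntegral k (V := fun r => V r - V t)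
      ((hV.mono hsub).sub continuousOn_const) (fun x => ?_)
      fun r hr => (H ⟨hball hr, hsub hr⟩).le
    have hi : IntervalIntegrable (fun r => (V r : ℝ → ℝ) x) volume t s :=
      ((W.evalL x).continuous.comp_continuousOn (hV.mono hsub)).intervalIntegrable
    simp only [AddSubgroupClass.coe_sub, Pi.sub_apply, Submodule.coe_smul, Pi.smul_apply]
    rw [intervalIntegral.integral_sub hi intervalIntegrable_const, hF s hsJ.1 t ht x,
      intervalIntegral.integral_const]
  rw [Real.dist_eq, sub_zero, abs_of_nonneg (apply_nonneg _ _), e, map_smul_eq_mul,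
    Real.norm_eq_abs, abs_inv]
  have h4 : 0 < |s - t| := abs_pos.2 hst
  calc |s - t|⁻¹ * W.seminorm k (F s - F t - (s - t) • V t)
      ≤ |s - t|⁻¹ * (ε / 2 * |s - t|) := mul_le_mul_of_nonneg_left h3 (by positivity)
    _ < ε := by field_simp; linarith

/-- A curve in `W^{∞,1}(ℝ)` is `C¹` as soon as it has a pointwise time derivative which is a
continuous curve in `W^{∞,1}(ℝ)`. -/
theorem W.isC1_of_pointwise {F V : ℝ → W} {J : Set ℝ} (hJ : J.OrdConnected)
    (hV : ContinuousOn V J)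
    (hF : ∀ t ∈ J, ∀ x, HasDerivWithinAt (fun s => (F s : ℝ → ℝ) x) ((V t : ℝ → ℝ) x) J t)
    {t : ℝ} (ht : t ∈ J) : HasDerivWithinAt F (V t) J t :=
  W.hasDerivWithinAt_of_integral hJ hV (fun _ hs _ ht x =>
    (intervalIntegral_eq_sub_of_hasDerivWithinAt hJ
      ((W.evalL x).continuous.comp_continuousOn hV) (fun t ht => hF t ht x) ht hs).symm) ht

/-- The analogue of `W.isC1_of_pointwise` for `𝔤`. The `x`-derivative is recovered by
differentiating `u(s) - u(t) = ∫ V` under the integral sign. -/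
theorem G.isC1_of_pointwise {u V : ℝ → G} {J : Set ℝ} (hJ : J.OrdConnected)
    (hV : ContinuousOn V J)
    (hu : ∀ t ∈ J, ∀ x, HasDerivWithinAt (fun s => (u s : ℝ → ℝ) x) ((V t : ℝ → ℝ) x) J t) :
    IsC1CurveOn u V J := by
  have hV' : ContinuousOn (fun s => G.D (V s)) J := G.DL.continuous.comp_continuousOn hV
  refine ⟨fun t ht => G.hasDerivWithinAt_iff.2
    (W.hasDerivWithinAt_of_integral hJ hV' (fun s hs t ht x => ?_) ht), hV⟩
  have hsub : uIcc t s ⊆ J := hJ.uIcc_subset ht hs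
  obtain ⟨C, hC⟩ := W.exists_seminorm_le isCompact_uIcc (hV'.mono hsub) 1
  have h := deriv_eq_intervalIntegral_deriv (g := fun x => (u s : ℝ → ℝ) x - (u t : ℝ → ℝ) x)
    (v := fun s => (V s : ℝ → ℝ)) (fun x => (intervalIntegral_eq_sub_of_hasDerivWithinAt hJ
      ((G.evalL x).continuous.comp_continuousOn hV) (fun t ht => hu t ht x) ht hs).symm)
    (fun s => (V s).2.1) (fun x => (G.evalL x).continuous.comp_continuousOn (hV.mono hsub))
    (fun x => (W.evalL x).continuous.comp_continuousOn (hV'.mono hsub))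
    (fun r hr x => (W.abs_le (G.D (V r)) x).trans (hC r hr)) x
  exact ((G.hasDerivAt (u s) x).sub (G.hasDerivAt (u t) x)).deriv.symm.trans h

/-! ### Pointwise chain rules -/

theorem exists_mean_slope {f f' : ℝ → ℝ} (hf : ∀ x, HasDerivAt f (f' x) x) (a b : ℝ) :
    ∃ ξ ∈ uIcc a b, f b - f a = f' ξ * (b - a) := by
  have hc : Continuous f := continuous_iff_continuousAt.2 fun x => (hf x).continuousAt
  rcases lt_trichotomy a b with h | h | h
  · obtain ⟨ξ, hξ, e⟩ := exists_hasDerivAt_eq_slope f f' h hc.continuousOn fun x _ => hf x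
    refine ⟨ξ, Icc_subset_uIcc ⟨hξ.1.le, hξ.2.le⟩, ?_⟩
    rw [e, div_mul_cancel₀ _ (sub_ne_zero.2 h.ne')]
  · exact ⟨a, left_mem_uIcc, by simp [h]⟩
  · obtain ⟨ξ, hξ, e⟩ := exists_hasDerivAt_eq_slope f f' h hc.continuousOn fun x _ => hf x
    refine ⟨ξ, Icc_subset_uIcc' ⟨hξ.1.le, hξ.2.le⟩, ?_⟩
    have : a - b ≠ 0 := sub_ne_zero.2 h.ne'
    rw [e]
    field_simp
    ring

/-- The increments of `f(s, ·)` from `y₀` to `y(s)` have slopes converging to `f_x(t, y₀)`, as soon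
as `f_x` is continuous at `(t, y₀)`. -/
theorem exists_tendsto_mean_slope {f fx : ℝ → ℝ → ℝ} {J : Set ℝ} {t y₀ : ℝ} {y : ℝ → ℝ}
    (hx : ∀ s x, HasDerivAt (f s) (fx s x) x)
    (hfx : ContinuousWithinAt (Function.uncurry fx) (J ×ˢ univ) (t, y₀))
    (hy : Tendsto y (𝓝[J] t) (𝓝 y₀)) :
    ∃ m : ℝ → ℝ, (∀ s, f s (y s) - f s y₀ = m s * (y s - y₀)) ∧
      Tendsto m (𝓝[J] t) (𝓝 (fx t y₀)) := by
  choose ξ hξ e using fun s => exists_mean_slope (hx s) y₀ (y s)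
  refine ⟨fun s => fx s (ξ s), e, ?_⟩
  have h1 : Tendsto ξ (𝓝[J] t) (𝓝 y₀) := by
    rw [tendsto_iff_dist_tendsto_zero] at hy ⊢
    refine squeeze_zero (fun _ => dist_nonneg) (fun s => ?_) hy
    rw [Real.dist_eq, Real.dist_eq]
    exact abs_sub_left_of_mem_uIcc (hξ s)
  have h2 : Tendsto (fun s => (s, ξ s)) (𝓝[J] t) (𝓝[J ×ˢ univ] (t, y₀)) := by
    rw [nhdsWithin_prod_eq, nhdsWithin_univ]
    exact tendsto_id.prodMk h1
  exact hfx.tendsto.comp h2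

/-- Derivative of `s ↦ f(s, y(s))`. -/
theorem hasDerivWithinAt_along {f fx : ℝ → ℝ → ℝ} {J : Set ℝ} {t ft y' : ℝ} {y : ℝ → ℝ}
    (hx : ∀ s x, HasDerivAt (f s) (fx s x) x)
    (hfx : ContinuousWithinAt (Function.uncurry fx) (J ×ˢ univ) (t, y t))
    (ht : HasDerivWithinAt (fun s => f s (y t)) ft J t) (hy : HasDerivWithinAt y y' J t) :
    HasDerivWithinAt (fun s => f s (y s)) (ft + fx t (y t) * y') J t := by
  obtain ⟨m, hm, hmt⟩ := exists_tendsto_mean_slope hx hfx hy.continuousWithinAt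
  rw [hasDerivWithinAt_iff_tendsto] at ht hy ⊢
  refine (ht.add ((hmt.mono_left (nhdsWithin_mono _ sdiff_subset)).mul hy)).congr fun s => ?_
  simp only [smul_eq_mul]
  linear_combination -(s - t)⁻¹ * hm s

/-- Derivative of an implicitly defined curve: `f(s, y(s))` is constant. -/
theorem hasDerivWithinAt_implicit {f fx : ℝ → ℝ → ℝ} {J : Set ℝ} {t ft c : ℝ} {y : ℝ → ℝ}
    (hx : ∀ s x, HasDerivAt (f s) (fx s x) x)
    (hfx : ContinuousWithinAt (Function.uncurry fx) (J ×ˢ univ) (t, y t))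
    (ht : HasDerivWithinAt (fun s => f s (y t)) ft J t) (hc : 0 < c) (htJ : t ∈ J)
    (hlow : ∀ᶠ s in 𝓝[J] t, ∀ x, c ≤ fx s x) (hy : ∀ s, f s (y s) = f t (y t)) :
    HasDerivWithinAt y (-ft / fx t (y t)) J t := by
  -- the lower bound on `f_x` makes `y` continuous at `t`
  have hcont : Tendsto y (𝓝[J] t) (𝓝 (y t)) := by
    have h1 : Tendsto (fun s => c⁻¹ * |f t (y t) - f s (y t)|) (𝓝[J] t) (𝓝 0) := by
      have h2 := ((ht.continuousWithinAt.tendsto.const_sub (f t (y t))).abs).const_mul c⁻¹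
      simpa using h2
    rw [tendsto_iff_dist_tendsto_zero]
    refine squeeze_zero' (Eventually.of_forall fun _ => dist_nonneg) ?_ h1
    filter_upwards [hlow] with s hs
    obtain ⟨ξ, -, e⟩ := exists_mean_slope (hx s) (y t) (y s)
    rw [hy s] at e
    rw [e, abs_mul, Real.dist_eq, ← mul_assoc]
    refine le_mul_of_one_le_left (abs_nonneg _) ?_
    rw [inv_mul_eq_div, one_le_div hc]
    exact (hs ξ).trans (le_abs_self _)
  obtain ⟨m, hm, hmt⟩ := exists_tendsto_mean_slope hx hfx hcont
  have hpos : 0 < fx t (y t) := hc.trans_le (hlow.self_of_nhdsWithin htJ _)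
  have hm0 : ∀ᶠ s in 𝓝[J \ {t}] t, 0 < m s :=
    (hmt.mono_left (nhdsWithin_mono _ sdiff_subset)).eventually_const_lt hpos
  rw [hasDerivWithinAt_iff_tendsto] at ht ⊢
  refine (ht.neg.div (hmt.mono_left (nhdsWithin_mono _ sdiff_subset)) hpos.ne').congr' ?_
  filter_upwards [hm0] with s hs
  rw [Pi.div_apply, div_eq_iff hs.ne']
  have := hm s
  rw [hy s] at this
  simp only [smul_eq_mul]
  linear_combination (s - t)⁻¹ * this

/-! ### Curves of diffeomorphisms -/

theorem continuousWithinAt_deriv_eval {F : ℝ → G} {J : Set ℝ} {t : ℝ}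
    (hF : ContinuousWithinAt F J t) (x : ℝ) :
    ContinuousWithinAt (fun p : ℝ × ℝ => deriv (F p.1 : ℝ → ℝ) p.2) (J ×ˢ univ) (t, x) := by
  have h1 : ContinuousWithinAt (fun p : ℝ × ℝ => G.D (F p.1)) (J ×ˢ univ) (t, x) :=
    G.DL.continuous.continuousAt.comp_continuousWithinAt
      (hF.comp continuousWithinAt_fst fun _ hp => hp.1)
  exact W.continuous_eval.continuousAt.comp_continuousWithinAt
    (h1.prodMk continuousWithinAt_snd)

theorem G.hasDerivWithinAt_apply {u : ℝ → G} {v : G} {J : Set ℝ} {t : ℝ}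
    (h : HasDerivWithinAt u v J t) (x : ℝ) :
    HasDerivWithinAt (fun s => (u s : ℝ → ℝ) x) ((v : ℝ → ℝ) x) J t :=
  hasDerivWithinAt_clm_comp (G.evalL x) h

theorem W.hasDerivWithinAt_apply {u : ℝ → W} {v : W} {J : Set ℝ} {t : ℝ}
    (h : HasDerivWithinAt u v J t) (x : ℝ) :
    HasDerivWithinAt (fun s => (u s : ℝ → ℝ) x) ((v : ℝ → ℝ) x) J t :=
  hasDerivWithinAt_clm_comp (W.evalL x) h

theorem DiffTilde.hasDerivWithinAt_apply {φ : ℝ → DiffTilde} {v : G} {J : Set ℝ} {t : ℝ}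
    (h : HasDerivWithinAt (fun s => disp (φ s)) v J t) (x : ℝ) :
    HasDerivWithinAt (fun s => (φ s).1 x) ((v : ℝ → ℝ) x) J t := by
  have h1 := (G.hasDerivWithinAt_apply h x).const_add x
  simpa only [← DiffTilde.apply_eq] using h1

theorem DiffTilde.continuousWithinAt_deriv {φ : ℝ → DiffTilde} {J : Set ℝ} {t : ℝ}
    (h : ContinuousWithinAt (fun s => disp (φ s)) J t) (x : ℝ) :
    ContinuousWithinAt (Function.uncurry fun s y => deriv (φ s).1 y) (J ×ˢ univ) (t, x) := by
  have := (continuousWithinAt_deriv_eval h x).const_add 1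
  simpa only [Function.uncurry_def, DiffTilde.deriv_eq] using this

/-- Time derivative of the inverse of a curve of diffeomorphisms. -/
theorem DiffTilde.hasDerivWithinAt_inv {φ : ℝ → DiffTilde} {v : G} {J : Set ℝ} {t : ℝ}
    (h : HasDerivWithinAt (fun s => disp (φ s)) v J t) (htJ : t ∈ J) (x : ℝ) :
    HasDerivWithinAt (fun s => (φ s)⁻¹.1 x)
      (-(v : ℝ → ℝ) ((φ t)⁻¹.1 x) / deriv (φ t).1 ((φ t)⁻¹.1 x)) J t := by
  have hcont := continuousWithinAt_of_hasDerivWithinAt h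
  obtain ⟨c, hc, hlow⟩ := MemDiff.lower (φ t).2
  refine hasDerivWithinAt_implicit (f := fun s y => (φ s).1 y) (c := c / 2)
    (fun s x => DiffTilde.hasDerivAt (φ s) x) (DiffTilde.continuousWithinAt_deriv hcont _)
    (DiffTilde.hasDerivWithinAt_apply h _) (half_pos hc) htJ ?_ fun s => by simp
  have h1 : Tendsto (fun s => G.D (disp (φ s))) (𝓝[J] t) (𝓝 (G.D (disp (φ t)))) :=
    (G.DL.continuous.tendsto _).comp hcont
  filter_upwards [W.eventually_abs_sub_lt h1 (half_pos hc)] with s hs x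
  have h2 := (abs_lt.1 (hs x)).1
  have h3 := hlow x
  rw [DiffTilde.deriv_eq] at h3 ⊢
  rw [G.D_apply, G.D_apply] at h2
  linarith

/-! ### The metric: definiteness, right invariance, pullback -/

theorem exists_rpow_le (β : ℝ) {c C : ℝ} (hc : 0 < c) :
    ∃ M, ∀ y ∈ Icc c C, |y ^ β| ≤ M :=
  isCompact_Icc.exists_bound_of_continuousOn fun y hy =>
    (Real.continuousAt_rpow_const y β (Or.inl (hc.trans_le hy.1).ne')).continuousWithinAt

theorem continuous_one_add_rpow {f : W} (hf : ∀ x, -1 < (f : ℝ → ℝ) x) (β : ℝ) :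
    Continuous fun x => (1 + (f : ℝ → ℝ) x) ^ β :=
  (continuous_const.add (W.continuous f)).rpow_const fun x => Or.inl (by
    have := hf x
    simp only [Pi.add_apply]
    linarith)

theorem integrable_rpow_mul {f : W} (hf : ∀ x, -1 < (f : ℝ → ℝ) x) (β : ℝ) (a b : W) :
    Integrable fun x => (1 + (f : ℝ → ℝ) x) ^ β * ((a : ℝ → ℝ) x * (b : ℝ → ℝ) x) := by
  obtain ⟨c, hc, H⟩ := MemW.lower f.2 hf
  obtain ⟨M, hM⟩ := exists_rpow_le β (C := 1 + W.seminorm 1 f) hc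
  have := int_mul (W.mul a b).2.int (continuous_one_add_rpow hf β)
    ⟨M, fun x => hM _ ⟨H x, add_le_add le_rfl ((le_abs_self _).trans (W.abs_le f x))⟩⟩
  simpa only [mul_comm, W.mul_apply] using this

theorem isWeakRiemannian (α : ℝ) : IsWeakRiemannian α := by
  intro φ
  refine ⟨fun X Y => integrable_rpow_mul (deriv_disp_gt φ) _ (G.D X) (G.D Y), fun X hX => ?_⟩
  obtain ⟨x, hx⟩ : ∃ x, deriv (X : ℝ → ℝ) x ≠ 0 := by
    by_contra! h
    exact hX (G.D_injective (Subtype.ext (funext fun x => (h x).trans (by simp))))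
  have hpos : ∀ x, 0 < (1 + deriv (disp φ : ℝ → ℝ) x) ^ (-α - 1) := fun x =>
    Real.rpow_pos_of_pos (by linarith [show -1 < deriv (disp φ : ℝ → ℝ) x from φ.2.2 x]) _
  refine integral_pos_of_integrable_nonneg_nonzero (x := x)
    ((continuous_one_add_rpow (deriv_disp_gt φ) _).mul
      ((W.continuous (G.D X)).mul (W.continuous (G.D X))))
    (integrable_rpow_mul (deriv_disp_gt φ) _ (G.D X) (G.D X))
    (fun y => mul_nonneg (hpos y).le (mul_self_nonneg _)) ?_
  exact mul_ne_zero (hpos x).ne' (mul_ne_zero hx hx)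

theorem DiffTilde.deriv_mul (φ ψ : DiffTilde) (x : ℝ) :
    deriv (φ * ψ).1 x = deriv φ.1 (ψ.1 x) * deriv ψ.1 x :=
  ((DiffTilde.hasDerivAt φ (ψ.1 x)).comp x (DiffTilde.hasDerivAt ψ x)).deriv

theorem deriv_rightTranslate (X : G) (ψ : DiffTilde) (x : ℝ) :
    deriv (rightTranslate X ψ : ℝ → ℝ) x = deriv (X : ℝ → ℝ) (ψ.1 x) * deriv ψ.1 x :=
  ((G.hasDerivAt X (ψ.1 x)).comp x (DiffTilde.hasDerivAt ψ x)).deriv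

theorem alphaH1_eq (α : ℝ) (φ : DiffTilde) (X Y : G) :
    alphaH1 α φ X Y =
      ∫ x, deriv φ.1 x ^ (-α - 1) * (deriv (X : ℝ → ℝ) x * deriv (Y : ℝ → ℝ) x) := by
  simp only [alphaH1, chartMetric, DiffTilde.deriv_eq]

/-- The metric after a right translation by `ψ`, as an integral with the extra weight
`(ψ')^{-α}`. -/
theorem alphaH1_rightTranslate (α : ℝ) (φ ψ : DiffTilde) (X Y : G) :
    alphaH1 α (φ * ψ) (rightTranslate X ψ) (rightTranslate Y ψ) =
      ∫ x, deriv ψ.1 x * (deriv ψ.1 x ^ (-α) * (deriv φ.1 (ψ.1 x) ^ (-α - 1) *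
        (deriv (X : ℝ → ℝ) (ψ.1 x) * deriv (Y : ℝ → ℝ) (ψ.1 x)))) := by
  rw [alphaH1_eq]
  refine integral_congr_ae (Eventually.of_forall fun x => ?_)
  have h := DiffTilde.deriv_pos ψ x
  simp only [DiffTilde.deriv_mul, deriv_rightTranslate]
  rw [Real.mul_rpow (DiffTilde.deriv_pos φ _).le h.le, Real.rpow_sub_one h.ne' (-α)]
  field_simp

theorem alphaH1_eq_comp (α : ℝ) (φ ψ : DiffTilde) (X Y : G) :
    alphaH1 α φ X Y = ∫ x, deriv ψ.1 x * (deriv φ.1 (ψ.1 x) ^ (-α - 1) *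
      (deriv (X : ℝ → ℝ) (ψ.1 x) * deriv (Y : ℝ → ℝ) (ψ.1 x))) :=
  (alphaH1_eq α φ X Y).trans (DiffTilde.integral_comp ψ fun x =>
    deriv φ.1 x ^ (-α - 1) * (deriv (X : ℝ → ℝ) x * deriv (Y : ℝ → ℝ) x)).symm

theorem isRightInvariant_zero : IsRightInvariant (alphaH1 0) := by
  intro φ ψ X Y
  rw [alphaH1_rightTranslate, alphaH1_eq_comp 0 φ ψ]
  simp

theorem memW_of_hasCompactSupport {f : ℝ → ℝ} (hf : ContDiff ℝ ∞ f) (hs : HasCompactSupport f) :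
    MemW f := by
  refine memW_iff.2 fun n => ?_
  induction n generalizing f with
  | zero => exact ⟨hf, hf.continuous.integrable_of_hasCompactSupport hs⟩
  | succ n ih =>
    exact ⟨hf, hf.continuous.integrable_of_hasCompactSupport hs, ih (contDiff_deriv hf) hs.deriv⟩

/-- A smooth bump function, as an element of `W^{∞,1}(ℝ)`. -/
def W.bump {c : ℝ} (b : ContDiffBump c) : W :=
  ⟨b, memW_of_hasCompactSupport b.contDiff b.hasCompactSupport⟩

theorem W.bump_apply {c : ℝ} (b : ContDiffBump c) (x : ℝ) : (W.bump b : ℝ → ℝ) x = b x := rfl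

theorem eq_of_integral_eq_of_le {f g : ℝ → ℝ} (hf : Continuous f) (hg : Continuous g)
    (hfi : Integrable f) (hgi : Integrable g) (hle : ∀ x, f x ≤ g x)
    (h : ∫ x, f x = ∫ x, g x) : f = g := by
  by_contra hne
  obtain ⟨x, hx⟩ := Function.ne_iff.1 hne
  have := integral_pos_of_integrable_nonneg_nonzero (μ := volume) (x := x) (hg.sub hf) (hgi.sub hfi)
    (fun y => sub_nonneg.2 (hle y)) (sub_ne_zero.2 hx.symm)
  simp only [Pi.sub_apply] at this
  rw [integral_sub hgi hfi, h, sub_self] at this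
  exact lt_irrefl _ this

/-- For `α ≠ 0` right invariance fails at `φ = id`: take `ψ` with `ψ' = 1 + b ≥ 1` for a bump
function `b`, and a field supported where `ψ' > 1`; there the weight `(ψ')^{-α}` stays on one side
of `1`. -/
theorem eq_zero_of_isRightInvariant {α : ℝ} (h : IsRightInvariant (alphaH1 α)) : α = 0 := by
  let b : ContDiffBump (0 : ℝ) := ⟨1, 2, one_pos, one_lt_two⟩
  have hb1 : b 0 = 1 := b.one_of_mem_closedBall (by simp [b])
  have hd : ∀ x, deriv (W.prim (W.bump b) : ℝ → ℝ) x = b x := fun x => by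
    rw [W.deriv_prim, W.bump_apply]
  let ψ := DiffTilde.ofDisp (W.prim (W.bump b)) fun x => by
    rw [hd]; linarith [b.nonneg' x]
  have hψ : ∀ x, deriv ψ.1 x = 1 + b x := fun x => by
    rw [DiffTilde.deriv_eq, disp_ofDisp, hd]
  set Y := W.prim (W.bump b)
  set X := rightTranslate Y ψ⁻¹
  have h1 : ∀ y, deriv (1 : DiffTilde).1 y = 1 := fun y => (hasDerivAt_id y).deriv
  have hX : ∀ x, deriv (X : ℝ → ℝ) (ψ.1 x) * (1 + b x) = b x := fun x => by
    rw [← hψ, ← deriv_rightTranslate, ← hd]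
    congr 1
    funext y
    change (Y : ℝ → ℝ) (ψ⁻¹.1 (ψ.1 y)) = _
    rw [DiffTilde.inv_apply]
  have e := h 1 ψ X X
  rw [alphaH1_rightTranslate, alphaH1_eq_comp α 1 ψ] at e
  simp only [h1, hψ, Real.one_rpow, one_mul] at e
  have hcX : Continuous fun x => deriv (X : ℝ → ℝ) (ψ.1 x) :=
    W.continuous (W.comp (G.D X) ψ)
  have hcb : Continuous fun x => 1 + b x := continuous_const.add b.continuous
  have hb0 : ∀ x, 1 ≤ 1 + b x := fun x => by linarith [b.nonneg' x]
  have hcp : Continuous fun x => (1 + b x) ^ (-α) :=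
    hcb.rpow_const fun x => Or.inl (by linarith [hb0 x])
  have hsupp : HasCompactSupport fun x => deriv (X : ℝ → ℝ) (ψ.1 x) := by
    refine b.hasCompactSupport.mono fun x hx hbx => hx ?_
    have := hX x
    rw [hbx] at this
    simpa using this
  have hcQ := hcX.mul hcX
  have hsQ := hsupp.mul_left (f := fun x => deriv (X : ℝ → ℝ) (ψ.1 x))
  have hc1 := hcb.mul (hcp.mul hcQ)
  have hc2 := hcb.mul hcQ
  have hi1 := hc1.integrable_of_hasCompactSupport (μ := volume) hsQ.mul_left.mul_left
  have hi2 := hc2.integrable_of_hasCompactSupport (μ := volume) hsQ.mul_left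
  have heq : (1 + b 0) * ((1 + b 0) ^ (-α) *
      (deriv (X : ℝ → ℝ) (ψ.1 0) * deriv (X : ℝ → ℝ) (ψ.1 0))) =
      (1 + b 0) * (deriv (X : ℝ → ℝ) (ψ.1 0) * deriv (X : ℝ → ℝ) (ψ.1 0)) := by
    rcases le_total 0 α with hα | hα
    · refine congrFun (eq_of_integral_eq_of_le hc1 hc2 hi1 hi2 (fun x => ?_) e) 0
      refine mul_le_mul_of_nonneg_left (mul_le_of_le_one_left (mul_self_nonneg _) ?_)
        (zero_le_one.trans (hb0 x))
      exact Real.rpow_le_one_of_one_le_of_nonpos (hb0 x) (by linarith)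
    · refine (congrFun (eq_of_integral_eq_of_le hc2 hc1 hi2 hi1 (fun x => ?_) e.symm) 0).symm
      refine mul_le_mul_of_nonneg_left (le_mul_of_one_le_left (mul_self_nonneg _) ?_)
        (zero_le_one.trans (hb0 x))
      exact Real.one_le_rpow (hb0 x) (by linarith)
  have hX0 : deriv (X : ℝ → ℝ) (ψ.1 0) ≠ 0 := fun h0 => by
    have := hX 0
    rw [h0, hb1] at this
    norm_num at this
  rw [hb1] at heq
  have h2 : (1 + 1 : ℝ) ^ (-α) = 1 := by
    have h3 := mul_left_cancel₀ (by norm_num : (1 + 1 : ℝ) ≠ 0) heq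
    exact mul_right_cancel₀ (mul_ne_zero hX0 hX0) (h3.trans (one_mul _).symm)
  have h4 := congrArg Real.log h2
  rw [Real.log_rpow (by norm_num), Real.log_one] at h4
  have h5 : Real.log (1 + 1) ≠ 0 := (Real.log_pos (by norm_num)).ne'
  simpa [h5] using h4

/-- The map `φ ↦ φ^* λ = φ' λ`. -/
def pullbackDensity (φ : DiffTilde) : DensTilde where
  coord := G.D (disp φ)
  pos x := by linarith [deriv_disp_gt φ x]

theorem toMeasure_pullbackDensity (φ : DiffTilde) :
    (pullbackDensity φ).toMeasure = Measure.map ((φ⁻¹ : DiffTilde) : Equiv.Perm ℝ) volume := by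
  have hm : Measurable (φ⁻¹ : DiffTilde).1 := (DiffTilde.smooth φ⁻¹).continuous.measurable
  refine Measure.ext fun s hs => ?_
  have h := lintegral_image_eq_lintegral_abs_deriv_mul hs
    (fun x _ => (DiffTilde.hasDerivAt φ x).hasDerivWithinAt) φ.1.injective.injOn fun _ => 1
  have himg : φ.1 '' s = (φ⁻¹ : DiffTilde).1 ⁻¹' s :=
    φ.1.image_eq_preimage_symm s
  rw [setLIntegral_one, himg] at h
  rw [Measure.map_apply hm hs, h, DensTilde.toMeasure, withDensity_apply _ hs]
  refine lintegral_congr fun x => ?_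
  rw [mul_one, abs_of_pos (DiffTilde.deriv_pos φ x), DiffTilde.deriv_eq]
  rfl

/-- In the global charts, `Θ` is the restriction of the continuous linear map `f ↦ f'`. -/
theorem isPullbackMetric (α : ℝ) :
    IsPullbackMetric (alphaH1 α) (alphaFisherRao α) pullbackDensity := by
  refine fun φ => ⟨G.DL, fun c X _ hX => ?_, fun X Y => rfl⟩
  rw [← hasDerivWithinAt_univ_tvs] at hX ⊢
  exact hasDerivWithinAt_clm_comp G.DL hX

/-! ### The integrated Proudman–Johnson equation -/

theorem iteratedDeriv_two_three (u : ℝ → ℝ) :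
    iteratedDeriv 2 u = deriv (deriv u) ∧ iteratedDeriv 3 u = deriv (deriv (deriv u)) := by
  simp only [iteratedDeriv_succ, iteratedDeriv_zero, and_self]

/-- For fields in `𝔤` the equation can be integrated once in `x`, because all terms vanish at
`-∞`. -/
theorem gpj_iff_integrated (α : ℝ) (u v : G) :
    (∀ x, iteratedDeriv 2 (v : ℝ → ℝ) x
      + (2 - α) * deriv (u : ℝ → ℝ) x * iteratedDeriv 2 (u : ℝ → ℝ) x
      + (u : ℝ → ℝ) x * iteratedDeriv 3 (u : ℝ → ℝ) x = 0) ↔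
    ∀ x, deriv (v : ℝ → ℝ) x + (u : ℝ → ℝ) x * deriv (deriv (u : ℝ → ℝ)) x
      + (1 - α) / 2 * deriv (u : ℝ → ℝ) x ^ 2 = 0 := by
  rw [(iteratedDeriv_two_three _).1, (iteratedDeriv_two_three _).1, (iteratedDeriv_two_three _).2]
  set q := fun x => deriv (v : ℝ → ℝ) x + (u : ℝ → ℝ) x * deriv (deriv (u : ℝ → ℝ)) x
      + (1 - α) / 2 * deriv (u : ℝ → ℝ) x ^ 2 with hq
  have hd : ∀ x, HasDerivAt q (deriv (deriv (v : ℝ → ℝ)) x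
      + (2 - α) * deriv (u : ℝ → ℝ) x * deriv (deriv (u : ℝ → ℝ)) x
      + (u : ℝ → ℝ) x * deriv (deriv (deriv (u : ℝ → ℝ))) x) x := fun x => by
    have h1 := W.hasDerivAt (G.D v) x
    have h2 := W.hasDerivAt (G.D u) x
    have h3 := W.hasDerivAt (W.der (G.D u)) x
    refine ((h1.add ((G.hasDerivAt u x).mul h3)).add ((h2.pow 2).const_mul _)).congr_deriv ?_
    change deriv (deriv (v : ℝ → ℝ)) x + (deriv (u : ℝ → ℝ) x * deriv (deriv (u : ℝ → ℝ)) x +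
      (u : ℝ → ℝ) x * deriv (deriv (deriv (u : ℝ → ℝ))) x) + (1 - α) / 2 *
        (((2 : ℕ) : ℝ) * deriv (u : ℝ → ℝ) x ^ (2 - 1) * deriv (deriv (u : ℝ → ℝ)) x) = _
    push_cast
    ring
  have hlim : Tendsto q atBot (𝓝 0) := by
    have h1 := (G.D v).2.tendsto_atBot
    have h2 := (G.D u).2.tendsto_atBot
    have h3 := (W.der (G.D u)).2.tendsto_atBot
    have h4 := (h1.add (u.2.2.2.mul h3)).add ((h2.pow 2).const_mul ((1 - α) / 2))
    norm_num at h4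
    exact h4
  constructor
  · intro h x
    have hconst : ∀ y, q y = q x := fun y =>
      is_const_of_deriv_eq_zero (fun z => (hd z).differentiableAt)
        (fun z => (hd z).deriv.trans (h z)) y x
    exact tendsto_nhds_unique (tendsto_const_nhds.congr fun y => (hconst y).symm) hlim
  · intro h x
    have h0 : q = fun _ => 0 := funext h
    have := (hd x).deriv
    rw [h0, deriv_const] at this
    exact this.symm

/-! ### The Eulerian velocity -/

/-- The time derivative `φ_tt ∘ φ⁻¹ - u u_x` of the Eulerian velocity `u` of a curve `φ`. -/
def eulerianVelocity (φ : ℝ → DiffTilde) (v acc : ℝ → G) (t : ℝ) : G :=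
  rightTranslate (acc t) (φ t)⁻¹ -
    W.toG (W.mulG (G.D (eulerian φ v t)) (eulerian φ v t))

theorem continuousOn_rightTranslate_inv {X : ℝ → G} {φ : ℝ → DiffTilde} {J : Set ℝ}
    (hX : ContinuousOn X J) (hφ : ContinuousOn (fun t => disp (φ t)) J) :
    ContinuousOn (fun t => rightTranslate (X t) (φ t)⁻¹) J := by
  rw [continuousOn_iff_continuous_domRestrict] at hX hφ ⊢
  exact continuous_rightTranslate_inv hX (φ := fun t : J => φ t) hφ

theorem deriv_eulerian (φ : ℝ → DiffTilde) (v : ℝ → G) (t x : ℝ) :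
    deriv (eulerian φ v t : ℝ → ℝ) x =
      deriv (v t : ℝ → ℝ) ((φ t)⁻¹.1 x) / deriv (φ t).1 ((φ t)⁻¹.1 x) := by
  rw [← G.D_apply, eulerian, G.D_rightTranslate_inv, W.comp_apply, W.divDeriv_apply, G.D_apply]

theorem isC1CurveOn_eulerian {φ : ℝ → DiffTilde} {v acc : ℝ → G} {J : Set ℝ}
    (hJ : J.OrdConnected) (h : IsC2CurveOn (fun t => disp (φ t)) v acc J) :
    IsC1CurveOn (eulerian φ v) (eulerianVelocity φ v acc) J := by
  have hφ : ContinuousOn (fun t => disp (φ t)) J := fun t ht =>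
    continuousWithinAt_of_hasDerivWithinAt (h.first t ht)
  have hv : ContinuousOn v J := fun t ht =>
    continuousWithinAt_of_hasDerivWithinAt (h.second.hasDeriv t ht)
  have hu : ContinuousOn (eulerian φ v) J := continuousOn_rightTranslate_inv hv hφ
  refine G.isC1_of_pointwise hJ ?_ fun t ht x => ?_
  · refine (continuousOn_rightTranslate_inv h.second.cont hφ).sub ?_
    exact W.continuous_toG.comp_continuousOn (W.continuous_mulG.comp_continuousOn
      ((G.DL.continuous.comp_continuousOn hu).prodMk hu))
  · have h1 := hasDerivWithinAt_along (f := fun s y => (v s : ℝ → ℝ) y)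
      (fun s y => G.hasDerivAt (v s) y) (continuousWithinAt_deriv_eval (hv t ht) _)
      (G.hasDerivWithinAt_apply (h.second.hasDeriv t ht) _)
      (DiffTilde.hasDerivWithinAt_inv (h.first t ht) ht x)
    refine h1.congr_deriv ?_
    simp only [eulerianVelocity, AddSubgroupClass.coe_sub, Pi.sub_apply, W.toG_apply,
      W.mulG_apply, G.D_apply, deriv_eulerian]
    simp only [eulerian, rightTranslate]
    ring

theorem deriv_eulerianVelocity (φ : ℝ → DiffTilde) (v acc : ℝ → G) (t x : ℝ) :
    deriv (eulerianVelocity φ v acc t : ℝ → ℝ) x =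
      deriv (acc t : ℝ → ℝ) ((φ t)⁻¹.1 x) / deriv (φ t).1 ((φ t)⁻¹.1 x) -
        (deriv (eulerian φ v t : ℝ → ℝ) x ^ 2 +
          (eulerian φ v t : ℝ → ℝ) x * deriv (deriv (eulerian φ v t : ℝ → ℝ)) x) := by
  rw [← G.D_apply, eulerianVelocity, map_sub, G.D_rightTranslate_inv, G.D_toG, W.der_mulG]
  simp only [AddSubgroupClass.coe_sub, Pi.sub_apply, Submodule.coe_add, Pi.add_apply,
    W.comp_apply, W.divDeriv_apply, W.mulG_apply, W.mul_apply, G.D_apply]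
  change _ - (deriv (deriv (eulerian φ v t : ℝ → ℝ)) x * _ + _) = _
  ring

/-- The defect of the geodesic equation `φ_ttx = (α + 1) / 2 · φ_tx² / φ_x`. -/
def geodesicDefect (α : ℝ) (φ : ℝ → DiffTilde) (v acc : ℝ → G) (t x : ℝ) : ℝ :=
  deriv (acc t : ℝ → ℝ) x - (α + 1) / 2 * deriv (v t : ℝ → ℝ) x ^ 2 / deriv (φ t).1 x

/-- At each time, the equation for the Eulerian velocity of a curve `φ` is the geodesic equation,
read at the point `φ(t, x)`. -/
theorem gpj_eulerian_iff (α : ℝ) (φ : ℝ → DiffTilde) (v acc : ℝ → G) (t : ℝ) :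
    (∀ x, iteratedDeriv 2 (eulerianVelocity φ v acc t : ℝ → ℝ) x
      + (2 - α) * deriv (eulerian φ v t : ℝ → ℝ) x * iteratedDeriv 2 (eulerian φ v t : ℝ → ℝ) x
      + (eulerian φ v t : ℝ → ℝ) x * iteratedDeriv 3 (eulerian φ v t : ℝ → ℝ) x = 0) ↔
      ∀ x, geodesicDefect α φ v acc t x = 0 := by
  have e : ∀ x, deriv (eulerianVelocity φ v acc t : ℝ → ℝ) ((φ t).1 x)
      + (eulerian φ v t : ℝ → ℝ) ((φ t).1 x) *
        deriv (deriv (eulerian φ v t : ℝ → ℝ)) ((φ t).1 x)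
      + (1 - α) / 2 * deriv (eulerian φ v t : ℝ → ℝ) ((φ t).1 x) ^ 2 =
      geodesicDefect α φ v acc t x / deriv (φ t).1 x := fun x => by
    have hpos := (DiffTilde.deriv_pos (φ t) x).ne'
    rw [deriv_eulerianVelocity, deriv_eulerian, DiffTilde.inv_apply, geodesicDefect]
    field_simp
    ring
  refine (gpj_iff_integrated α _ _).trans
    (((φ t).1.surjective.forall).trans (forall_congr' fun x => ?_))
  rw [e, div_eq_zero_iff, or_iff_left (DiffTilde.deriv_pos (φ t) x).ne']

theorem isGPJSolution_eulerian_of_geodesicDefect (α : ℝ) {J : Set ℝ} (hJ : J.OrdConnected)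
    {φ : ℝ → DiffTilde} {v acc : ℝ → G} (h : IsC2CurveOn (fun t => disp (φ t)) v acc J)
    (H : ∀ t ∈ J, ∀ x, geodesicDefect α φ v acc t x = 0) :
    IsGPJSolution α J (eulerian φ v) :=
  ⟨_, isC1CurveOn_eulerian hJ h, fun t ht => (gpj_eulerian_iff α φ v acc t).2 (H t ht)⟩

/-- The Eulerian velocity of a `C²` curve has only one time derivative, so being a solution is a
condition on the curve alone. -/
theorem isGPJSolution_eulerian_iff (α : ℝ) {a b : ℝ} (hab : a < b) {φ : ℝ → DiffTilde}
    {v acc : ℝ → G} (h : IsC2CurveOn (fun t => disp (φ t)) v acc (Icc a b)) :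
    IsGPJSolution α (Icc a b) (eulerian φ v) ↔
      ∀ t ∈ Icc a b, ∀ x, geodesicDefect α φ v acc t x = 0 := by
  refine ⟨?_, isGPJSolution_eulerian_of_geodesicDefect α ordConnected_Icc h⟩
  rintro ⟨w, hw, heq⟩ t ht
  have hC1 := isC1CurveOn_eulerian ordConnected_Icc h
  have hwt : w t = eulerianVelocity φ v acc t := by
    refine Subtype.ext (funext fun x => ?_)
    exact (uniqueDiffOn_Icc hab t ht).eq_deriv _
      (G.hasDerivWithinAt_apply (hw.hasDeriv t ht) x)
      (G.hasDerivWithinAt_apply (hC1.hasDeriv t ht) x)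
  rw [← gpj_eulerian_iff α φ v acc t, ← hwt]
  exact heq t ht

/-! ### Integration over a space-time strip -/

/-- Lebesgue measure on the strip `(a, b] × ℝ` of pairs `(t, x)`. -/
def stripMeasure (a b : ℝ) : Measure (ℝ × ℝ) := (volume.restrict (Ioc a b)).prod volume

theorem stripMeasure_eq (a b : ℝ) :
    stripMeasure a b = (volume.prod volume).restrict (Ioc a b ×ˢ univ) := by
  rw [stripMeasure, ← Measure.prod_restrict, Measure.restrict_univ]

theorem ae_strip (a b : ℝ) : ∀ᵐ p ∂stripMeasure a b, p ∈ Icc a b ×ˢ (univ : Set ℝ) := by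
  rw [stripMeasure_eq]
  filter_upwards [ae_restrict_mem (measurableSet_Ioc.prod MeasurableSet.univ)] with p hp
  exact ⟨Ioc_subset_Icc_self hp.1, hp.2⟩

theorem aestronglyMeasurable_strip {a b : ℝ} {Q : ℝ × ℝ → ℝ} (hQ : ContinuousOn Q (Icc a b ×ˢ univ)) :
    AEStronglyMeasurable Q (stripMeasure a b) := by
  rw [stripMeasure_eq]
  exact (hQ.mono (prod_mono_left Ioc_subset_Icc_self)).aestronglyMeasurable
    (measurableSet_Ioc.prod MeasurableSet.univ)

/-- Continuous and bounded on the closed strip `[a, b] × ℝ`. -/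
def BddStrip (a b : ℝ) (Q : ℝ × ℝ → ℝ) : Prop :=
  ContinuousOn Q (Icc a b ×ˢ univ) ∧ ∃ C, ∀ p ∈ Icc a b ×ˢ (univ : Set ℝ), |Q p| ≤ C

namespace BddStrip

variable {a b : ℝ} {Q R : ℝ × ℝ → ℝ}

theorem mul (hQ : BddStrip a b Q) (hR : BddStrip a b R) : BddStrip a b fun p => Q p * R p := by
  obtain ⟨C, hC⟩ := hQ.2
  obtain ⟨D, hD⟩ := hR.2
  refine ⟨hQ.1.mul hR.1, C * D, fun p hp => ?_⟩
  rw [abs_mul]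
  exact mul_le_mul (hC p hp) (hD p hp) (abs_nonneg _) ((abs_nonneg _).trans (hC p hp))

theorem add (hQ : BddStrip a b Q) (hR : BddStrip a b R) : BddStrip a b fun p => Q p + R p := by
  obtain ⟨C, hC⟩ := hQ.2
  obtain ⟨D, hD⟩ := hR.2
  exact ⟨hQ.1.add hR.1, C + D, fun p hp => (abs_add_le _ _).trans (add_le_add (hC p hp) (hD p hp))⟩

theorem const_mul (hQ : BddStrip a b Q) (c : ℝ) : BddStrip a b fun p => c * Q p :=
  mul ⟨continuousOn_const, |c|, fun _ _ => le_rfl⟩ hQ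

theorem of_curve {F : ℝ → W} (hF : ContinuousOn F (Icc a b)) :
    BddStrip a b fun p => (F p.1 : ℝ → ℝ) p.2 := by
  obtain ⟨C, hC⟩ := W.exists_seminorm_le isCompact_Icc hF 1
  exact ⟨W.continuousOn_eval hF, C, fun p hp => (W.abs_le _ _).trans (hC _ hp.1)⟩

end BddStrip

theorem integrable_strip_curve {a b : ℝ} {F : ℝ → W} (hF : ContinuousOn F (Icc a b)) :
    Integrable (fun p : ℝ × ℝ => (F p.1 : ℝ → ℝ) p.2) (stripMeasure a b) := by
  refine (integrable_prod_iff (aestronglyMeasurable_strip (W.continuousOn_eval hF))).2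
    ⟨Eventually.of_forall fun t => (F t).2.int, ?_⟩
  simp only [Real.norm_eq_abs, ← W.seminorm_zero]
  exact (((W.continuous_seminorm 0).comp_continuousOn hF).integrableOn_compact
    isCompact_Icc).mono_set Ioc_subset_Icc_self

theorem BddStrip.integrable_mul {a b : ℝ} {Q : ℝ × ℝ → ℝ} {F : ℝ → W} (hQ : BddStrip a b Q)
    (hF : ContinuousOn F (Icc a b)) :
    Integrable (fun p : ℝ × ℝ => Q p * (F p.1 : ℝ → ℝ) p.2) (stripMeasure a b) := by
  obtain ⟨C, hC⟩ := hQ.2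
  exact (integrable_strip_curve hF).bdd_mul (aestronglyMeasurable_strip hQ.1)
    ((ae_strip a b).mono hC)

/-- A continuous curve on a compact time set with values in `{f > -1}` stays uniformly away
from `-1`. -/
theorem exists_uniform_lower {F : ℝ → W} {K : Set ℝ} (hK : IsCompact K) (hF : ContinuousOn F K)
    (hpos : ∀ t x, -1 < (F t : ℝ → ℝ) x) :
    ∃ c, 0 < c ∧ ∀ t ∈ K, ∀ x, c ≤ 1 + (F t : ℝ → ℝ) x := by
  refine hK.induction_on (p := fun S => ∃ c, 0 < c ∧ ∀ t ∈ S, ∀ x, c ≤ 1 + (F t : ℝ → ℝ) x)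
    ⟨1, one_pos, by simp⟩ ?_ ?_ fun t ht => ?_
  · rintro S T hST ⟨c, hc, h⟩
    exact ⟨c, hc, fun t ht => h t (hST ht)⟩
  · rintro S T ⟨c, hc, h⟩ ⟨d, hd, h'⟩
    refine ⟨min c d, lt_min hc hd, fun t ht x => ?_⟩
    rcases ht with ht | ht
    · exact (min_le_left _ _).trans (h t ht x)
    · exact (min_le_right _ _).trans (h' t ht x)
  · obtain ⟨c, hc, h⟩ := MemW.lower (F t).2 (hpos t)
    refine ⟨_, W.eventually_abs_sub_lt (hF t ht) (half_pos hc), c / 2, half_pos hc, fun s hs x => ?_⟩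
    have h1 := (abs_lt.1 (hs x)).1
    linarith [h x]

/-! ### The first variation of the energy -/

section Variation

variable {a b : ℝ} {f v acc w w' w'' : ℝ → G}

theorem BddStrip.rpow {F : ℝ → W} (hF : ContinuousOn F (Icc a b))
    (hpos : ∀ t x, -1 < (F t : ℝ → ℝ) x) (γ : ℝ) :
    BddStrip a b fun p => (1 + (F p.1 : ℝ → ℝ) p.2) ^ γ := by
  obtain ⟨c, hc, h⟩ := exists_uniform_lower isCompact_Icc hF hpos
  obtain ⟨C, hC⟩ := W.exists_seminorm_le isCompact_Icc hF 1
  obtain ⟨M, hM⟩ := exists_rpow_le γ (C := 1 + C) hc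
  refine ⟨(continuousOn_const.add (W.continuousOn_eval hF)).rpow_const fun p hp =>
    Or.inl (hc.trans_le (h _ hp.1 _)).ne', M, fun p hp => hM _ ⟨h _ hp.1 _, ?_⟩⟩
  exact add_le_add le_rfl (((le_abs_self _).trans (W.abs_le _ _)).trans (hC _ hp.1))

/-- Integration by parts in time, for a variation vanishing at the end points: with `h = 1 + f_x`
the integrand is the time derivative of `h^β v_x w_x`. -/
theorem integral_strip_eq_zero (hab : a ≤ b) (β : ℝ) (hf : IsC2CurveOn f v acc (Icc a b))
    (hpos : ∀ t x, -1 < (G.D (f t) : ℝ → ℝ) x) (hw : IsC2CurveOn w w' w'' (Icc a b))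
    (hwa : w a = 0) (hwb : w b = 0) :
    ∫ p, (β * ((1 + (G.D (f p.1) : ℝ → ℝ) p.2) ^ (β - 1) *
        ((G.D (v p.1) : ℝ → ℝ) p.2 * (G.D (v p.1) : ℝ → ℝ) p.2)) * (G.D (w p.1) : ℝ → ℝ) p.2
      + (1 + (G.D (f p.1) : ℝ → ℝ) p.2) ^ β * (G.D (v p.1) : ℝ → ℝ) p.2 *
        (G.D (w' p.1) : ℝ → ℝ) p.2
      + (1 + (G.D (f p.1) : ℝ → ℝ) p.2) ^ β * (G.D (acc p.1) : ℝ → ℝ) p.2 *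
        (G.D (w p.1) : ℝ → ℝ) p.2) ∂stripMeasure a b = 0 := by
  have hcf : ContinuousOn (fun t => G.D (f t)) (Icc a b) := G.DL.continuous.comp_continuousOn
    fun t ht => continuousWithinAt_of_hasDerivWithinAt (hf.first t ht)
  have hcv : ContinuousOn (fun t => G.D (v t)) (Icc a b) := G.DL.continuous.comp_continuousOn
    fun t ht => continuousWithinAt_of_hasDerivWithinAt (hf.second.hasDeriv t ht)
  have hca : ContinuousOn (fun t => G.D (acc t)) (Icc a b) :=
    G.DL.continuous.comp_continuousOn hf.second.cont
  have hcw : ContinuousOn (fun t => G.D (w t)) (Icc a b) := G.DL.continuous.comp_continuousOn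
    fun t ht => continuousWithinAt_of_hasDerivWithinAt (hw.first t ht)
  have hcw' : ContinuousOn (fun t => G.D (w' t)) (Icc a b) := G.DL.continuous.comp_continuousOn
    fun t ht => continuousWithinAt_of_hasDerivWithinAt (hw.second.hasDeriv t ht)
  have bv := BddStrip.of_curve hcv
  have b1 := ((BddStrip.rpow hcf hpos (β - 1)).mul (bv.mul bv)).const_mul β
  have b2 := (BddStrip.rpow hcf hpos β).mul bv
  have b3 := (BddStrip.rpow hcf hpos β).mul (BddStrip.of_curve hca)
  have hcont := ((b1.mul (BddStrip.of_curve hcw)).add (b2.mul (BddStrip.of_curve hcw'))).add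
    (b3.mul (BddStrip.of_curve hcw))
  have hint := ((b1.integrable_mul hcw).add (b2.integrable_mul hcw')).add (b3.integrable_mul hcw)
  simp only [stripMeasure, Pi.add_def] at hint ⊢
  rw [integral_prod_symm _ hint]
  refine integral_eq_zero_of_ae (Eventually.of_forall fun x => ?_)
  dsimp only [Pi.zero_apply]
  rw [← intervalIntegral.integral_of_le hab]
  have hD : ∀ {c : ℝ → G} {d : G} {t : ℝ}, HasDerivWithinAt c d (Icc a b) t →
      HasDerivWithinAt (fun s => (G.D (c s) : ℝ → ℝ) x) ((G.D d : ℝ → ℝ) x) (Icc a b) t :=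
    fun h => W.hasDerivWithinAt_apply (hasDerivWithinAt_clm_comp G.DL h) x
  have hcx := hcont.1.comp (Continuous.prodMk_left x).continuousOn
    (s := Icc a b) fun t ht => ⟨ht, trivial⟩
  simp only [Function.comp_def] at hcx
  rw [intervalIntegral_eq_sub_of_hasDerivWithinAt (J := Icc a b) ordConnected_Icc
    (f := fun t => (1 + (G.D (f t) : ℝ → ℝ) x) ^ β * (G.D (v t) : ℝ → ℝ) x *
      (G.D (w t) : ℝ → ℝ) x) hcx (fun t ht => ?_) (left_mem_Icc.2 hab) (right_mem_Icc.2 hab)]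
  · simp only [hwa, hwb, map_zero, ZeroMemClass.coe_zero, Pi.zero_apply, mul_zero, sub_self]
  · have h0 : 1 + (G.D (f t) : ℝ → ℝ) x ≠ 0 := by linarith [hpos t x]
    refine (((((hD (hf.first t ht)).const_add 1).rpow_const (Or.inl h0)).mul
      (hD (hf.second.hasDeriv t ht))).mul (hD (hw.first t ht))).congr_deriv ?_
    simp only [Pi.mul_apply]
    ring

/-- The energy density of the varied curve. -/
def energyDensity (β : ℝ) (f v w w' : ℝ → G) (s : ℝ) (p : ℝ × ℝ) : ℝ :=
  (1 + (G.D (f p.1) : ℝ → ℝ) p.2 + s * (G.D (w p.1) : ℝ → ℝ) p.2) ^ β *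
    ((G.D (v p.1) : ℝ → ℝ) p.2 + s * (G.D (w' p.1) : ℝ → ℝ) p.2) ^ 2

/-- The first variation of the energy. Differentiation under the integral sign gives terms in `w_x`
and in `w_tx`; `integral_strip_eq_zero` turns the latter into terms in `w_x`. -/
theorem hasDerivAt_energy (hab : a ≤ b) (α : ℝ) (hf : IsC2CurveOn f v acc (Icc a b))
    (hpos : ∀ t x, -1 < (G.D (f t) : ℝ → ℝ) x) (hw : IsC2CurveOn w w' w'' (Icc a b))
    (hwa : w a = 0) (hwb : w b = 0) :
    HasDerivAt (fun s : ℝ => energy α a b (fun t => f t + s • w t) (fun t => v t + s • w' t))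
      (-∫ p, (G.D (w p.1) : ℝ → ℝ) p.2 * ((1 + (G.D (f p.1) : ℝ → ℝ) p.2) ^ (-α - 1) *
        ((G.D (acc p.1) : ℝ → ℝ) p.2 - (α + 1) / 2 * (G.D (v p.1) : ℝ → ℝ) p.2 ^ 2 /
          (1 + (G.D (f p.1) : ℝ → ℝ) p.2))) ∂stripMeasure a b) 0 := by
  obtain ⟨β, hβ⟩ : ∃ β, β = -α - 1 := ⟨_, rfl⟩
  rw [← hβ]
  have hcf : ContinuousOn (fun t => G.D (f t)) (Icc a b) := G.DL.continuous.comp_continuousOn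
    fun t ht => continuousWithinAt_of_hasDerivWithinAt (hf.first t ht)
  have hcv : ContinuousOn (fun t => G.D (v t)) (Icc a b) := G.DL.continuous.comp_continuousOn
    fun t ht => continuousWithinAt_of_hasDerivWithinAt (hf.second.hasDeriv t ht)
  have hca : ContinuousOn (fun t => G.D (acc t)) (Icc a b) :=
    G.DL.continuous.comp_continuousOn hf.second.cont
  have hcw : ContinuousOn (fun t => G.D (w t)) (Icc a b) := G.DL.continuous.comp_continuousOn
    fun t ht => continuousWithinAt_of_hasDerivWithinAt (hw.first t ht)
  have hcw' : ContinuousOn (fun t => G.D (w' t)) (Icc a b) := G.DL.continuous.comp_continuousOn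
    fun t ht => continuousWithinAt_of_hasDerivWithinAt (hw.second.hasDeriv t ht)
  obtain ⟨c, hc, hlow⟩ := exists_uniform_lower isCompact_Icc hcf hpos
  obtain ⟨Cf, hCf⟩ := W.exists_seminorm_le isCompact_Icc hcf 1
  obtain ⟨Cv, hCv⟩ := W.exists_seminorm_le isCompact_Icc hcv 1
  obtain ⟨Cw, hCw⟩ := W.exists_seminorm_le isCompact_Icc hcw 1
  obtain ⟨Cz, hCz⟩ := W.exists_seminorm_le isCompact_Icc hcw' 1
  have hCw0 : 0 ≤ Cw := (apply_nonneg _ _).trans (hCw a (left_mem_Icc.2 hab))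
  have hCv0 : 0 ≤ Cv := (apply_nonneg _ _).trans (hCv a (left_mem_Icc.2 hab))
  have hCz0 : 0 ≤ Cz := (apply_nonneg _ _).trans (hCz a (left_mem_Icc.2 hab))
  obtain ⟨M, hM⟩ := exists_rpow_le β (c := c / 2) (C := 1 + Cf + Cw) (half_pos hc)
  obtain ⟨M', hM'⟩ := exists_rpow_le (β - 1) (c := c / 2) (C := 1 + Cf + Cw) (half_pos hc)
  -- for `|s| < ε` the factor `1 + f_x + s w_x` stays in a compact subset of `(0, ∞)`
  set ε := min 1 (c / (2 * (Cw + 1))) with hε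
  have hε0 : 0 < ε := lt_min one_pos (by positivity)
  have hs1 : ∀ s ∈ Metric.ball (0 : ℝ) ε, |s| ≤ 1 := fun s hs => by
    rw [mem_ball_zero_iff, Real.norm_eq_abs] at hs
    exact hs.le.trans (min_le_left _ _)
  have hmem : ∀ s ∈ Metric.ball (0 : ℝ) ε, ∀ p ∈ Icc a b ×ˢ (univ : Set ℝ),
      1 + (G.D (f p.1) : ℝ → ℝ) p.2 + s * (G.D (w p.1) : ℝ → ℝ) p.2 ∈
        Icc (c / 2) (1 + Cf + Cw) := by
    intro s hs p hp
    have h1 := hs1 s hs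
    rw [mem_ball_zero_iff, Real.norm_eq_abs] at hs
    have h2 : |(G.D (w p.1) : ℝ → ℝ) p.2| ≤ Cw := (W.abs_le _ _).trans (hCw _ hp.1)
    have h3 : |(G.D (f p.1) : ℝ → ℝ) p.2| ≤ Cf := (W.abs_le _ _).trans (hCf _ hp.1)
    have h4 : |s * (G.D (w p.1) : ℝ → ℝ) p.2| ≤ c / 2 := by
      rw [abs_mul]
      have h5 : |s| ≤ c / (2 * (Cw + 1)) := hs.le.trans (min_le_right _ _)
      calc |s| * |(G.D (w p.1) : ℝ → ℝ) p.2| ≤ c / (2 * (Cw + 1)) * (Cw + 1) :=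
            mul_le_mul h5 (h2.trans (by linarith)) (abs_nonneg _) (by positivity)
        _ = c / 2 := by field_simp
    have h5 : |s * (G.D (w p.1) : ℝ → ℝ) p.2| ≤ Cw := by
      rw [abs_mul]
      exact (mul_le_of_le_one_left (abs_nonneg _) h1).trans h2
    have h6 := hlow p.1 hp.1 p.2
    exact ⟨by linarith [(abs_le.1 h4).1], by linarith [(abs_le.1 h5).2, (abs_le.1 h3).2]⟩
  have hVZ : ∀ s ∈ Metric.ball (0 : ℝ) ε, ∀ p : ℝ × ℝ,
      |(G.D (v p.1) : ℝ → ℝ) p.2 + s * (G.D (w' p.1) : ℝ → ℝ) p.2| ≤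
        |(G.D (v p.1) : ℝ → ℝ) p.2| + |(G.D (w' p.1) : ℝ → ℝ) p.2| := fun s hs p => by
    refine (abs_add_le _ _).trans (add_le_add le_rfl ?_)
    rw [abs_mul]
    exact mul_le_of_le_one_left (abs_nonneg _) (hs1 s hs)
  have hg : ∀ p ∈ Icc a b ×ˢ (univ : Set ℝ),
      |(G.D (v p.1) : ℝ → ℝ) p.2| + |(G.D (w' p.1) : ℝ → ℝ) p.2| ≤ Cv + Cz := fun p hp =>
    add_le_add ((W.abs_le _ _).trans (hCv _ hp.1)) ((W.abs_le _ _).trans (hCz _ hp.1))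
  have hgi : Integrable (fun p : ℝ × ℝ => |(G.D (v p.1) : ℝ → ℝ) p.2| +
      |(G.D (w' p.1) : ℝ → ℝ) p.2|) (stripMeasure a b) :=
    (integrable_strip_curve hcv).abs.add (integrable_strip_curve hcw').abs
  have hPm : ∀ s ∈ Metric.ball (0 : ℝ) ε,
      AEStronglyMeasurable (energyDensity β f v w w' s) (stripMeasure a b) := fun s hs => by
    refine aestronglyMeasurable_strip (ContinuousOn.mul (ContinuousOn.rpow_const ?_ fun p hp =>
      Or.inl ((half_pos hc).trans_le (hmem s hs p hp).1).ne') (ContinuousOn.pow ?_ 2))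
    · exact (continuousOn_const.add (W.continuousOn_eval hcf)).add
        (continuousOn_const.mul (W.continuousOn_eval hcw))
    · exact (W.continuousOn_eval hcv).add (continuousOn_const.mul (W.continuousOn_eval hcw'))
  have hPi : ∀ s ∈ Metric.ball (0 : ℝ) ε,
      Integrable (energyDensity β f v w w' s) (stripMeasure a b) := fun s hs => by
    refine (hgi.const_mul (M * (Cv + Cz))).mono' (hPm s hs) ?_
    filter_upwards [ae_strip a b] with p hp
    rw [energyDensity, norm_mul, norm_pow, Real.norm_eq_abs, Real.norm_eq_abs, sq, mul_assoc]
    have h1 := hVZ s hs p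
    have h2 := hM _ (hmem s hs p hp)
    exact mul_le_mul h2 (mul_le_mul (h1.trans (hg p hp)) h1 (abs_nonneg _) (by positivity))
      (by positivity) ((abs_nonneg _).trans h2)
  have hE : ∀ s ∈ Metric.ball (0 : ℝ) ε,
      energy α a b (fun t => f t + s • w t) (fun t => v t + s • w' t) =
        (1 / 2) * ∫ p, energyDensity β f v w w' s p ∂stripMeasure a b := fun s hs => by
    have hi := hPi s hs
    rw [stripMeasure] at hi ⊢
    rw [integral_prod _ hi, energy, intervalIntegral.integral_of_le hab]
    refine congrArg _ (integral_congr_ae (Eventually.of_forall fun t => ?_))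
    refine integral_congr_ae (Eventually.of_forall fun x => ?_)
    have e : ∀ u z : G, deriv ((u + s • z : G) : ℝ → ℝ) x =
        (G.D u : ℝ → ℝ) x + s * (G.D z : ℝ → ℝ) x := fun u z => by
      rw [← G.D_apply, map_add, map_smul]
      rfl
    change (1 + deriv ((f t + s • w t : G) : ℝ → ℝ) x) ^ (-α - 1) *
      (deriv ((v t + s • w' t : G) : ℝ → ℝ) x * deriv ((v t + s • w' t : G) : ℝ → ℝ) x) =
        energyDensity β f v w w' s (t, x)
    rw [e, e, energyDensity, sq, add_assoc, hβ]
  let P' : ℝ → ℝ × ℝ → ℝ := fun s p =>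
    (G.D (w p.1) : ℝ → ℝ) p.2 * β *
      (1 + (G.D (f p.1) : ℝ → ℝ) p.2 + s * (G.D (w p.1) : ℝ → ℝ) p.2) ^ (β - 1) *
      ((G.D (v p.1) : ℝ → ℝ) p.2 + s * (G.D (w' p.1) : ℝ → ℝ) p.2) ^ 2 +
    (1 + (G.D (f p.1) : ℝ → ℝ) p.2 + s * (G.D (w p.1) : ℝ → ℝ) p.2) ^ β *
      (2 * ((G.D (v p.1) : ℝ → ℝ) p.2 + s * (G.D (w' p.1) : ℝ → ℝ) p.2) *
        (G.D (w' p.1) : ℝ → ℝ) p.2)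
  have hP'0 : ∀ p, P' 0 p = 2 * ((β / 2 * ((1 + (G.D (f p.1) : ℝ → ℝ) p.2) ^ (β - 1) *
        ((G.D (v p.1) : ℝ → ℝ) p.2 * (G.D (v p.1) : ℝ → ℝ) p.2)) * (G.D (w p.1) : ℝ → ℝ) p.2
      + (1 + (G.D (f p.1) : ℝ → ℝ) p.2) ^ β * (G.D (v p.1) : ℝ → ℝ) p.2 *
        (G.D (w' p.1) : ℝ → ℝ) p.2)) := fun p => by
    simp only [P', zero_mul, add_zero]
    ring
  have bv := BddStrip.of_curve hcv
  have b1 := (BddStrip.rpow hcf hpos (β - 1)).mul (bv.mul bv)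
  have b2 := (BddStrip.rpow hcf hpos β).mul bv
  have b3 := (BddStrip.rpow hcf hpos β).mul (BddStrip.of_curve hca)
  have i1 := (b1.const_mul (β / 2)).integrable_mul hcw
  have i2 := b2.integrable_mul hcw'
  have i3 := b3.integrable_mul hcw
  have hderiv := (hasDerivAt_integral_of_dominated_loc_of_deriv_le
    (μ := stripMeasure a b) (F := energyDensity β f v w w') (F' := P') (x₀ := 0)
    (bound := fun p => (Cw * |β| * M' * (Cv + Cz) + M * (2 * (Cv + Cz))) *
      (|(G.D (v p.1) : ℝ → ℝ) p.2| + |(G.D (w' p.1) : ℝ → ℝ) p.2|))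
    (Metric.ball_mem_nhds 0 hε0)
    ((Metric.ball_mem_nhds 0 hε0 : _ ∈ 𝓝 (0 : ℝ)) |> fun h => by
      filter_upwards [h] with s hs using hPm s hs)
    (hPi 0 (Metric.mem_ball_self hε0)) ?_ ?_ (hgi.const_mul _) ?_).2
  · refine ((hderiv.const_mul (1 / 2)).congr_of_eventuallyEq ?_).congr_deriv ?_
    · filter_upwards [Metric.ball_mem_nhds (0 : ℝ) hε0] with s hs using hE s hs
    · have hzero := integral_strip_eq_zero hab β hf hpos hw hwa hwb
      rw [integral_congr_ae (Eventually.of_forall hP'0), integral_const_mul, ← mul_assoc,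
        eq_neg_iff_add_eq_zero, one_div_mul_cancel two_ne_zero, one_mul]
      rw [← hzero]
      have e : ∀ p : ℝ × ℝ, (G.D (w p.1) : ℝ → ℝ) p.2 * ((1 + (G.D (f p.1) : ℝ → ℝ) p.2) ^ β *
        ((G.D (acc p.1) : ℝ → ℝ) p.2 - (α + 1) / 2 * (G.D (v p.1) : ℝ → ℝ) p.2 ^ 2 /
          (1 + (G.D (f p.1) : ℝ → ℝ) p.2))) =
          β / 2 * ((1 + (G.D (f p.1) : ℝ → ℝ) p.2) ^ (β - 1) *
            ((G.D (v p.1) : ℝ → ℝ) p.2 * (G.D (v p.1) : ℝ → ℝ) p.2)) *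
              (G.D (w p.1) : ℝ → ℝ) p.2 +
          (1 + (G.D (f p.1) : ℝ → ℝ) p.2) ^ β * (G.D (acc p.1) : ℝ → ℝ) p.2 *
            (G.D (w p.1) : ℝ → ℝ) p.2 := fun p => by
        have h0 : 1 + (G.D (f p.1) : ℝ → ℝ) p.2 ≠ 0 := by linarith [hpos p.1 p.2]
        rw [Real.rpow_sub_one h0 β, show α + 1 = -β by rw [hβ]; ring]
        field_simp
        ring
      have i12 := i1.add i2
      have i13 := i1.add i3
      simp only [Pi.add_def] at i12 i13
      rw [integral_congr_ae (Eventually.of_forall e), ← integral_add i12 i13]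
      refine integral_congr_ae (Eventually.of_forall fun p => ?_)
      ring
  · rw [funext hP'0]
    exact ((i1.add i2).const_mul 2).aestronglyMeasurable
  · filter_upwards [ae_strip a b] with p hp s hs
    have h1 := hVZ s hs p
    have h2 := hM _ (hmem s hs p hp)
    have h3 := hM' _ (hmem s hs p hp)
    have h4 := hg p hp
    have h5 : |(G.D (w p.1) : ℝ → ℝ) p.2| ≤ Cw := (W.abs_le _ _).trans (hCw _ hp.1)
    have hMn := (abs_nonneg _).trans h2
    have hMn' := (abs_nonneg _).trans h3
    refine (norm_add_le _ _).trans ?_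
    rw [add_mul]
    refine add_le_add ?_ ?_
    · rw [norm_mul, norm_mul, norm_mul, norm_pow, sq, mul_assoc _ (Cv + Cz)]
      simp only [Real.norm_eq_abs]
      exact mul_le_mul (mul_le_mul (mul_le_mul_of_nonneg_right h5 (abs_nonneg _)) h3
        (abs_nonneg _) (by positivity)) (mul_le_mul (h1.trans h4) h1 (abs_nonneg _) (by positivity))
        (by positivity) (by positivity)
    · rw [norm_mul, norm_mul, norm_mul, mul_assoc M]
      simp only [Real.norm_eq_abs, abs_two]
      refine mul_le_mul h2 (mul_le_mul (mul_le_mul_of_nonneg_left (h1.trans h4) zero_le_two)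
        (le_add_of_nonneg_left (abs_nonneg _)) (abs_nonneg _) (by positivity)) (by positivity) hMn
  · filter_upwards [ae_strip a b] with p hp s hs
    have h0 : 1 + (G.D (f p.1) : ℝ → ℝ) p.2 + s * (G.D (w p.1) : ℝ → ℝ) p.2 ≠ 0 :=
      ((half_pos hc).trans_le (hmem s hs p hp).1).ne'
    have d1 : HasDerivAt (fun s => 1 + (G.D (f p.1) : ℝ → ℝ) p.2 +
        s * (G.D (w p.1) : ℝ → ℝ) p.2) ((G.D (w p.1) : ℝ → ℝ) p.2) s := by
      simpa using ((hasDerivAt_id s).mul_const ((G.D (w p.1) : ℝ → ℝ) p.2)).const_add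
        (1 + (G.D (f p.1) : ℝ → ℝ) p.2)
    have d2 : HasDerivAt (fun s => (G.D (v p.1) : ℝ → ℝ) p.2 +
        s * (G.D (w' p.1) : ℝ → ℝ) p.2) ((G.D (w' p.1) : ℝ → ℝ) p.2) s := by
      simpa using ((hasDerivAt_id s).mul_const ((G.D (w' p.1) : ℝ → ℝ) p.2)).const_add
        ((G.D (v p.1) : ℝ → ℝ) p.2)
    refine ((d1.rpow_const (Or.inl h0)).mul (d2.fun_pow 2)).congr_deriv ?_
    simp only [P']
    push_cast
    ring

end Variation

/-! ### Geodesics -/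

/-- A `C²` function of time times a fixed vector is a `C²` curve. -/
theorem isC2CurveOn_smul {χ : ℝ → ℝ} (hχ : ContDiff ℝ ∞ χ) (g : G) {J : Set ℝ}
    (hJ : J.OrdConnected) : IsC2CurveOn (fun t => χ t • g) (fun t => deriv χ t • g)
      (fun t => deriv (deriv χ) t • g) J := by
  have key : ∀ {η : ℝ → ℝ}, ContDiff ℝ ∞ η →
      IsC1CurveOn (fun t => η t • g) (fun t => deriv η t • g) J := fun hη =>
    G.isC1_of_pointwise hJ (((contDiff_deriv hη).continuous.smul continuous_const).continuousOn)
      fun t _ x => ((diff_of hη t).hasDerivAt.mul_const _).hasDerivWithinAt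
  exact ⟨(key hχ).hasDeriv, key (contDiff_deriv hχ)⟩

/-- The fundamental lemma of the calculus of variations on the strip `[a, b] × ℝ`, for variations
which are `C²` curves in `𝔤`. -/
theorem eq_zero_of_integral_variation {a b : ℝ} (hab : a < b) {Q : ℝ × ℝ → ℝ}
    (hQ : BddStrip a b Q)
    (h : ∀ w w' w'' : ℝ → G, IsC2CurveOn w w' w'' (Icc a b) → w a = 0 → w b = 0 →
      ∫ p, (G.D (w p.1) : ℝ → ℝ) p.2 * Q p ∂stripMeasure a b = 0) :
    ∀ t ∈ Icc a b, ∀ x, Q (t, x) = 0 := by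
  suffices H : ∀ x, ∀ t ∈ Ioo a b, Q (t, x) = 0 from fun t ht x =>
    EqOn.of_subset_closure (s := Ioo a b) (H x) (hQ.1.comp
      (Continuous.prodMk_left x).continuousOn fun t ht => ⟨ht, trivial⟩) continuousOn_const
      Ioo_subset_Icc_self (closure_Ioo hab.ne).ge ht
  intro x t ht
  by_contra h0
  have hs : Icc a b ×ˢ (univ : Set ℝ) ∈ 𝓝 (t, x) :=
    prod_mem_nhds (Icc_mem_nhds ht.1 ht.2) univ_mem
  have hpos : ∀ᶠ p in 𝓝 (t, x), 0 < Q (t, x) * Q p :=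
    ((hQ.1.continuousAt hs).const_mul (Q (t, x))).eventually_const_lt (mul_self_pos.2 h0)
  obtain ⟨r₁, hr₁, H₁⟩ := Metric.eventually_nhds_iff_ball.1 hpos
  obtain ⟨r₂, hr₂, H₂⟩ := Metric.mem_nhds_iff.1 (Ioo_mem_nhds ht.1 ht.2)
  have hr : 0 < min r₁ r₂ := lt_min hr₁ hr₂
  let χ : ContDiffBump t := ⟨min r₁ r₂ / 2, min r₁ r₂, half_pos hr, half_lt_self hr⟩
  let ξ : ContDiffBump x := ⟨min r₁ r₂ / 2, min r₁ r₂, half_pos hr, half_lt_self hr⟩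
  have hout : ∀ s, s ∉ Ioo a b → χ s = 0 := fun s hs => χ.zero_of_le_dist <| by
    by_contra hlt
    exact hs (H₂ (Metric.ball_subset_ball (min_le_right _ _) (not_le.1 hlt)))
  -- the variation has `w_x = Q(t, x) χ ξ`, supported where `Q` has the sign of `Q(t, x)`
  let w : ℝ → G := fun s => χ s • W.prim (Q (t, x) • W.bump ξ)
  have hw := isC2CurveOn_smul χ.contDiff (W.prim (Q (t, x) • W.bump ξ))
    (ordConnected_Icc (a := a) (b := b))
  have hD : ∀ p : ℝ × ℝ, (G.D (w p.1) : ℝ → ℝ) p.2 * Q p =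
      χ p.1 * ξ p.2 * (Q (t, x) * Q p) := fun p => by
    have : (G.D (w p.1) : ℝ → ℝ) p.2 = χ p.1 * (Q (t, x) * ξ p.2) := by
      simp only [w, map_smul, G.D_prim]
      rfl
    rw [this]
    ring
  have hint := h w _ _ hw (by simp [w, hout a fun h => lt_irrefl _ h.1])
    (by simp [w, hout b fun h => lt_irrefl _ h.2])
  have hcw : ContinuousOn (fun s => G.D (w s)) (Icc a b) := G.DL.continuous.comp_continuousOn
    fun t ht => continuousWithinAt_of_hasDerivWithinAt (hw.first t ht)
  have hball : ∀ p : ℝ × ℝ, χ p.1 ≠ 0 → ξ p.2 ≠ 0 → 0 < Q (t, x) * Q p := fun p h1 h2 => by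
    refine H₁ p (Metric.ball_subset_ball (min_le_left r₁ r₂) ?_)
    rw [Metric.mem_ball, Prod.dist_eq]
    exact max_lt (not_le.1 fun h => h1 (χ.zero_of_le_dist h))
      (not_le.1 fun h => h2 (ξ.zero_of_le_dist h))
  have hnn : ∀ p, 0 ≤ (G.D (w p.1) : ℝ → ℝ) p.2 * Q p := fun p => by
    rw [hD]
    by_cases h1 : χ p.1 = 0
    · simp [h1]
    by_cases h2 : ξ p.2 = 0
    · simp [h2]
    exact mul_nonneg (mul_nonneg (χ.nonneg' _) (ξ.nonneg' _)) (hball p h1 h2).le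
  have hi := hQ.integrable_mul hcw
  simp only [mul_comm (Q _)] at hi
  have hae := (integral_eq_zero_iff_of_nonneg hnn hi).1 hint
  rw [stripMeasure_eq] at hae
  have hae' := (ae_restrict_iff' (measurableSet_Ioc.prod MeasurableSet.univ)).1 hae
  -- the integrand is positive on a ball around `(t, x)`, which has positive measure
  have hB := Metric.isOpen_ball.measure_pos (volume.prod volume)
    (Metric.nonempty_ball.2 hr : (Metric.ball (t, x) (min r₁ r₂)).Nonempty)
  refine hB.ne' (measure_mono_null (fun p hp => ?_) (ae_iff.1 hae'))
  refine fun hp0 => ?_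
  rw [Metric.mem_ball, Prod.dist_eq, max_lt_iff] at hp
  have h1 : χ p.1 ≠ 0 := (χ.pos_of_mem_ball hp.1).ne'
  have h2 : ξ p.2 ≠ 0 := (ξ.pos_of_mem_ball hp.2).ne'
  have h3 : p.1 ∈ Ioo a b := H₂ (Metric.ball_subset_ball (min_le_right _ _) hp.1)
  have h4 := hp0 ⟨Ioo_subset_Ioc_self h3, trivial⟩
  rw [Pi.zero_apply] at h4
  exact mul_ne_zero (mul_ne_zero h1 h2) (hball p h1 h2).ne' ((hD p).symm.trans h4)

/-- The geodesic equation `φ_ttx = (α + 1) / 2 · φ_tx² / φ_x`, on the closed time interval. -/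
theorem isGeodesic_iff (α : ℝ) {a b : ℝ} (hab : a < b) {φ : ℝ → DiffTilde} {v acc : ℝ → G}
    (h : IsC2CurveOn (fun t => disp (φ t)) v acc (Icc a b)) :
    IsGeodesic α a b φ v ↔ ∀ t ∈ Icc a b, ∀ x, geodesicDefect α φ v acc t x = 0 := by
  have hpos : ∀ t x, -1 < (G.D (disp (φ t)) : ℝ → ℝ) x := fun t => deriv_disp_gt (φ t)
  have hE := fun w w' w'' hw hwa hwb => hasDerivAt_energy (w := w) (w' := w') (w'' := w'')
    hab.le α h hpos hw hwa hwb
  have hcf : ContinuousOn (fun t => G.D (disp (φ t))) (Icc a b) :=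
    G.DL.continuous.comp_continuousOn
      fun t ht => continuousWithinAt_of_hasDerivWithinAt (h.first t ht)
  have hcv : ContinuousOn (fun t => G.D (v t)) (Icc a b) := G.DL.continuous.comp_continuousOn
    fun t ht => continuousWithinAt_of_hasDerivWithinAt (h.second.hasDeriv t ht)
  have hca : ContinuousOn (fun t => G.D (acc t)) (Icc a b) :=
    G.DL.continuous.comp_continuousOn h.second.cont
  have hdef : ∀ p : ℝ × ℝ, (G.D (acc p.1) : ℝ → ℝ) p.2 - (α + 1) / 2 *
      (G.D (v p.1) : ℝ → ℝ) p.2 ^ 2 / (1 + (G.D (disp (φ p.1)) : ℝ → ℝ) p.2) =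
      geodesicDefect α φ v acc p.1 p.2 := fun p => by
    rw [geodesicDefect, DiffTilde.deriv_eq]
    rfl
  simp only [hdef] at hE
  constructor
  · intro hg t ht x
    have bv := BddStrip.of_curve hcv
    have hQ : BddStrip a b fun p => (1 + (G.D (disp (φ p.1)) : ℝ → ℝ) p.2) ^ (-α - 1) *
        geodesicDefect α φ v acc p.1 p.2 := by
      have hb := ((BddStrip.of_curve hca).add ((((bv.mul bv)).mul
        (BddStrip.rpow hcf hpos (-1))).const_mul (-(α + 1) / 2)))
      convert (BddStrip.rpow hcf hpos (-α - 1)).mul hb using 3 with p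
      rw [← hdef, Real.rpow_neg_one]
      ring
    have h0 := eq_zero_of_integral_variation hab hQ (fun w w' w'' hw hwa hwb => by
      have := (hE w w' w'' hw hwa hwb).unique (hg w w' w'' hw hwa hwb)
      exact neg_eq_zero.1 this) t ht x
    refine (mul_eq_zero.1 h0).resolve_left (Real.rpow_pos_of_pos ?_ _).ne'
    linarith [hpos t x]
  · intro h0 w w' w'' hw hwa hwb
    refine (hE w w' w'' hw hwa hwb).congr_deriv ?_
    rw [neg_eq_zero]
    refine integral_eq_zero_of_ae ?_
    filter_upwards [ae_strip a b] with p hp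
    rw [h0 p.1 hp.1 p.2, mul_zero, mul_zero]
    rfl

theorem isGeodesic_iff_isGPJSolution (α : ℝ) {a b : ℝ} (hab : a < b) {φ : ℝ → DiffTilde}
    {v acc : ℝ → G} (h : IsC2CurveOn (fun t => disp (φ t)) v acc (Icc a b)) :
    IsGeodesic α a b φ v ↔ IsGPJSolution α (Icc a b) (eulerian φ v) :=
  (isGeodesic_iff α hab h).trans (isGPJSolution_eulerian_iff α hab h).symm

/-! ### The case `α = 1`: the explicit solution -/

theorem contDiff_exp_sub_one : ContDiff ℝ ∞ fun y : ℝ => Real.exp y - 1 :=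
  Real.contDiff_exp.sub contDiff_const

/-- `e^f - 1`, for `f ∈ W^{∞,1}(ℝ)`. -/
def W.expSubOne (f : W) : W := ⟨fun x => Real.exp ((f : ℝ → ℝ) x) - 1, by
  obtain ⟨C, hC⟩ := f.2.bdd
  have h0 : 0 ≤ C := (abs_nonneg _).trans (hC 0)
  exact f.2.superpose (Φ := fun y => Real.exp y - 1) isOpen_univ contDiff_exp_sub_one.contDiffOn
    (by simp) (subset_univ _)
    (show (0 : ℝ) ∈ Icc (-C) C from ⟨by linarith, h0⟩) fun x => _root_.abs_le.1 (hC x)⟩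

theorem W.expSubOne_apply (f : W) (x : ℝ) :
    (W.expSubOne f : ℝ → ℝ) x = Real.exp ((f : ℝ → ℝ) x) - 1 := rfl

theorem W.continuous_expSubOne : Continuous W.expSubOne := by
  refine continuous_superpose (h := id) continuous_id isOpen_univ (fun f => ?_)
    contDiff_exp_sub_one.contDiffOn (by simp) fun f x => rfl
  obtain ⟨C, hC⟩ := f.2.bdd
  have h0 : 0 ≤ C := (abs_nonneg _).trans (hC 0)
  refine ⟨-(C + 1), C + 1, ⟨by linarith, by linarith⟩, subset_univ _, ?_⟩
  filter_upwards [W.eventually_abs_sub_lt (tendsto_id (x := 𝓝 f)) one_pos] with g hg x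
  have h1 := abs_lt.1 (hg x)
  have h2 := _root_.abs_le.1 (hC x)
  exact ⟨by linarith [h1.1, h2.1], by linarith [h1.2, h2.2]⟩

/-- The geodesic `φ` with `φ_x = e^{t u₀'}` of the metric with `α = 1`. -/
def expFlow (u₀ : G) (t : ℝ) : DiffTilde :=
  DiffTilde.ofDisp (W.prim (W.expSubOne (t • G.D u₀))) fun x => by
    rw [W.deriv_prim, W.expSubOne_apply]
    linarith [Real.exp_pos (((t • G.D u₀ : W) : ℝ → ℝ) x)]

/-- The `x`-derivative `u₀' e^{t u₀'}` of the velocity of `expFlow u₀`. -/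
def expFlowVelocityDeriv (u₀ : G) (t : ℝ) : W :=
  G.D u₀ + W.mul (G.D u₀) (W.expSubOne (t • G.D u₀))

/-- The velocity of `expFlow u₀`. -/
def expFlowVelocity (u₀ : G) (t : ℝ) : G := W.prim (expFlowVelocityDeriv u₀ t)

theorem D_disp_expFlow (u₀ : G) (t : ℝ) :
    G.D (disp (expFlow u₀ t)) = W.expSubOne (t • G.D u₀) := by
  rw [expFlow, disp_ofDisp, G.D_prim]

theorem deriv_expFlow (u₀ : G) (t x : ℝ) :
    deriv (expFlow u₀ t).1 x = Real.exp (t * deriv (u₀ : ℝ → ℝ) x) := by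
  rw [DiffTilde.deriv_eq, ← G.D_apply, D_disp_expFlow, W.expSubOne_apply, add_sub_cancel]
  rfl

theorem expFlowVelocityDeriv_apply (u₀ : G) (t x : ℝ) :
    (expFlowVelocityDeriv u₀ t : ℝ → ℝ) x =
      deriv (u₀ : ℝ → ℝ) x * Real.exp (t * deriv (u₀ : ℝ → ℝ) x) := by
  change deriv (u₀ : ℝ → ℝ) x + deriv (u₀ : ℝ → ℝ) x *
    (Real.exp (t * deriv (u₀ : ℝ → ℝ) x) - 1) = _
  ring

theorem continuous_D_disp_expFlow :
    Continuous fun p : G × ℝ => W.expSubOne (p.2 • G.D p.1) :=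
  W.continuous_expSubOne.comp
    (continuous_snd.smul (G.DL.continuous.comp continuous_fst))

theorem continuous_expFlow : Continuous fun p : G × ℝ => disp (expFlow p.1 p.2) := by
  refine G.isInducing_D.continuous_iff.2 ?_
  simp only [Function.comp_def, D_disp_expFlow]
  exact continuous_D_disp_expFlow

theorem continuous_expFlowVelocityDeriv :
    Continuous fun p : G × ℝ => expFlowVelocityDeriv p.1 p.2 := by
  have h : Continuous fun p : G × ℝ => G.D p.1 := G.DL.continuous.comp continuous_fst
  exact h.add (W.continuous_mul.comp (h.prodMk continuous_D_disp_expFlow))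

theorem isC2CurveOn_expFlow (u₀ : G) {J : Set ℝ} (hJ : J.OrdConnected) :
    IsC2CurveOn (fun t => disp (expFlow u₀ t)) (expFlowVelocity u₀)
      (fun t => W.prim (W.mul (G.D u₀) (expFlowVelocityDeriv u₀ t))) J := by
  have hc := (continuous_expFlowVelocityDeriv.comp (Continuous.prodMk_right u₀)).continuousOn
    (s := J)
  have hc' : ContinuousOn (fun t => W.mul (G.D u₀) (expFlowVelocityDeriv u₀ t)) J :=
    W.continuous_mul.comp_continuousOn (continuousOn_const.prodMk hc)
  have hexp : ∀ t x, HasDerivAt (fun t => Real.exp (t * deriv (u₀ : ℝ → ℝ) x))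
      (deriv (u₀ : ℝ → ℝ) x * Real.exp (t * deriv (u₀ : ℝ → ℝ) x)) t := fun t x => by
    simpa [mul_comm] using ((hasDerivAt_id t).mul_const (deriv (u₀ : ℝ → ℝ) x)).exp
  refine ⟨fun t ht => G.hasDerivWithinAt_iff.2 ?_, fun t ht => G.hasDerivWithinAt_iff.2 ?_,
    W.continuous_prim.comp_continuousOn hc'⟩
  · simp only [D_disp_expFlow, expFlowVelocity, G.D_prim]
    refine W.isC1_of_pointwise hJ hc (fun t _ x => ?_) ht
    refine (((hexp t x).sub_const 1).congr_deriv ?_).hasDerivWithinAt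
    exact (expFlowVelocityDeriv_apply u₀ t x).symm
  · simp only [expFlowVelocity, G.D_prim]
    refine W.isC1_of_pointwise hJ hc' (fun t _ x => ?_) ht
    simp only [expFlowVelocityDeriv_apply, W.mul_apply, G.D_apply]
    exact ((hexp t x).const_mul _).hasDerivWithinAt

/-- The solution of the equation with `α = 1`. -/
def expSolution (u₀ : G) : ℝ → G := eulerian (expFlow u₀) (expFlowVelocity u₀)

/-- Since `φ_x = e^{t u₀'}`, both sides of `φ_ttx = φ_tx² / φ_x` are `u₀'² e^{t u₀'}`. -/
theorem isGPJSolution_expSolution (u₀ : G) {J : Set ℝ} (hJ : J.OrdConnected) :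
    IsGPJSolution 1 J (expSolution u₀) := by
  refine isGPJSolution_eulerian_of_geodesicDefect 1 hJ (isC2CurveOn_expFlow u₀ hJ) fun t _ x => ?_
  rw [geodesicDefect, expFlowVelocity, W.deriv_prim, W.deriv_prim, W.mul_apply,
    expFlowVelocityDeriv_apply, deriv_expFlow, G.D_apply]
  have := Real.exp_ne_zero (t * deriv (u₀ : ℝ → ℝ) x)
  field_simp
  ring

theorem expSolution_zero (u₀ : G) : expSolution u₀ 0 = u₀ := by
  have h1 : expFlow u₀ 0 = 1 := by
    refine Subtype.ext (Equiv.ext fun x => ?_)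
    change (expFlow u₀ 0).1 x = x
    rw [DiffTilde.apply_eq, expFlow, disp_ofDisp]
    simp [W.prim, W.expSubOne_apply]
  refine G.D_injective (Subtype.ext (funext fun x => ?_))
  rw [G.D_apply, expSolution, deriv_eulerian, h1, inv_one, expFlowVelocity, W.deriv_prim,
    expFlowVelocityDeriv_apply, zero_mul, Real.exp_zero, mul_one, ← h1, deriv_expFlow, zero_mul,
    Real.exp_zero, div_one, h1]
  rfl

theorem continuous_expSolution : Continuous fun p : G × ℝ => expSolution p.1 p.2 :=
  continuous_rightTranslate_inv (W.continuous_prim.comp continuous_expFlowVelocityDeriv)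
    continuous_expFlow

theorem expSolution_apply_expFlow (u₀ : G) (t x : ℝ) :
    (expSolution u₀ t : ℝ → ℝ) ((expFlow u₀ t).1 x) = (expFlowVelocity u₀ t : ℝ → ℝ) x := by
  change (expFlowVelocity u₀ t : ℝ → ℝ) ((expFlow u₀ t)⁻¹.1 ((expFlow u₀ t).1 x)) = _
  rw [DiffTilde.inv_apply]

/-! ### The case `α = 1`: uniqueness -/

/-- Grönwall's inequality for a seminorm along a `C¹` curve in `W^{∞,1}(ℝ)`. -/
theorem W.seminorm_eq_zero_of_deriv_le (k : ℕ) {F V : ℝ → W} {T K : ℝ}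
    (hF : ∀ t ∈ Icc 0 T, HasDerivWithinAt F (V t) (Icc 0 T) t) (h0 : F 0 = 0)
    (hV : ∀ t ∈ Icc 0 T, W.seminorm k (V t) ≤ K * W.seminorm k (F t)) :
    ∀ t ∈ Icc 0 T, W.seminorm k (F t) = 0 := by
  have h := le_gronwallBound_of_liminf_deriv_right_le (f := fun t => W.seminorm k (F t))
    (f' := fun t => W.seminorm k (V t)) (δ := 0) (K := K) (ε := 0) (a := 0) (b := T)
    ((W.continuous_seminorm k).comp_continuousOn fun t ht =>
      continuousWithinAt_of_hasDerivWithinAt (hF t ht)) (fun t ht r hr => ?_) (by simp [h0])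
    fun t ht => by simpa using hV t ⟨ht.1, ht.2.le⟩
  · intro t ht
    have := h t ht
    rw [gronwallBound_ε0_δ0] at this
    exact le_antisymm this (apply_nonneg _ _)
  · have h1 := hasDerivWithinAt_iff_tendsto.1 (hF t ⟨ht.1, ht.2.le⟩)
    have hsub : 𝓝[>] t ≤ 𝓝[Icc 0 T \ {t}] t := by
      rw [← nhdsWithin_Ioo_eq_nhdsGT ht.2]
      exact nhdsWithin_mono _ fun s hs => ⟨⟨ht.1.trans hs.1.le, hs.2.le⟩, hs.1.ne'⟩
    have h2 := (((W.continuous_seminorm k).tendsto _).comp (h1.mono_left hsub)).eventually_lt_const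
      hr
    refine Eventually.frequently ?_
    filter_upwards [h2, self_mem_nhdsWithin] with z hz hzt
    have hpos : 0 < z - t := sub_pos.2 hzt
    refine lt_of_le_of_lt ?_ hz
    simp only [Function.comp_apply]
    rw [map_smul_eq_mul, Real.norm_eq_abs, abs_of_pos (inv_pos.2 hpos)]
    exact mul_le_mul_of_nonneg_left ((le_abs_self _).trans (abs_sub_map_le_sub _ _ _)) (inv_pos.2 hpos).le

theorem disp_inv (φ : DiffTilde) : disp φ⁻¹ = -rightTranslate (disp φ) φ⁻¹ := by
  refine Subtype.ext (funext fun x => ?_)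
  change φ⁻¹.1 x - x = -(φ.1 (φ⁻¹.1 x) - φ⁻¹.1 x)
  rw [DiffTilde.apply_inv]
  ring

/-- Composition is continuous because inversion is, and `f ∘ φ = f ∘ (φ⁻¹)⁻¹`. -/
theorem continuousOn_comp {F : ℝ → W} {φ : ℝ → DiffTilde} {J : Set ℝ} (hF : ContinuousOn F J)
    (hφ : ContinuousOn (fun t => disp (φ t)) J) :
    ContinuousOn (fun t => W.comp (F t) (φ t)) J := by
  rw [continuousOn_iff_continuous_domRestrict] at hF hφ ⊢
  have h1 : Continuous fun t : J => disp (φ t)⁻¹ := by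
    simp only [disp_inv]
    exact (continuous_rightTranslate_inv hφ (φ := fun t : J => φ t) hφ).neg
  have h2 := continuous_comp_inv hF (φ := fun t : J => (φ t)⁻¹) h1
  simp only [inv_inv] at h2
  exact h2

/-- Uniqueness for `α = 1`. If `d` is the difference of the `x`-derivatives of a solution `u` and
of the explicit solution `S`, and `φ` is the flow of `S`, then `d ∘ φ` has time derivative
`-((u - S) u_xx) ∘ φ`, whose `L¹` norm is dominated by the one of `d ∘ φ`. -/
theorem eqOn_expSolution {T : ℝ} {u : ℝ → G} (hu : IsGPJSolution 1 (Icc 0 T) u) :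
    EqOn u (expSolution (u 0)) (Icc 0 T) := by
  set S := expSolution (u 0) with hS
  set φ := expFlow (u 0)
  obtain ⟨v, hv, hveq⟩ := hu
  obtain ⟨z, hz, hzeq⟩ := isGPJSolution_expSolution (u 0) (ordConnected_Icc (a := 0) (b := T))
  have hφ := isC2CurveOn_expFlow (u 0) (ordConnected_Icc (a := 0) (b := T))
  have cu : ContinuousOn u (Icc 0 T) := fun t ht =>
    continuousWithinAt_of_hasDerivWithinAt (hv.hasDeriv t ht)
  have cS : ContinuousOn S (Icc 0 T) := fun t ht =>
    continuousWithinAt_of_hasDerivWithinAt (hz.hasDeriv t ht)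
  have cφ : ContinuousOn (fun t => disp (φ t)) (Icc 0 T) := fun t ht =>
    continuousWithinAt_of_hasDerivWithinAt (hφ.first t ht)
  have cDφ := G.DL.continuous.comp_continuousOn cφ
  have cuxx : ContinuousOn (fun t => W.der (G.D (u t))) (Icc 0 T) :=
    (W.derL.continuous.comp G.DL.continuous).comp_continuousOn cu
  let V : ℝ → W := fun t => W.comp (-W.mulG (W.der (G.D (u t))) (u t - S t)) (φ t)
  have cV : ContinuousOn V (Icc 0 T) :=
    continuousOn_comp (W.continuous_mulG.comp_continuousOn (cuxx.prodMk (cu.sub cS))).neg cφ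
  have hderiv : ∀ t ∈ Icc 0 T,
      HasDerivWithinAt (fun s => W.comp (G.D (u s - S s)) (φ s)) (V t) (Icc 0 T) t := by
    intro t ht
    refine W.isC1_of_pointwise ordConnected_Icc cV (fun t ht x => ?_) ht
    have h1 := hasDerivWithinAt_along (f := fun s y => (G.D (u s) : ℝ → ℝ) y)
      (y := fun s => (φ s).1 x) (fun s y => W.hasDerivAt (G.D (u s)) y)
      ((W.continuousOn_eval cuxx) (t, (φ t).1 x) ⟨ht, trivial⟩)
      (W.hasDerivWithinAt_apply (hasDerivWithinAt_clm_comp G.DL (hv.hasDeriv t ht)) _)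
      (DiffTilde.hasDerivWithinAt_apply (hφ.first t ht) x)
    have h2 := hasDerivWithinAt_along (f := fun s y => (G.D (S s) : ℝ → ℝ) y)
      (y := fun s => (φ s).1 x) (fun s y => W.hasDerivAt (G.D (S s)) y)
      ((W.continuousOn_eval ((W.derL.continuous.comp G.DL.continuous).comp_continuousOn cS))
        (t, (φ t).1 x) ⟨ht, trivial⟩)
      (W.hasDerivWithinAt_apply (hasDerivWithinAt_clm_comp G.DL (hz.hasDeriv t ht)) _)
      (DiffTilde.hasDerivWithinAt_apply (hφ.first t ht) x)
    have e1 := (gpj_iff_integrated 1 _ _).1 (hveq t ht) ((φ t).1 x)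
    have e2 := (gpj_iff_integrated 1 _ _).1 (hzeq t ht) ((φ t).1 x)
    have e3 : (S t : ℝ → ℝ) ((φ t).1 x) = _ := expSolution_apply_expFlow (u 0) t x
    refine ((h1.sub h2).congr_deriv ?_).congr (fun s _ => ?_) ?_
    · change deriv (v t : ℝ → ℝ) ((φ t).1 x) + deriv (deriv (u t : ℝ → ℝ)) ((φ t).1 x) * _ -
        (deriv (z t : ℝ → ℝ) ((φ t).1 x) + deriv (deriv (S t : ℝ → ℝ)) ((φ t).1 x) * _) =
        -(deriv (deriv (u t : ℝ → ℝ)) ((φ t).1 x) *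
          ((u t : ℝ → ℝ) ((φ t).1 x) - (S t : ℝ → ℝ) ((φ t).1 x)))
      rw [← e3]
      linear_combination e1 - e2
    · rw [map_sub]; rfl
    · rw [map_sub]; rfl
  -- composition with `φ(t)` and with its inverse is bounded in `L¹`, uniformly in time
  obtain ⟨c, hc, hlow⟩ := exists_uniform_lower isCompact_Icc cDφ
    fun t x => deriv_disp_gt (φ t) x
  obtain ⟨K, hK⟩ := W.exists_seminorm_le isCompact_Icc cDφ 1
  obtain ⟨M, hM⟩ := W.exists_seminorm_le isCompact_Icc cuxx 0
  have hd : ∀ t ∈ Icc 0 T, W.seminorm 0 (G.D (u t - S t)) ≤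
      (1 + K) * W.seminorm 0 (W.comp (G.D (u t - S t)) (φ t)) := fun t ht => by
    have h1 := W.seminorm_zero_comp_inv_le (W.comp (G.D (u t - S t)) (φ t)) (φ t)
    have e : W.comp (W.comp (G.D (u t - S t)) (φ t)) (φ t)⁻¹ = G.D (u t - S t) := by
      refine Subtype.ext (funext fun x => ?_)
      rw [W.comp_apply, W.comp_apply, DiffTilde.apply_inv]
    rw [e] at h1
    exact h1.trans (mul_le_mul_of_nonneg_right (add_le_add le_rfl (hK t ht)) (apply_nonneg _ _))
  have hzero := W.seminorm_eq_zero_of_deriv_le 0 (K := c⁻¹ * (M * (1 + K))) hderiv ?_ ?_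
  · intro t ht
    have h1 := hd t ht
    rw [hzero t ht, mul_zero] at h1
    refine Subtype.ext (funext fun x => sub_eq_zero.1 (abs_nonpos_iff.1 ?_))
    exact (G.abs_le (u t - S t) x).trans h1
  · rw [hS, expSolution_zero, sub_self, map_zero]
    rfl
  · intro t ht
    refine (W.seminorm_zero_comp_le _ (φ t) hc fun x => ?_).trans ?_
    · rw [DiffTilde.deriv_eq]
      exact hlow t ht x
    · rw [mul_assoc, map_neg_eq_map]
      refine mul_le_mul_of_nonneg_left ?_ (inv_pos.2 hc).le
      refine (W.seminorm_zero_mulG_le _ _).trans ?_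
      rw [mul_assoc]
      exact mul_le_mul (hM t ht) (hd t ht) (apply_nonneg _ _)
        ((apply_nonneg _ _).trans (hM t ht))

theorem globallyWellPosed_one : GloballyWellPosed 1 :=
  ⟨expSolution, fun u₀ => ⟨expSolution_zero u₀, isGPJSolution_expSolution u₀ ordConnected_Ici⟩,
    fun _ _ _ _ h0 hu => h0 ▸ eqOn_expSolution hu, continuous_expSolution.continuousOn⟩

/-! ### The case `α ≠ 1`: blow-up -/

/-- The characteristics `η_t = u(t, η)` of a continuous curve `u` in `𝔤`. -/
theorem exists_characteristic {u : ℝ → G} {T : ℝ} (hT : 0 ≤ T) (hu : ContinuousOn u (Icc 0 T))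
    (x₀ : ℝ) : ∃ η : ℝ → ℝ, η 0 = x₀ ∧
      ∀ t ∈ Icc 0 T, HasDerivWithinAt η ((u t : ℝ → ℝ) (η t)) (Icc 0 T) t := by
  have cD := G.DL.continuous.comp_continuousOn hu
  obtain ⟨L, hL⟩ := W.exists_seminorm_le isCompact_Icc cD 0
  obtain ⟨K, hK⟩ := W.exists_seminorm_le isCompact_Icc cD 1
  have hL0 : 0 ≤ L := (apply_nonneg _ _).trans (hL 0 (left_mem_Icc.2 hT))
  have hK0 : 0 ≤ K := (apply_nonneg _ _).trans (hK 0 (left_mem_Icc.2 hT))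
  -- `u` is bounded by `L`, so that a curve cannot leave the ball of radius `L T`
  have hPL : IsPicardLindelof (fun t x => (u t : ℝ → ℝ) x) (⟨0, left_mem_Icc.2 hT⟩ : Icc 0 T) x₀
      ⟨L * T, mul_nonneg hL0 hT⟩ 0 ⟨L, hL0⟩ ⟨K, hK0⟩ := by
    refine ⟨fun t ht => (lipschitzWith_of_nnnorm_deriv_le (u t).2.1 fun x => ?_).lipschitzOnWith,
      fun x _ => (G.evalL x).continuous.comp_continuousOn hu, fun t ht x _ => ?_, ?_⟩
    · exact (W.abs_le (G.D (u t)) x).trans (hK t ht)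
    · exact (G.abs_le (u t) x).trans (hL t ht)
    · change L * max (T - 0) (0 - 0) ≤ L * T - 0
      rw [sub_zero, sub_zero, sub_zero, max_eq_left hT]
  exact hPL.exists_eq_forall_mem_Icc_hasDerivWithinAt₀

/-- Along a characteristic, `q = u_x` solves the Riccati equation `q' = (α - 1) / 2 · q²`. Hence
`q(t) (1 - t) = q(0)` if `q(0) = 2 / (α - 1)`, and the solution cannot live up to time one. -/
theorem not_isGPJSolution_of_deriv_eq {α : ℝ} (hα : α ≠ 1) {u : ℝ → G} {x₀ : ℝ}
    (h0 : deriv (u 0 : ℝ → ℝ) x₀ = 2 / (α - 1)) : ¬IsGPJSolution α (Icc 0 1) u := by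
  rintro ⟨v, hv, heq⟩
  have hα' : α - 1 ≠ 0 := sub_ne_zero.2 hα
  have cu : ContinuousOn u (Icc 0 1) := fun t ht =>
    continuousWithinAt_of_hasDerivWithinAt (hv.hasDeriv t ht)
  have cD := G.DL.continuous.comp_continuousOn cu
  obtain ⟨K, hK⟩ := W.exists_seminorm_le isCompact_Icc cD 1
  obtain ⟨η, hη0, hη⟩ := exists_characteristic zero_le_one cu x₀
  set q : ℝ → ℝ := fun t => deriv (u t : ℝ → ℝ) (η t) with hq
  have hq' : ∀ t ∈ Icc (0 : ℝ) 1, HasDerivWithinAt q ((α - 1) / 2 * q t ^ 2) (Icc 0 1) t := by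
    intro t ht
    have h1 := hasDerivWithinAt_along (f := fun s y => (G.D (u s) : ℝ → ℝ) y) (y := η)
      (fun s y => W.hasDerivAt (G.D (u s)) y)
      ((W.continuousOn_eval ((W.derL.continuous.comp G.DL.continuous).comp_continuousOn cu))
        (t, η t) ⟨ht, trivial⟩)
      (W.hasDerivWithinAt_apply (hasDerivWithinAt_clm_comp G.DL (hv.hasDeriv t ht)) _) (hη t ht)
    refine h1.congr_deriv ?_
    change deriv (v t : ℝ → ℝ) (η t) + deriv (deriv (u t : ℝ → ℝ)) (η t) *
      (u t : ℝ → ℝ) (η t) = (α - 1) / 2 * deriv (u t : ℝ → ℝ) (η t) ^ 2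
    linear_combination (gpj_iff_integrated α _ _).1 (heq t ht) (η t)
  -- `z` satisfies a linear homogeneous equation with `z(0) = 0`, but `z(1) = -2 / (α - 1)`
  set z : ℝ → ℝ := fun t => q t * (1 - t) - 2 / (α - 1) with hz
  have hz' : ∀ t ∈ Icc (0 : ℝ) 1,
      HasDerivWithinAt z ((α - 1) / 2 * q t * z t) (Icc 0 1) t := by
    intro t ht
    refine (((hq' t ht).mul ((hasDerivWithinAt_id t _).const_sub 1)).sub_const _).congr_deriv ?_
    simp only [hz, id]
    field_simp
    ring
  have hzero := eq_zero_of_abs_deriv_le_mul_abs_self_of_eq_zero_right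
    (f' := fun t => (α - 1) / 2 * q t * z t) (K := |(α - 1) / 2| * K)
    (fun t ht => (hz' t ht).continuousWithinAt)
    (fun t ht => (hz' t ⟨ht.1, ht.2.le⟩).mono_of_mem_nhdsWithin (Icc_mem_nhdsGE_of_mem ht))
    (by simp only [hz, hq, hη0, h0]; ring) (fun t ht => ?_) 1 (right_mem_Icc.2 zero_le_one)
  · simp only [hz, sub_self, mul_zero, zero_sub, neg_eq_zero] at hzero
    exact div_ne_zero two_ne_zero hα' hzero
  · rw [norm_mul, norm_mul]
    refine mul_le_mul_of_nonneg_right (mul_le_mul_of_nonneg_left ?_ (norm_nonneg _))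
      (norm_nonneg _)
    exact (W.abs_le (G.D (u t)) (η t)).trans (hK t ⟨ht.1, ht.2.le⟩)

theorem IsGPJSolution.mono {α : ℝ} {J J' : Set ℝ} {u : ℝ → G} (h : IsGPJSolution α J u)
    (hJ : J' ⊆ J) : IsGPJSolution α J' u := by
  obtain ⟨v, hv, heq⟩ := h
  refine ⟨v, ⟨fun t ht => ?_, hv.cont.mono hJ⟩, fun t ht => heq t (hJ ht)⟩
  have := hv.hasDeriv t (hJ ht)
  rw [hasDerivWithinAt_iff_tendsto] at this ⊢
  exact this.mono_left (nhdsWithin_mono _ (sdiff_subset_sdiff_left hJ))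

theorem GloballyWellPosed.eq_one {α : ℝ} (h : GloballyWellPosed α) : α = 1 := by
  by_contra hα
  obtain ⟨S, hS, -, -⟩ := h
  let b : ContDiffBump (0 : ℝ) := ⟨1, 2, one_pos, one_lt_two⟩
  have hb : b 0 = 1 := b.one_of_mem_closedBall (by simp [b])
  obtain ⟨h0, hsol⟩ := hS (W.prim ((2 / (α - 1)) • W.bump b))
  refine not_isGPJSolution_of_deriv_eq hα (x₀ := 0) ?_ (hsol.mono Icc_subset_Ici_self)
  rw [h0, W.deriv_prim]
  change 2 / (α - 1) * b 0 = _
  rw [hb, mul_one]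

end ProudmanJohnson

end

theorem mainTheorem6 (α : ℝ) :
    -- the metric is well defined and positive definite, and right-invariant only for `α = 0`
    ProudmanJohnson.IsWeakRiemannian α ∧
    (ProudmanJohnson.IsRightInvariant (ProudmanJohnson.alphaH1 α) ↔ α = 0) ∧
    -- it is the pullback of the Fisher–Rao metric under `φ ↦ φ^* λ = (φ⁻¹)_* λ`
    (∃ Θ : ProudmanJohnson.DiffTilde → ProudmanJohnson.DensTilde,
      (∀ φ : ProudmanJohnson.DiffTilde, (Θ φ).toMeasure =
        MeasureTheory.Measure.map ((φ⁻¹ : ProudmanJohnson.DiffTilde) : Equiv.Perm ℝ)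
          MeasureTheory.volume) ∧
      ProudmanJohnson.IsPullbackMetric (ProudmanJohnson.alphaH1 α)
        (ProudmanJohnson.alphaFisherRao α) Θ) ∧
    -- the geodesic equation, in terms of the Eulerian velocity, is the gPJ equation
    (∀ (a b : ℝ) (φ : ℝ → ProudmanJohnson.DiffTilde) (v acc : ℝ → ProudmanJohnson.G), a < b →
      ProudmanJohnson.IsC2CurveOn (fun t => ProudmanJohnson.disp (φ t)) v acc (Set.Icc a b) →
      (ProudmanJohnson.IsGeodesic α a b φ v ↔
        ProudmanJohnson.IsGPJSolution α (Set.Icc a b) (ProudmanJohnson.eulerian φ v))) ∧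
    (ProudmanJohnson.GloballyWellPosed α ↔ α = 1) := by
  open ProudmanJohnson in
  exact ⟨isWeakRiemannian α,
    ⟨eq_zero_of_isRightInvariant, fun h => h ▸ isRightInvariant_zero⟩,
    ⟨pullbackDensity, toMeasure_pullbackDensity, isPullbackMetric α⟩,
    fun _ _ _ _ _ hab h => isGeodesic_iff_isGPJSolution α hab h,
    ⟨GloballyWellPosed.eq_one, fun h => h ▸ globallyWellPosed_one⟩⟩
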